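/- **Theorem.** Let $n\ge 2$. A *stable nodal quilted disk with $n+1$ markings* is a finite collection of closed unit disks $D_v$, glued at pairs of boundary points (nodes) along a tree $T$, with boundary markings $z_0,\dots,z_n$; all nodes and markings on a component (its special points) are distinct. For a component $D_v$ and a marking $z_i$ let $z_{v,i}\in\partial D_v$ be the special point of $D_v$ in the direction of $z_i$ (the marking $z_i$ itself, or the node leading towards it). The following is required. * The markings are in counterclockwise cyclic order: if $i<j<k$ and $z_{v,i},z_{v,j},z_{v,k}$ are distinct, they are in counterclockwise order on $\partial D_v$. * Some components are quilted: they carry a seam, a circle $C_v\subset D_v$ of radius in $(0,1)$ tangent to $\partial D_v$ at $z_{v,0}$. For each $i\neq 0$ exactly one vertex on the path in $T$ from the component of $z_i$ to the component of $z_0$ is quilted. * Each quilted component has at least $2$ special points and each unquilted component at least $3$. An isomorphism consists of an isomorphism of trees and holomorphic isomorphisms of the corresponding components preserving nodes, markings and seams. Let $\overline M_{n,1}$ be the set of isomorphism classes. Put $$\rho_4(w_1,w_2,w_3,w_4)=\frac{(w_2-w_3)(w_4-w_1)}{(w_1-w_2)(w_3-w_4)} .$$ For $0\le i<j<k<l\le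 n$, the cross-ratio $\rho_{ijkl}(S)\in[-\infty,0]$ is $\rho_4(z_{v,i},z_{v,j},z_{v,k},z_{v,l})$ if there is a component $D_v$ at which these four points are distinct. Otherwise it is $-\infty$ if there is a component $D_v$ at which $z_{v,i},z_{v,j},z_{v,k}$ are distinct and $z_{v,k}=z_{v,l}$ (the tree separates $i,j$ from $k,l$), and $0$ in the remaining case (the tree separates $j,k$ from $i,l$). For $1\le i<j\le n$ let $D_v$ be the component at which $z_{v,0},z_{v,i},z_{v,j}$ are distinct. The quilted cross-ratio $\rho_{ij}(S)\in[0,\infty]$ is $\operatorname{Im}\rho_4(z_{v,i},z_{v,j},z_{v,0},w)$ for any $w\in C_v\setminus\{z_{v,0}\}$ if $D_v$ is quilted (this does not depend on $w$; identifying $D_v\setminus\{z_{v,0}\}$ with the closed upper half plane, it is the height of the line $C_v$ divided by $z_{v,j}-z_{v,i}$). It is $\infty$ if a quilted component lies strictly between $D_v$ and the root, that is, on the path from $D_v$ to the component containing $z_0$ and different from $D_v$. It is $0$ otherwise. Then the map $$\rho_{n,1}\colon \overline M_{n,1}\to[-\infty,0]^N\times[0,\infty]^{n(n-1)/2},\qquad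 N=\binom{n+1}{4},$$ given by all $\rho_{ijkl}$ with $0\le i<j<k<l\le n$ and all $\rho_{ij}$ with $1\le i<j\le n$, is well defined and injective, and its image is closed. Consequently $\overline M_{n,1}$, with the topology pulled back along $\rho_{n,1}$, is compact and Hausdorff. -/

import Mathlib

open Set Metric
open scoped ComplexConjugate

noncomputable section

namespace QuiltedDisk

/-! ### The closed unit disk: isomorphisms, cyclic order, cross-ratio -/

/-- A holomorphic isomorphism of the closed unit disk: a self-homeomorphism of the closed unit
disk which restricts to a biholomorphism of the open unit disk. (The values of the two functions
outside the closed disk play no role.) -/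
structure DiskIso where
  toFun : ℂ → ℂ
  invFun : ℂ → ℂ
  continuousOn_toFun : ContinuousOn toFun (closedBall 0 1)
  continuousOn_invFun : ContinuousOn invFun (closedBall 0 1)
  mapsTo_closedBall : MapsTo toFun (closedBall 0 1) (closedBall 0 1)
  mapsTo_closedBall_inv : MapsTo invFun (closedBall 0 1) (closedBall 0 1)
  left_inv : LeftInvOn invFun toFun (closedBall 0 1)
  right_inv : RightInvOn invFun toFun (closedBall 0 1)
  mapsTo_ball : MapsTo toFun (ball 0 1) (ball 0 1)
  mapsTo_ball_inv : MapsTo invFun (ball 0 1) (ball 0 1)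
  differentiableOn_toFun : DifferentiableOn ℂ toFun (ball 0 1)
  differentiableOn_invFun : DifferentiableOn ℂ invFun (ball 0 1)

namespace DiskIso

instance : CoeFun DiskIso (fun _ => ℂ → ℂ) := ⟨DiskIso.toFun⟩

/-- The identity. -/
def refl : DiskIso where
  toFun := id
  invFun := id
  continuousOn_toFun := continuousOn_id
  continuousOn_invFun := continuousOn_id
  mapsTo_closedBall := mapsTo_id _
  mapsTo_closedBall_inv := mapsTo_id _
  left_inv := fun _ _ => rfl
  right_inv := fun _ _ => rfl
  mapsTo_ball := mapsTo_id _
  mapsTo_ball_inv := mapsTo_id _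
  differentiableOn_toFun := differentiableOn_id
  differentiableOn_invFun := differentiableOn_id

/-- The inverse. -/
def symm (f : DiskIso) : DiskIso where
  toFun := f.invFun
  invFun := f.toFun
  continuousOn_toFun := f.continuousOn_invFun
  continuousOn_invFun := f.continuousOn_toFun
  mapsTo_closedBall := f.mapsTo_closedBall_inv
  mapsTo_closedBall_inv := f.mapsTo_closedBall
  left_inv := f.right_inv
  right_inv := f.left_inv
  mapsTo_ball := f.mapsTo_ball_inv
  mapsTo_ball_inv := f.mapsTo_ball
  differentiableOn_toFun := f.differentiableOn_invFun
  differentiableOn_invFun := f.differentiableOn_toFun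

/-- The composition, first `f`, then `g`. -/
def trans (f g : DiskIso) : DiskIso where
  toFun := g.toFun ∘ f.toFun
  invFun := f.invFun ∘ g.invFun
  continuousOn_toFun := g.continuousOn_toFun.comp f.continuousOn_toFun f.mapsTo_closedBall
  continuousOn_invFun :=
    f.continuousOn_invFun.comp g.continuousOn_invFun g.mapsTo_closedBall_inv
  mapsTo_closedBall := g.mapsTo_closedBall.comp f.mapsTo_closedBall
  mapsTo_closedBall_inv := f.mapsTo_closedBall_inv.comp g.mapsTo_closedBall_inv
  left_inv := fun z hz => by
    change f.invFun (g.invFun (g.toFun (f.toFun z))) = z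
    rw [g.left_inv (f.mapsTo_closedBall hz), f.left_inv hz]
  right_inv := fun z hz => by
    change g.toFun (f.toFun (f.invFun (g.invFun z))) = z
    rw [f.right_inv (g.mapsTo_closedBall_inv hz), g.right_inv hz]
  mapsTo_ball := g.mapsTo_ball.comp f.mapsTo_ball
  mapsTo_ball_inv := f.mapsTo_ball_inv.comp g.mapsTo_ball_inv
  differentiableOn_toFun :=
    g.differentiableOn_toFun.comp f.differentiableOn_toFun f.mapsTo_ball
  differentiableOn_invFun :=
    f.differentiableOn_invFun.comp g.differentiableOn_invFun g.mapsTo_ball_inv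

end DiskIso

/-- Three points of the unit circle are in counterclockwise cyclic order (in particular they are
distinct): the triangle `a b c` is positively oriented. -/
def CCW (a b c : Circle) : Prop :=
  0 < (conj ((b : ℂ) - a) * ((c : ℂ) - a)).im

/-- The cross-ratio
`ρ₄(w₁,w₂,w₃,w₄) = (w₂ - w₃)(w₄ - w₁) / ((w₁ - w₂)(w₃ - w₄))`. -/
def crossRatio (w₁ w₂ w₃ w₄ : ℂ) : ℂ :=
  ((w₂ - w₃) * (w₄ - w₁)) / ((w₁ - w₂) * (w₃ - w₄))

theorem normSq_one_add_sub (a z : ℂ) :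
    Complex.normSq (1 + conj a * z) - Complex.normSq (z + a) =
      (1 - Complex.normSq a) * (1 - Complex.normSq z) := by
  simp [Complex.normSq_apply]
  ring

theorem one_add_conj_mul_ne_zero {a z : ℂ} (ha : ‖a‖ < 1) (hz : ‖z‖ ≤ 1) :
    1 + conj a * z ≠ 0 := by
  intro h
  have h1 : conj a * z = -1 := by linear_combination h
  have h2 : ‖a‖ * ‖z‖ = 1 := by
    rw [← RCLike.norm_conj a, ← norm_mul, h1]; simp
  nlinarith [norm_nonneg a, norm_nonneg z]

/-- A disk automorphism `z ↦ (z + a) / (1 + conj a * z)`. -/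
def blaschke (a z : ℂ) : ℂ := (z + a) / (1 + conj a * z)

theorem norm_blaschke_lt {a z : ℂ} (ha : ‖a‖ < 1) (hz : ‖z‖ < 1) : ‖blaschke a z‖ < 1 := by
  have h0 := one_add_conj_mul_ne_zero ha hz.le
  rw [blaschke, norm_div, div_lt_one (norm_pos_iff.2 h0)]
  have h := normSq_one_add_sub a z
  simp only [Complex.normSq_eq_norm_sq] at h
  have h1 : 0 < (1 - ‖a‖ ^ 2) * (1 - ‖z‖ ^ 2) := by
    apply mul_pos <;> nlinarith [norm_nonneg a, norm_nonneg z]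
  exact lt_of_pow_lt_pow_left₀ 2 (norm_nonneg _) (by linarith)

theorem differentiableOn_blaschke {a : ℂ} (ha : ‖a‖ < 1) :
    DifferentiableOn ℂ (blaschke a) (ball 0 1) := by
  intro z hz
  have h0 := one_add_conj_mul_ne_zero ha (mem_ball_zero_iff.1 hz).le
  unfold blaschke
  exact DifferentiableAt.differentiableWithinAt (by fun_prop (disch := exact h0))

theorem blaschke_neg_blaschke {a z : ℂ} (ha : ‖a‖ < 1) (hz : ‖z‖ < 1) :
    blaschke a (blaschke (-a) z) = z := by
  have h0 := one_add_conj_mul_ne_zero (a := -a) (by simpa using ha) hz.le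
  have h1 := one_add_conj_mul_ne_zero ha
    (norm_blaschke_lt (a := -a) (by simpa using ha) hz).le
  rw [map_neg] at h0
  rw [blaschke, div_eq_iff h1]
  simp only [blaschke, map_neg]
  rw [mul_add, mul_one, mul_div_assoc', mul_div_assoc', div_add' _ _ _ h0, add_div' _ _ _ h0]
  congr 1
  ring

/-- Holomorphic isomorphisms of the closed disk are fractional linear. -/
theorem DiskIso.exists_eq (f : DiskIso) : ∃ a c : ℂ, ‖a‖ < 1 ∧ ‖c‖ = 1 ∧
    ∀ z ∈ closedBall (0 : ℂ) 1, f z = c * blaschke a z := by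
  obtain ⟨b, hb⟩ : ∃ b, b = f.invFun 0 := ⟨_, rfl⟩
  have hb1 : ‖b‖ < 1 := by
    rw [hb]; simpa using f.mapsTo_ball_inv (mem_ball_self (x := (0 : ℂ)) one_pos)
  have hb1' : ‖-b‖ < 1 := by simpa using hb1
  have hfb : f b = 0 := by rw [hb]; exact f.right_inv (by simp)
  have hm : MapsTo (blaschke b) (ball 0 1) (ball 0 1) := fun z hz => by
    simp only [mem_ball_zero_iff] at *; exact norm_blaschke_lt hb1 hz
  have hm' : MapsTo (blaschke (-b)) (ball 0 1) (ball 0 1) := fun z hz => by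
    simp only [mem_ball_zero_iff] at *; exact norm_blaschke_lt hb1' hz
  have hg : DifferentiableOn ℂ (fun z => f (blaschke b z)) (ball 0 1) :=
    f.differentiableOn_toFun.comp (differentiableOn_blaschke hb1) hm
  have hg' : DifferentiableOn ℂ (fun z => blaschke (-b) (f.invFun z)) (ball 0 1) :=
    (differentiableOn_blaschke hb1').comp f.differentiableOn_invFun f.mapsTo_ball_inv
  have hgm : MapsTo (fun z => f (blaschke b z)) (ball 0 1) (closedBall 0 1) :=
    fun z hz => ball_subset_closedBall (f.mapsTo_ball (hm hz))
  have hgm' : MapsTo (fun z => blaschke (-b) (f.invFun z)) (ball 0 1) (closedBall 0 1) :=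
    fun z hz => ball_subset_closedBall (hm' (f.mapsTo_ball_inv hz))
  have hg0 : f (blaschke b 0) = 0 := by simp [blaschke, hfb]
  have hg0' : blaschke (-b) (f.invFun 0) = 0 := by rw [← hb]; simp [blaschke]
  have key : ‖f (blaschke b (1/2))‖ = ‖(1/2 : ℂ)‖ := by
    have hz : (1/2 : ℂ) ∈ ball (0 : ℂ) 1 := by simp; norm_num
    apply le_antisymm
    · exact Complex.norm_le_norm_of_mapsTo_ball hg hgm hg0 (by simpa using hz)
    · have h := Complex.norm_le_norm_of_mapsTo_ball hg' hgm' hg0'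
        (z := f (blaschke b (1/2))) (by simpa using f.mapsTo_ball (hm hz))
      have h2 : f.invFun (f (blaschke b (1/2))) = blaschke b (1/2) :=
        f.left_inv (ball_subset_closedBall (hm hz))
      have h3 := blaschke_neg_blaschke hb1' (z := 1/2) (by simpa using hz)
      rw [neg_neg] at h3
      simpa only [h2, h3] using h
  obtain ⟨c, hc, hgc⟩ := Complex.affine_of_mapsTo_ball_of_exists_norm_dslope_eq_div' (c := 0)
    (R₁ := 1) (R₂ := 1) hg (by simpa only [hg0] using hgm) ⟨1/2, by simp; norm_num, by
      rw [dslope_of_ne _ (by norm_num), slope_def_module]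
      simp only [hg0, sub_zero, norm_smul, norm_inv, key]
      norm_num⟩
  refine ⟨-b, c, hb1', by simpa using hc, ?_⟩
  have hball : EqOn f (fun z => c * blaschke (-b) z) (ball 0 1) := by
    intro z hz
    have h := hgc (hm' hz)
    have h3 := blaschke_neg_blaschke hb1 (z := z) (by simpa using hz)
    simp only [h3, hg0, zero_add, sub_zero, smul_eq_mul] at h
    rw [h, mul_comm]
  refine hball.of_subset_closure f.continuousOn_toFun ?_ ball_subset_closedBall
    (by rw [closure_ball _ one_ne_zero])
  refine continuousOn_const.mul (ContinuousOn.div (by fun_prop) (by fun_prop) fun z hz => ?_)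
  exact one_add_conj_mul_ne_zero hb1' (by simpa using hz)

/-- The cross-ratio is invariant under isomorphisms of the disk. -/
theorem DiskIso.crossRatio_eq (f : DiskIso) {w₁ w₂ w₃ w₄ : ℂ} (h₁ : ‖w₁‖ ≤ 1) (h₂ : ‖w₂‖ ≤ 1)
    (h₃ : ‖w₃‖ ≤ 1) (h₄ : ‖w₄‖ ≤ 1) :
    crossRatio (f w₁) (f w₂) (f w₃) (f w₄) = crossRatio w₁ w₂ w₃ w₄ := by
  obtain ⟨a, c, ha, hc, hf⟩ := f.exists_eq
  have ha' : 1 - conj a * a ≠ 0 := by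
    have := one_add_conj_mul_ne_zero (a := a) (z := -a) ha (by simpa using ha.le)
    intro h; apply this; linear_combination h
  have hc' : c ≠ 0 := by rintro rfl; simp at hc
  have hd : ∀ {z w : ℂ}, ‖z‖ ≤ 1 → ‖w‖ ≤ 1 → f z - f w =
      c * (1 - conj a * a) * (z - w) / ((1 + conj a * z) * (1 + conj a * w)) := by
    intro z w hz hw
    rw [hf z (by simpa using hz), hf w (by simpa using hw)]
    have h1 := one_add_conj_mul_ne_zero ha hz
    have h2 := one_add_conj_mul_ne_zero ha hw
    simp only [blaschke]
    rw [← mul_sub, div_sub_div _ _ h1 h2, mul_div_assoc']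
    congr 1
    ring
  have e₁ := one_add_conj_mul_ne_zero ha h₁
  have e₂ := one_add_conj_mul_ne_zero ha h₂
  have e₃ := one_add_conj_mul_ne_zero ha h₃
  have e₄ := one_add_conj_mul_ne_zero ha h₄
  simp only [crossRatio]
  rw [hd h₂ h₃, hd h₄ h₁, hd h₁ h₂, hd h₃ h₄]
  rw [show ∀ A B : ℂ, c * (1 - conj a * a) * A / ((1 + conj a * w₂) * (1 + conj a * w₃)) *
      (c * (1 - conj a * a) * B / ((1 + conj a * w₄) * (1 + conj a * w₁))) =
      (c * (1 - conj a * a)) ^ 2 / ((1 + conj a * w₁) * (1 + conj a * w₂) *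
        (1 + conj a * w₃) * (1 + conj a * w₄)) * (A * B) by intro A B; field_simp,
    show ∀ A B : ℂ, c * (1 - conj a * a) * A / ((1 + conj a * w₁) * (1 + conj a * w₂)) *
      (c * (1 - conj a * a) * B / ((1 + conj a * w₃) * (1 + conj a * w₄))) =
      (c * (1 - conj a * a)) ^ 2 / ((1 + conj a * w₁) * (1 + conj a * w₂) *
        (1 + conj a * w₃) * (1 + conj a * w₄)) * (A * B) by intro A B; field_simp]
  exact mul_div_mul_left _ _ (by positivity)

/-! ### Nodal disks -/

/-- A nodal disk with boundary markings `z₀, …, zₙ`: a finite collection of closed unit disks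
`D_v`, `v : V`, glued along a tree. For adjacent `u`, `v` the boundary point `node u v` of `D_u`
is identified with the boundary point `node v u` of `D_v`. The marking `zᵢ` is the boundary point
`mark i` of the disk `D_v`, `v = comp i`. All nodes and markings on a disk are distinct. (The
value `node u v` plays no role unless `u` and `v` are adjacent.) -/
structure NodalDisk (n : ℕ) where
  V : Type
  finite : Finite V
  graph : SimpleGraph V
  isTree : graph.IsTree
  node : V → V → Circle
  comp : Fin (n + 1) → V
  mark : Fin (n + 1) → Circle
  node_inj : ∀ {u v v' : V}, graph.Adj u v → graph.Adj u v' → node u v = node u v' → v = v'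
  mark_inj : ∀ {i j : Fin (n + 1)}, comp i = comp j → mark i = mark j → i = j
  node_ne_mark : ∀ {u v : V} {i : Fin (n + 1)}, graph.Adj u v → comp i = u → node u v ≠ mark i

namespace NodalDisk

variable {n : ℕ} (S : NodalDisk n)

/-- The unique path in the tree between two vertices. -/
def path (u v : S.V) : S.graph.Walk u v := (S.isTree.existsUnique_path u v).choose

open Classical in
/-- The special point `z_{v,i}` of the disk `D_v` in the direction of the marking `zᵢ`: the
marking `zᵢ` itself if it lies on `D_v`, and otherwise the node of `D_v` through which the path
in the tree from `v` to the component of `zᵢ` leaves `v`. -/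
def branch (v : S.V) (i : Fin (n + 1)) : Circle :=
  if S.comp i = v then S.mark i else S.node v (S.path v (S.comp i)).snd

/-- The number of special points (nodes and markings) on the disk `D_v`. -/
def numSpecial (v : S.V) : ℕ :=
  (S.graph.neighborSet v).ncard + {i | S.comp i = v}.ncard

/-- The markings `z₀, …, zₙ` are in counterclockwise order around the boundary of the nodal disk:
whenever three of them lie on three different branches at a component, these branches occur on
its boundary in the corresponding cyclic order. -/
def Ordered : Prop :=
  ∀ (v : S.V) (i j k : Fin (n + 1)), i < j → j < k →
    S.branch v i ≠ S.branch v j → S.branch v j ≠ S.branch v k → S.branch v i ≠ S.branch v k →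
    CCW (S.branch v i) (S.branch v j) (S.branch v k)

end NodalDisk

/-- A stable nodal quilted disk with markings `z₀, …, zₙ`. The components in `quilted` (the
colored vertices of the tree) carry a seam, see `seam`; `radius v` is its radius (the value
plays no role on the other components). -/
structure StableQuiltedDisk (n : ℕ) extends NodalDisk n where
  ordered : toNodalDisk.Ordered
  quilted : Set V
  radius : V → ℝ
  radius_mem : ∀ v ∈ quilted, 0 < radius v ∧ radius v < 1
  /-- On the path from any leaf to the root there is exactly one colored vertex. -/
  colored : ∀ i : Fin (n + 1), i ≠ 0 →
    ∃! v, v ∈ quilted ∧ v ∈ (toNodalDisk.path (comp i) (comp 0)).support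
  stable_quilted : ∀ v ∈ quilted, 2 ≤ toNodalDisk.numSpecial v
  stable_unquilted : ∀ v ∉ quilted, 3 ≤ toNodalDisk.numSpecial v

namespace StableQuiltedDisk

variable {n : ℕ}

/-- The seam of a quilted component `D_v`: the circle of radius `radius v` in the closed unit
disk which is tangent to the boundary at the special point in the direction of `z₀`. -/
def seam (S : StableQuiltedDisk n) (v : S.V) : Set ℂ :=
  sphere ((1 - (S.radius v : ℂ)) * (S.branch v 0 : ℂ)) (S.radius v)

/-- An isomorphism of stable nodal quilted disks: an isomorphism of trees and holomorphic
isomorphisms between corresponding components, which preserve the nodes, the markings, the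
quilted components and their seams. -/
structure Iso (S S' : StableQuiltedDisk n) where
  tree : S.graph ≃g S'.graph
  disk : S.V → DiskIso
  map_node : ∀ {u v : S.V}, S.graph.Adj u v → disk u (S.node u v) = S'.node (tree u) (tree v)
  map_comp : ∀ i, tree (S.comp i) = S'.comp i
  map_mark : ∀ i, disk (S.comp i) (S.mark i) = S'.mark i
  map_quilted : ∀ v, v ∈ S.quilted ↔ tree v ∈ S'.quilted
  map_seam : ∀ v ∈ S.quilted, disk v '' S.seam v = S'.seam (tree v)

theorem coe_mem_closedBall (p : Circle) : (p : ℂ) ∈ closedBall (0 : ℂ) 1 := by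
  rw [mem_closedBall_zero_iff, Circle.norm_coe]

theorem seam_subset (S : StableQuiltedDisk n) {v : S.V} (hv : v ∈ S.quilted) :
    S.seam v ⊆ closedBall 0 1 := by
  intro w hw
  obtain ⟨h0, h1⟩ := S.radius_mem v hv
  have h2 : ‖w - (1 - (S.radius v : ℂ)) * (S.branch v 0 : ℂ)‖ = S.radius v := by
    simpa [seam, dist_eq_norm] using hw
  have h3 : ‖(1 - (S.radius v : ℂ)) * (S.branch v 0 : ℂ)‖ = 1 - S.radius v := by
    rw [norm_mul, Circle.norm_coe, mul_one, ← Complex.ofReal_one, ← Complex.ofReal_sub,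
      Complex.norm_real, Real.norm_of_nonneg (by linarith)]
  rw [mem_closedBall_zero_iff]
  calc ‖w‖ = ‖(w - (1 - (S.radius v : ℂ)) * (S.branch v 0 : ℂ)) +
        (1 - (S.radius v : ℂ)) * (S.branch v 0 : ℂ)‖ := by rw [sub_add_cancel]
    _ ≤ _ := norm_add_le _ _
    _ = 1 := by rw [h2, h3]; ring

/-- The identity isomorphism. -/
def Iso.refl (S : StableQuiltedDisk n) : Iso S S where
  tree := SimpleGraph.Iso.refl
  disk _ := DiskIso.refl
  map_node _ := rfl
  map_comp _ := rfl
  map_mark _ := rfl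
  map_quilted _ := Iff.rfl
  map_seam v _ := by simp [DiskIso.refl]

/-- The inverse isomorphism. -/
def Iso.symm {S S' : StableQuiltedDisk n} (f : Iso S S') : Iso S' S where
  tree := f.tree.symm
  disk v := (f.disk (f.tree.symm v)).symm
  map_node {u v} h := by
    have h1 := f.map_node (f.tree.symm.map_rel_iff.2 h)
    rw [RelIso.apply_symm_apply, RelIso.apply_symm_apply] at h1
    change (f.disk (f.tree.symm u)).invFun _ = _
    rw [← h1]
    exact (f.disk _).left_inv (coe_mem_closedBall _)
  map_comp i := by rw [← f.map_comp, RelIso.symm_apply_apply]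
  map_mark i := by
    have h : f.tree.symm (S'.comp i) = S.comp i := by
      rw [← f.map_comp, RelIso.symm_apply_apply]
    rw [h]
    change (f.disk (S.comp i)).invFun _ = _
    rw [← f.map_mark i]
    exact (f.disk _).left_inv (coe_mem_closedBall _)
  map_quilted v := by rw [f.map_quilted, RelIso.apply_symm_apply]
  map_seam v hv := by
    have hq : f.tree.symm v ∈ S.quilted := by rwa [f.map_quilted, RelIso.apply_symm_apply]
    have h := f.map_seam (f.tree.symm v) hq
    rw [RelIso.apply_symm_apply] at h
    rw [← h]
    exact ((f.disk (f.tree.symm v)).left_inv.mono (S.seam_subset hq)).image_image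

/-- The composition of two isomorphisms. -/
def Iso.trans {S S' S'' : StableQuiltedDisk n} (f : Iso S S') (g : Iso S' S'') : Iso S S'' where
  tree := f.tree.trans g.tree
  disk v := (f.disk v).trans (g.disk (f.tree v))
  map_node {u v} h := by
    change g.disk (f.tree u) (f.disk u (S.node u v)) = _
    rw [f.map_node h, g.map_node (f.tree.map_rel_iff.2 h)]
    rfl
  map_comp i := by
    change g.tree (f.tree _) = _
    rw [f.map_comp, g.map_comp]
  map_mark i := by
    change g.disk (f.tree (S.comp i)) (f.disk (S.comp i) (S.mark i)) = _
    rw [f.map_mark, f.map_comp, g.map_mark]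
  map_quilted v := by
    rw [f.map_quilted, g.map_quilted]
    rfl
  map_seam v hv := by
    change (g.disk (f.tree v) ∘ f.disk v) '' _ = S''.seam (g.tree (f.tree v))
    rw [image_comp, f.map_seam v hv, g.map_seam _ ((f.map_quilted v).1 hv)]

instance setoid (n : ℕ) : Setoid (StableQuiltedDisk n) where
  r S S' := Nonempty (Iso S S')
  iseqv := ⟨fun S => ⟨Iso.refl S⟩, fun ⟨f⟩ => ⟨f.symm⟩, fun ⟨f⟩ ⟨g⟩ => ⟨f.trans g⟩⟩

theorem Iso.map_branch {S S' : StableQuiltedDisk n} (f : Iso S S') (v : S.V) (i : Fin (n + 1)) :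
    f.disk v (S.branch v i) = S'.branch (f.tree v) i := by
  have hc := f.map_comp i
  have hp : (S.path v (S.comp i)).IsPath :=
    (S.isTree.existsUnique_path v (S.comp i)).choose_spec.1
  unfold NodalDisk.branch
  by_cases h : S.comp i = v
  · subst h
    rw [if_pos rfl, if_pos hc.symm, f.map_mark]
  · have h' : S'.comp i ≠ f.tree v := by
      rw [← hc]; exact fun e => h (f.tree.injective e)
    rw [if_neg h, if_neg h', f.map_node]
    · have hq := (S'.isTree.existsUnique_path (f.tree v) (S'.comp i)).choose_spec.2
        (((S.path v (S.comp i)).map f.tree.toHom).copy rfl hc)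
        (by simpa using SimpleGraph.Walk.IsPath.map f.tree.injective hp)
      have hq' : ((S.path v (S.comp i)).map f.tree.toHom).copy rfl hc =
        S'.path (f.tree v) (S'.comp i) := hq
      rw [← hq']
      congr 2
      simp [SimpleGraph.Walk.snd]
    · exact SimpleGraph.Walk.adj_snd (fun hn => h (SimpleGraph.Walk.eq_of_length_eq_zero
        (SimpleGraph.Walk.length_eq_zero_iff.2 hn)).symm)

theorem Iso.branch_eq_iff {S S' : StableQuiltedDisk n} (f : Iso S S') (v : S.V)
    (i j : Fin (n + 1)) :
    S'.branch (f.tree v) i = S'.branch (f.tree v) j ↔ S.branch v i = S.branch v j := by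
  rw [← Circle.coe_inj, ← Circle.coe_inj, ← f.map_branch, ← f.map_branch]
  exact (f.disk v).left_inv.injOn.eq_iff (coe_mem_closedBall _) (coe_mem_closedBall _)

/-! ### The cross-ratios of a stable nodal quilted disk -/

variable (S : StableQuiltedDisk n)

/-- There is a component at which the four branches towards `zᵢ, zⱼ, zₖ, zₗ` meet (second type
of the subtree spanned by `i, j, k, l`), and `x` is the cross-ratio, which is a real number, of
the corresponding four boundary points. -/
def IsCrossRatio (i j k l : Fin (n + 1)) (x : ℝ) : Prop :=
  ∃ v : S.V, [S.branch v i, S.branch v j, S.branch v k, S.branch v l].Nodup ∧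
    (x : ℂ) = QuiltedDisk.crossRatio (S.branch v i) (S.branch v j) (S.branch v k) (S.branch v l)

/-- The pair `zᵢ, zⱼ` is separated from the pair `zₖ, zₗ` (first type of the subtree spanned by
`i, j, k, l`): at the component where the branches towards `zᵢ, zⱼ, zₖ` meet, the branches
towards `zₖ` and `zₗ` agree. -/
def Separated (i j k l : Fin (n + 1)) : Prop :=
  ∃ v : S.V, [S.branch v i, S.branch v j, S.branch v k].Nodup ∧ S.branch v k = S.branch v l

open Classical in
/-- The cross-ratio `ρ_{ijkl} ∈ [-∞, 0]`, for `i < j < k < l`. -/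
def rho (i j k l : Fin (n + 1)) : EReal :=
  if h : ∃ x : ℝ, S.IsCrossRatio i j k l x then ((h.choose : ℝ) : EReal)
  else if S.Separated i j k l then ⊥
  else 0

/-- The component at which the branches towards `z₀, zᵢ, zⱼ` meet is quilted, and `x` is the
imaginary part of the cross-ratio of the corresponding boundary points `zᵢ, zⱼ, z₀` and a point
`w ≠ z₀` of the seam. (It does not depend on `w`.) -/
def IsQuiltedCrossRatio (i j : Fin (n + 1)) (x : ℝ) : Prop :=
  ∃ v ∈ S.quilted, [S.branch v 0, S.branch v i, S.branch v j].Nodup ∧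
    ∃ w ∈ S.seam v, w ≠ (S.branch v 0 : ℂ) ∧
      x = (QuiltedDisk.crossRatio (S.branch v i) (S.branch v j) (S.branch v 0) w).im

/-- A quilted component lies strictly between the root and the component at which the branches
towards `z₀, zᵢ, zⱼ` meet. -/
def QuiltedBelow (i j : Fin (n + 1)) : Prop :=
  ∃ v ∈ S.quilted, S.branch v i = S.branch v j ∧ S.branch v i ≠ S.branch v 0

open Classical in
/-- The quilted cross-ratio `ρ_{ij} ∈ [0, ∞]`, for `0 < i < j`. -/
def quiltedRho (i j : Fin (n + 1)) : EReal :=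
  if h : ∃ x : ℝ, S.IsQuiltedCrossRatio i j x then ((h.choose : ℝ) : EReal)
  else if S.QuiltedBelow i j then ⊤
  else 0

variable {S} {S' : StableQuiltedDisk n}

theorem Iso.isCrossRatio (f : Iso S S') {i j k l : Fin (n + 1)} {x : ℝ}
    (h : S.IsCrossRatio i j k l x) : S'.IsCrossRatio i j k l x := by
  obtain ⟨v, hv, hx⟩ := h
  refine ⟨f.tree v, by simpa [f.branch_eq_iff] using hv, ?_⟩
  rw [hx, ← f.map_branch, ← f.map_branch, ← f.map_branch, ← f.map_branch,
    DiskIso.crossRatio_eq] <;> exact (Circle.norm_coe _).le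

theorem Iso.separated (f : Iso S S') {i j k l : Fin (n + 1)}
    (h : S.Separated i j k l) : S'.Separated i j k l := by
  obtain ⟨v, hv, h'⟩ := h
  exact ⟨f.tree v, by simpa [f.branch_eq_iff] using hv, (f.branch_eq_iff _ _ _).2 h'⟩

theorem Iso.isQuiltedCrossRatio (f : Iso S S') {i j : Fin (n + 1)} {x : ℝ}
    (h : S.IsQuiltedCrossRatio i j x) : S'.IsQuiltedCrossRatio i j x := by
  obtain ⟨v, hv, hd, w, hw, hw0, hx⟩ := h
  have hwc := S.seam_subset hv hw
  refine ⟨f.tree v, (f.map_quilted v).1 hv, by simpa [f.branch_eq_iff] using hd, f.disk v w,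
    ?_, ?_, ?_⟩
  · rw [← f.map_seam v hv]; exact mem_image_of_mem _ hw
  · rw [← f.map_branch]
    exact fun e => hw0 ((f.disk v).left_inv.injOn hwc (coe_mem_closedBall _) e)
  · rw [hx, ← f.map_branch, ← f.map_branch, ← f.map_branch, DiskIso.crossRatio_eq] <;>
      first
      | exact (Circle.norm_coe _).le
      | exact mem_closedBall_zero_iff.1 hwc

theorem Iso.quiltedBelow (f : Iso S S') {i j : Fin (n + 1)}
    (h : S.QuiltedBelow i j) : S'.QuiltedBelow i j := by
  obtain ⟨v, hv, h1, h2⟩ := h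
  exact ⟨f.tree v, (f.map_quilted v).1 hv, (f.branch_eq_iff _ _ _).2 h1,
    fun e => h2 ((f.branch_eq_iff _ _ _).1 e)⟩

theorem Iso.rho_eq (f : Iso S S') (i j k l : Fin (n + 1)) : S.rho i j k l = S'.rho i j k l := by
  have h1 : S.IsCrossRatio i j k l = S'.IsCrossRatio i j k l :=
    funext fun _ => propext ⟨f.isCrossRatio, f.symm.isCrossRatio⟩
  have h2 : S.Separated i j k l = S'.Separated i j k l :=
    propext ⟨f.separated, f.symm.separated⟩
  unfold rho
  generalize S.IsCrossRatio i j k l = P at h1 ⊢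
  subst h1
  generalize S.Separated i j k l = Q at h2 ⊢
  subst h2
  rfl

theorem Iso.quiltedRho_eq (f : Iso S S') (i j : Fin (n + 1)) :
    S.quiltedRho i j = S'.quiltedRho i j := by
  have h1 : S.IsQuiltedCrossRatio i j = S'.IsQuiltedCrossRatio i j :=
    funext fun _ => propext ⟨f.isQuiltedCrossRatio, f.symm.isQuiltedCrossRatio⟩
  have h2 : S.QuiltedBelow i j = S'.QuiltedBelow i j :=
    propext ⟨f.quiltedBelow, f.symm.quiltedBelow⟩
  unfold quiltedRho
  generalize S.IsQuiltedCrossRatio i j = P at h1 ⊢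
  subst h1
  generalize S.QuiltedBelow i j = Q at h2 ⊢
  subst h2
  rfl

end StableQuiltedDisk

/-! ### The moduli space and its canonical map -/

/-- The moduli space of isomorphism classes of stable nodal quilted disks with markings
`z₀, …, zₙ`. -/
def Moduli (n : ℕ) : Type 1 := Quotient (StableQuiltedDisk.setoid n)

/-- The indices `0 ≤ i < j < k < l ≤ n` of the cross-ratios. -/
abbrev Quad (n : ℕ) : Type :=
  {q : Fin (n + 1) × Fin (n + 1) × Fin (n + 1) × Fin (n + 1) //
    q.1 < q.2.1 ∧ q.2.1 < q.2.2.1 ∧ q.2.2.1 < q.2.2.2}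

/-- The indices `1 ≤ i < j ≤ n` of the quilted cross-ratios. -/
abbrev Pair (n : ℕ) : Type :=
  {p : Fin (n + 1) × Fin (n + 1) // 0 < p.1 ∧ p.1 < p.2}

/-- All cross-ratios and quilted cross-ratios of an isomorphism class, as extended reals. -/
def rhoMap (n : ℕ) (x : Moduli n) : (Quad n → EReal) × (Pair n → EReal) :=
  Quotient.lift
    (fun S : StableQuiltedDisk n =>
      ((fun q : Quad n => S.rho q.1.1 q.1.2.1 q.1.2.2.1 q.1.2.2.2,
        fun p : Pair n => S.quiltedRho p.1.1 p.1.2) : (Quad n → EReal) × (Pair n → EReal)))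
    (fun S S' h => by
      obtain ⟨f⟩ : Nonempty (StableQuiltedDisk.Iso S S') := h
      exact Prod.ext (funext fun _ => f.rho_eq _ _ _ _)
        (funext fun _ => f.quiltedRho_eq _ _)) x

/-- The topology on the moduli space is pulled back along the map given by all cross-ratios. -/
instance (n : ℕ) : TopologicalSpace (Moduli n) :=
  TopologicalSpace.induced (rhoMap n) inferInstance

end QuiltedDisk

end

/-! The image of `rhoMap` is identified with the closure of the cross-ratio values of smooth quilted
disks. A smooth disk is a real configuration: `z₀` at infinity in the upper half plane, the other
markings in increasing order on the real line, and the seam at height one. A closure is closed, so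
together with injectivity this makes `rhoMap` a closed embedding into a compact Hausdorff product of
intervals.

Both inclusions use the same notion of convergence, `IsLimit`: at each component some affine
rescaling takes the markings beyond it to their branches and sends the other nonzero markings to
infinity. The rescaling factor, which is the rescaled height of the seam, tends to the height of the
seam, to infinity or to zero, according to the position of the quilted layer.
`IsLimit.tendsto_rhoMap` shows that the cross-ratios then converge to those of the nodal disk. Every
stable disk is such a limit: assign to its components scales of different powers of `t` and place
consecutive markings at the distances these prescribe (`isLimit_smoothing`).

Conversely, a point of the closure is a limit along an ultrafilter of real configurations. Their
germs are points of a non-Archimedean ordered field. Archimedean classes define an ultrametric on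
them, and the balls whose radius is one or a distance of two markings form a finite tree. This tree
carries a stable quilted disk: standard parts of rescaled germs are its coordinates, and the balls
of radius one are quilted (`quiltedDisk`). The configurations converge to it
(`isLimit_quiltedDisk`), so the given point is its value under `rhoMap`.

For injectivity, a component is determined by the set of markings beyond it and its colour
(`eq_of_beyond_eq`), and the tree by inclusion of these sets (`farther_iff`, `Farther.adj_iff`). The
cross-ratios detect these data and, up to an affine map, the coordinates and the height of the seam
(`SameRho.exists_matches`, `SameRho.exists_affine`). Affine maps of half planes are isomorphisms of
disks, and they assemble to an isomorphism of nodal disks (`SameRho.nonempty_iso`). -/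

noncomputable section

/-! ### Paths and directions in a tree -/

namespace SimpleGraph.IsTree

variable {V : Type*} {G : SimpleGraph V} (hG : G.IsTree)

include hG in
theorem path_eq {u v : V} {p q : G.Walk u v} (hp : p.IsPath) (hq : q.IsPath) : p = q :=
  (hG.existsUnique_path u v).unique hp hq

/-- The path between two vertices of a tree. -/
def thePath (u v : V) : G.Walk u v := (hG.existsUnique_path u v).choose

theorem thePath_isPath (u v : V) : (hG.thePath u v).IsPath :=
  (hG.existsUnique_path u v).choose_spec.1

theorem eq_thePath {u v : V} {p : G.Walk u v} (hp : p.IsPath) : p = hG.thePath u v :=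
  hG.path_eq hp (hG.thePath_isPath u v)

/-- The first vertex after `u` on the path from `u` to `v`. -/
def step (u v : V) : V := (hG.thePath u v).snd

theorem thePath_not_nil {u v : V} (h : u ≠ v) : ¬ (hG.thePath u v).Nil := fun hn =>
  h hn.eq

theorem adj_step {u v : V} (h : u ≠ v) : G.Adj u (hG.step u v) :=
  SimpleGraph.Walk.adj_snd (hG.thePath_not_nil h)

theorem reverse_thePath (u v : V) : (hG.thePath u v).reverse = hG.thePath v u :=
  hG.eq_thePath (hG.thePath_isPath u v).reverse

theorem thePath_cons {u v w : V} (h : G.Adj v u) (hv : v ∉ (hG.thePath u w).support) :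
    hG.thePath v w = .cons h (hG.thePath u w) :=
  (hG.eq_thePath ((hG.thePath_isPath u w).cons hv)).symm

theorem step_of_notMem {u v w : V} (h : G.Adj v u) (hv : v ∉ (hG.thePath u w).support) :
    hG.step v w = u := by
  rw [step, hG.thePath_cons h hv, Walk.snd_cons]

/-- Removing detours from a walk that avoids `v` yields the path and still avoids `v`. This allows
steps to be computed from any convenient walk. -/
theorem step_of_walk {u v w : V} (h : G.Adj v u) (q : G.Walk u w) (hv : v ∉ q.support) :
    hG.step v w = u := by
  classical
  refine hG.step_of_notMem h fun hm => hv ?_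
  rw [← hG.eq_thePath q.bypass_isPath] at hm
  exact q.support_bypass_subset_support hm

theorem step_of_adj {u v : V} (h : G.Adj u v) : hG.step u v = v :=
  hG.step_of_walk h .nil (by simpa using h.ne)

theorem step_eq_of_mem {u v w : V} (hw : w ∈ (hG.thePath u v).support) (h : w ≠ u) :
    hG.step u w = hG.step u v := by
  classical
  have := hG.eq_thePath ((hG.thePath_isPath u v).takeUntil hw)
  rw [step, ← this, Walk.snd_takeUntil h, step]

/-- A second common vertex of the two paths would force both to leave `v` by the same edge. -/
theorem thePath_append {u v w : V} (h : v = u ∨ v = w ∨ hG.step v u ≠ hG.step v w) :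
    (hG.thePath u v).append (hG.thePath v w) = hG.thePath u w := by
  refine hG.eq_thePath ?_
  rw [Walk.isPath_def, Walk.support_append, List.nodup_append]
  refine ⟨(hG.thePath_isPath u v).support_nodup,
    (hG.thePath_isPath v w).support_nodup.tail, ?_⟩
  rintro x hx y hy rfl
  have hxv : x ≠ v := by
    rintro rfl
    have := (hG.thePath_isPath x w).support_nodup
    rw [← Walk.cons_tail_support] at this
    exact (List.nodup_cons.1 this).1 hy
  have hxw : x ∈ (hG.thePath v w).support := List.mem_of_mem_tail hy
  have hxu : x ∈ (hG.thePath v u).support := by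
    rw [← hG.reverse_thePath]; simpa using hx
  rcases h with rfl | rfl | h
  · have := hG.eq_thePath (Walk.IsPath.nil (G := G) (u := v))
    rw [← this] at hxu; simp at hxu; exact hxv hxu
  · have := hG.eq_thePath (Walk.IsPath.nil (G := G) (u := v))
    rw [← this] at hxw; simp at hxw; exact hxv hxw
  · exact h ((hG.step_eq_of_mem hxu hxv).symm.trans (hG.step_eq_of_mem hxw hxv))

/-- Lying on a path becomes a condition on directions at a single vertex; this is how the colouring
axiom is later expressed by branches. -/
theorem mem_support_iff {u v w : V} :
    v ∈ (hG.thePath u w).support ↔ v = u ∨ v = w ∨ hG.step v u ≠ hG.step v w := by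
  classical
  constructor
  · intro h
    by_contra! hc
    obtain ⟨h1, h2, h3⟩ := hc
    obtain ⟨q, r, hq, hr, hqr⟩ := (hG.thePath_isPath u w).mem_support_iff_exists_append.1 h
    have hp := hG.thePath_isPath u w
    rw [hqr] at hp
    rw [hG.eq_thePath hq, hG.eq_thePath hr, Walk.isPath_def, Walk.support_append,
      List.nodup_append] at hp
    refine hp.2.2 (hG.step v u) ?_ (hG.step v w) ?_ h3
    · rw [← hG.reverse_thePath, Walk.support_reverse, List.mem_reverse]
      exact Walk.getVert_mem_support _ _
    · have h4 := Walk.cons_tail_eq _ (hG.thePath_not_nil h2)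
      rw [← h4, Walk.support_cons, List.tail_cons]
      exact Walk.start_mem_support _
  · intro h
    rw [← hG.thePath_append h, Walk.mem_support_append_iff]
    exact Or.inl (Walk.end_mem_support _)

/-- If `w` does not lie in the direction of `v'` from `v`, then from `v'` it lies in the
direction of `v`. -/
theorem step_opposite {v v' w : V} (h : v ≠ v') (hw : v = w ∨ hG.step v v' ≠ hG.step v w) :
    v' ≠ w ∧ hG.step v' w = hG.step v' v := by
  have hm : v ∈ (hG.thePath v' w).support := hG.mem_support_iff.2 (Or.inr hw)
  refine ⟨?_, (hG.step_eq_of_mem hm h).symm⟩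
  rintro rfl
  rcases hw with hw | hw
  · exact h hw
  · exact hw rfl

theorem length_thePath {u v : V} (h : u ≠ v) :
    (hG.thePath u v).length = (hG.thePath (hG.step u v) v).length + 1 := by
  have h4 := Walk.cons_tail_eq _ (hG.thePath_not_nil h)
  have h5 := hG.thePath_isPath u v
  rw [← h4] at h5
  have h6 := hG.eq_thePath h5.of_cons
  rw [← h4, Walk.length_cons, h6]
  rfl

theorem length_thePath_le_of_adj {u v : V} (h : G.Adj u v) (w : V) :
    (hG.thePath u w).length ≤ (hG.thePath v w).length + 1 := by
  by_cases hv : u ∈ (hG.thePath v w).support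
  · by_cases hvw : v = w
    · subst hvw
      have := hG.eq_thePath (Walk.IsPath.nil (G := G) (u := v))
      rw [← this] at hv; simp at hv; exact absurd hv h.ne
    · rw [hG.length_thePath hvw, ← hG.step_eq_of_mem hv h.ne, hG.step_of_adj h.symm]
      omega
  · rw [hG.thePath_cons h hv, Walk.length_cons]

end SimpleGraph.IsTree

/-! ### Trees from finite partial orders -/

section Hasse

open SimpleGraph

variable {V : Type*} [PartialOrder V] [Finite V]

theorem exists_hasse_walk {v w : V} (h : v ≤ w) :
    ∃ p : (hasse V).Walk v w, ∀ u ∈ p.support, v ≤ u ∧ u ≤ w := by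
  induction v using WellFoundedGT.induction with
  | _ v ih =>
    rcases h.eq_or_lt with rfl | hlt
    · exact ⟨.nil, by simp⟩
    · obtain ⟨u, hu, huw⟩ := exists_covBy_le_of_lt hlt
      obtain ⟨p, hp⟩ := ih u hu.lt huw
      have hadj : (hasse V).Adj v u := Or.inl hu
      refine ⟨.cons hadj p, fun x hx => ?_⟩
      rw [Walk.support_cons, List.mem_cons] at hx
      rcases hx with rfl | hx
      · exact ⟨le_rfl, h⟩
      · exact ⟨hu.le.trans (hp x hx).1, (hp x hx).2⟩

/-- Connectedness comes from walking up to `t`. On a cycle, both neighbours of a minimal vertex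
cover it. The elements above that vertex form a chain, so the two neighbours would coincide, which
is impossible on a cycle. -/
theorem hasse_isTree {t : V} (ht : ∀ v, v ≤ t) (H : ∀ u v w : V, u ≤ v → u ≤ w → v ≤ w ∨ w ≤ v) :
    (hasse V).IsTree := by
  classical
  have : Nonempty V := ⟨t⟩
  refine ⟨⟨fun v w => ?_⟩, ?_⟩
  · obtain ⟨p, -⟩ := exists_hasse_walk (ht v)
    obtain ⟨q, -⟩ := exists_hasse_walk (ht w)
    exact ⟨p.append q.reverse⟩
  · intro v c hc
    obtain ⟨m, hm⟩ := (c.support.finite_toSet.inter_of_left univ |>.subset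
      (fun x (hx : x ∈ {x | x ∈ c.support}) => ⟨hx, mem_univ _⟩)).exists_minimal
      ⟨v, c.start_mem_support⟩
    have hc' := hc.rotate hm.1
    have hmin : ∀ x ∈ (c.rotate m hm.1).support, x ≤ m → m ≤ x := fun x hx hxm =>
      hm.2 (by simpa using hx) hxm
    have key : ∀ x ∈ (c.rotate m hm.1).support, (hasse V).Adj m x → m ⋖ x := by
      intro x hx hadj
      rcases hadj with h | h
      · exact h
      · exact absurd (hmin x hx h.le) h.lt.not_ge
    have h1 := key _ (Walk.getVert_mem_support _ _) (Walk.adj_snd hc'.not_nil)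
    have h2 := key _ (Walk.getVert_mem_support _ _)
      (Walk.adj_penultimate hc'.not_nil).symm
    refine hc'.snd_ne_penultimate ?_
    rcases H _ _ _ h1.le h2.le with h | h
    · exact (h2.eq_or_eq h1.le h).resolve_left h1.lt.ne'
    · exact ((h1.eq_or_eq h2.le h).resolve_left h2.lt.ne').symm

/-- A monotone walk from `w` up to `u` stays below `u`, hence avoids `v`. -/
theorem step_hasse_of_covBy (hG : (hasse V).IsTree) {u v w : V} (h : u ⋖ v)
    (hw : w ≤ u) : hG.step v w = u := by
  obtain ⟨p, hp⟩ := exists_hasse_walk hw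
  refine hG.step_of_walk (Or.inr h) p.reverse fun hv => ?_
  exact absurd (hp v (by simpa using hv)).2 h.lt.not_ge

/-- The walk from `u` up to the top and down to `w` avoids `v`: the ascending half stays above `u`,
the descending half above `w`. -/
theorem step_hasse_of_not_le {t : V} (ht : ∀ v, v ≤ t) (hG : (hasse V).IsTree) {u v w : V}
    (h : v ⋖ u) (hw : ¬ w ≤ v) : hG.step v w = u := by
  obtain ⟨p, hp⟩ := exists_hasse_walk (ht w)
  obtain ⟨q, hq⟩ := exists_hasse_walk (ht u)
  refine hG.step_of_walk (Or.inl h) (q.append p.reverse) fun hv => ?_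
  rw [Walk.mem_support_append_iff] at hv
  rcases hv with hv | hv
  · exact absurd (hq v hv).1 h.lt.not_ge
  · exact hw (hp v (by simpa using hv)).1

end Hasse

end


/-! ### Branches and meeting components of a nodal disk -/

noncomputable section

namespace QuiltedDisk

namespace NodalDisk

variable {n : ℕ} (S : NodalDisk n)

/-- The node of `D_v` in the direction of another component `D_w`. -/
def dir (v w : S.V) : Circle := S.node v (S.isTree.step v w)

variable {S}

theorem branch_of_comp_eq {v : S.V} {i : Fin (n + 1)} (h : S.comp i = v) :
    S.branch v i = S.mark i := if_pos h

theorem branch_of_comp_ne {v : S.V} {i : Fin (n + 1)} (h : S.comp i ≠ v) :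
    S.branch v i = S.dir v (S.comp i) := if_neg h

theorem dir_eq_dir_iff {v u w : S.V} (hu : v ≠ u) (hw : v ≠ w) :
    S.dir v u = S.dir v w ↔ S.isTree.step v u = S.isTree.step v w :=
  ⟨fun h => S.node_inj (S.isTree.adj_step hu) (S.isTree.adj_step hw) h, fun h => by
    rw [dir, dir, h]⟩

theorem branch_eq_dir_iff {v w : S.V} {i : Fin (n + 1)} (h : v ≠ w) :
    S.branch v i = S.dir v w ↔
      v ≠ S.comp i ∧ S.isTree.step v w = S.isTree.step v (S.comp i) := by
  by_cases hi : S.comp i = v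
  · rw [branch_of_comp_eq hi]
    exact ⟨fun e => absurd e.symm (S.node_ne_mark (S.isTree.adj_step h) hi),
      fun e => absurd hi.symm e.1⟩
  · rw [branch_of_comp_ne hi, dir_eq_dir_iff (Ne.symm hi) h]
    exact ⟨fun e => ⟨Ne.symm hi, e.symm⟩, fun e => e.2.symm⟩

/-- Every marking lies in the direction of the other component as seen from one of two different
components. -/
theorem branch_eq_dir_or {v w : S.V} (h : v ≠ w) (i : Fin (n + 1)) :
    S.branch v i = S.dir v w ∨ S.branch w i = S.dir w v := by
  rw [branch_eq_dir_iff h, branch_eq_dir_iff h.symm]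
  by_contra! hc
  obtain ⟨h1, h2⟩ := hc
  have := S.isTree.step_opposite (w := S.comp i) h (by
    by_cases hv : v = S.comp i
    · exact Or.inl hv
    · exact Or.inr (h1 hv))
  exact h2 this.1 this.2.symm

theorem branch_eq_branch_iff {v : S.V} {i j : Fin (n + 1)} :
    S.branch v i = S.branch v j ↔ i = j ∨ v ≠ S.comp i ∧ v ≠ S.comp j ∧
      S.isTree.step v (S.comp i) = S.isTree.step v (S.comp j) := by
  by_cases hi : S.comp i = v
  · by_cases hj : S.comp j = v
    · rw [branch_of_comp_eq hi, branch_of_comp_eq hj]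
      refine ⟨fun h => Or.inl (S.mark_inj (hi.trans hj.symm) h), ?_⟩
      rintro (rfl | h)
      · rfl
      · exact absurd hi.symm h.1
    · rw [branch_of_comp_ne hj, branch_of_comp_eq hi]
      refine ⟨fun h => absurd h.symm
        (S.node_ne_mark (S.isTree.adj_step (Ne.symm hj)) hi), ?_⟩
      rintro (rfl | h)
      · exact absurd hi hj
      · exact absurd hi.symm h.1
  · rw [branch_of_comp_ne hi, eq_comm, branch_eq_dir_iff (Ne.symm hi)]
    refine ⟨fun h => Or.inr ⟨Ne.symm hi, h⟩, ?_⟩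
    rintro (rfl | h)
    · exact ⟨Ne.symm hi, rfl⟩
    · exact h.2

/-- Replaces membership in a path by a comparison of branches, so that the rest of the argument
never handles paths of markings. -/
theorem mem_support_path_iff {v : S.V} {i j : Fin (n + 1)} (h : i ≠ j) :
    v ∈ (S.path (S.comp i) (S.comp j)).support ↔ S.branch v i ≠ S.branch v j := by
  rw [Ne, branch_eq_branch_iff]
  -- `path` and `thePath` unfold to the same choice, so the statement about the tree applies as it
  -- stands.
  refine S.isTree.mem_support_iff.trans ?_
  tauto

/-- The branches towards three markings are distinct at a component. -/
def Meet (S : NodalDisk n) (v : S.V) (i j k : Fin (n + 1)) : Prop :=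
  S.branch v i ≠ S.branch v j ∧ S.branch v i ≠ S.branch v k ∧ S.branch v j ≠ S.branch v k

/-- Given two different components, each of the three markings lies, from one of them, in the
direction of the other. By the pigeonhole principle two markings do so from the same component, and
they share a branch there. -/
theorem Meet.unique {v w : S.V} {i j k : Fin (n + 1)} (hv : S.Meet v i j k)
    (hw : S.Meet w i j k) : v = w := by
  by_contra h
  have hi := branch_eq_dir_or h i
  have hj := branch_eq_dir_or h j
  have hk := branch_eq_dir_or h k
  obtain ⟨h1, h2, h3⟩ := hv
  obtain ⟨h4, h5, h6⟩ := hw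
  grind

/-- One step along the common branch approaches both markings and recedes from anything else by at
most one. -/
theorem exists_shorter {v : S.V} {i j : Fin (n + 1)} (hij : i ≠ j)
    (h : S.branch v i = S.branch v j) : ∃ u : S.V,
      (S.path u (S.comp i)).length + 1 = (S.path v (S.comp i)).length ∧
      (S.path u (S.comp j)).length + 1 = (S.path v (S.comp j)).length ∧
      ∀ w, (S.path u w).length ≤ (S.path v w).length + 1 := by
  rw [branch_eq_branch_iff] at h
  obtain ⟨h1, h2, h3⟩ := h.resolve_left hij
  refine ⟨S.isTree.step v (S.comp i), (S.isTree.length_thePath h1).symm, ?_,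
    S.isTree.length_thePath_le_of_adj (S.isTree.adj_step h1).symm⟩
  rw [h3]
  exact (S.isTree.length_thePath h2).symm

/-- Minimize the sum of the three distances. If two branches agreed, moving along them would gain
two and lose at most one. -/
theorem exists_meet {i j k : Fin (n + 1)} (hij : i ≠ j) (hik : i ≠ k) (hjk : j ≠ k) :
    ∃ v : S.V, S.Meet v i j k := by
  have := S.finite
  have := S.isTree.connected.nonempty
  obtain ⟨v, hv⟩ := Finite.exists_min (fun v : S.V => (S.path v (S.comp i)).length +
    (S.path v (S.comp j)).length + (S.path v (S.comp k)).length)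
  refine ⟨v, fun h => ?_, fun h => ?_, fun h => ?_⟩
  · obtain ⟨u, h1, h2, h3⟩ := exists_shorter hij h
    have := hv u
    have := h3 (S.comp k)
    omega
  · obtain ⟨u, h1, h2, h3⟩ := exists_shorter hik h
    have := hv u
    have := h3 (S.comp j)
    omega
  · obtain ⟨u, h1, h2, h3⟩ := exists_shorter hjk h
    have := hv u
    have := h3 (S.comp i)
    omega

/-- The special points of a component. -/
def special (S : NodalDisk n) (v : S.V) : Set Circle :=
  S.node v '' S.graph.neighborSet v ∪ S.mark '' {i | S.comp i = v}

theorem ncard_special (v : S.V) : (S.special v).ncard = S.numSpecial v := by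
  have := S.finite
  rw [special, ncard_union_eq _ (toFinite _) (toFinite _), InjOn.ncard_image,
    InjOn.ncard_image, numSpecial]
  · intro i hi j hj h
    exact S.mark_inj (hi.trans hj.symm) h
  · intro u hu w hw h
    exact S.node_inj hu hw h
  · rw [Set.disjoint_left]
    rintro _ ⟨u, hu, rfl⟩ ⟨i, hi, h⟩
    exact S.node_ne_mark hu hi h.symm

theorem finite_special (v : S.V) : (S.special v).Finite := by
  have := S.finite
  exact ((toFinite _).image _).union ((toFinite _).image _)

theorem range_branch_subset (v : S.V) : range (S.branch v) ⊆ S.special v := by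
  rintro _ ⟨i, rfl⟩
  by_cases hi : S.comp i = v
  · rw [branch_of_comp_eq hi]; exact Or.inr ⟨i, hi, rfl⟩
  · rw [branch_of_comp_ne hi]; exact Or.inl ⟨_, S.isTree.adj_step (Ne.symm hi), rfl⟩

theorem ncard_range_branch_le (v : S.V) : (range (S.branch v)).ncard ≤ S.numSpecial v := by
  rw [← ncard_special]
  exact ncard_le_ncard (range_branch_subset v) (finite_special v)

end NodalDisk

/-! ### Consequences of stability and of the colouring -/

namespace StableQuiltedDisk

open NodalDisk

variable {n : ℕ} {S : StableQuiltedDisk n}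

theorem two_le_numSpecial (v : S.V) : 2 ≤ S.numSpecial v := by
  by_cases hv : v ∈ S.quilted
  · exact S.stable_quilted v hv
  · exact (S.stable_unquilted v hv).trans' (by norm_num)

/-- A component farthest from `u` in the direction of `v` is a leaf of the tree. It has at least two
special points but only one node, so it carries a marking. -/
theorem exists_branch_eq_node {u v : S.V} (h : S.graph.Adj u v) :
    ∃ i, S.branch u i = S.node u v := by
  have := S.finite
  obtain ⟨w, ⟨hwu, hw⟩, hmax⟩ := exists_max_image {w : S.V | u ≠ w ∧ S.isTree.step u w = v}
    (fun w => (S.path u w).length) (toFinite _) ⟨v, h.ne, S.isTree.step_of_adj h⟩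
  -- Any neighbour of `w` not leading back to `u` would be farther away in the same direction.
  have hn : S.graph.neighborSet w ⊆ {S.isTree.step w u} := by
    intro x hx
    by_contra hne
    have hxw : S.isTree.step w x = x := S.isTree.step_of_adj hx
    obtain ⟨h1, h2⟩ := S.isTree.step_opposite (v := w) (v' := u) (w := x) hwu.symm
      (Or.inr (by rw [hxw]; exact fun e => hne e.symm))
    have h3 := hmax x ⟨h1, h2.trans hw⟩
    have h4 : (S.isTree.thePath u x).length =
        (S.isTree.thePath u w).length + (S.isTree.thePath w x).length := by
      rw [← SimpleGraph.Walk.length_append, S.isTree.thePath_append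
        (Or.inr (Or.inr (by rw [hxw]; exact fun e => hne e.symm)))]
    have h5 : 0 < (S.isTree.thePath w x).length := by
      rw [S.isTree.length_thePath (SimpleGraph.Adj.ne hx)]; omega
    change (S.isTree.thePath u x).length ≤ (S.isTree.thePath u w).length at h3
    omega
  have h2 := two_le_numSpecial w
  have h3 := ncard_le_ncard hn (toFinite _)
  rw [ncard_singleton] at h3
  rw [numSpecial] at h2
  obtain ⟨i, hi⟩ := (ncard_pos (toFinite {i | S.comp i = w})).1 (by omega)
  have hi' : S.comp i = w := hi
  refine ⟨i, ?_⟩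
  rw [branch_of_comp_ne (by rw [hi']; exact hwu.symm), dir, hi', hw]

/-- Since a marking lies beyond every node, counting special points is counting branches; stability
thus becomes a statement about branches. -/
theorem range_branch (v : S.V) : range (S.branch v) = S.special v := by
  refine (range_branch_subset v).antisymm ?_
  rintro _ (⟨u, hu, rfl⟩ | ⟨i, hi, rfl⟩)
  · exact exists_branch_eq_node hu
  · exact ⟨i, branch_of_comp_eq hi⟩

theorem ncard_range_branch (v : S.V) : (range (S.branch v)).ncard = S.numSpecial v := by
  rw [range_branch, ncard_special]

/-- The set of markings beyond `D_v`, as seen from the root. -/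
def beyond (S : StableQuiltedDisk n) (v : S.V) : Set (Fin (n + 1)) :=
  {i | S.branch v i ≠ S.branch v 0}

theorem mem_beyond {v : S.V} {i : Fin (n + 1)} :
    i ∈ S.beyond v ↔ S.branch v i ≠ S.branch v 0 := Iff.rfl

theorem zero_notMem_beyond (v : S.V) : 0 ∉ S.beyond v := fun h => h rfl

theorem ne_zero_of_mem_beyond {v : S.V} {i : Fin (n + 1)} (h : i ∈ S.beyond v) : i ≠ 0 := by
  rintro rfl; exact h rfl

theorem beyond_nonempty (v : S.V) : (S.beyond v).Nonempty := by
  by_contra hc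
  have h1 : range (S.branch v) ⊆ {S.branch v 0} := by
    rintro _ ⟨i, rfl⟩
    by_contra h
    exact hc ⟨i, h⟩
  have h2 := ncard_le_ncard h1 (toFinite _)
  rw [ncard_range_branch, ncard_singleton] at h2
  have := two_le_numSpecial v
  omega

/-- In this form the colouring axiom says that the sets `beyond v`, for `v` quilted, partition the
nonzero markings. -/
theorem existsUnique_quilted {i : Fin (n + 1)} (hi : i ≠ 0) :
    ∃! v, v ∈ S.quilted ∧ i ∈ S.beyond v := by
  have := S.colored i hi
  simpa only [mem_support_path_iff hi, mem_beyond] using this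

/-- Three special points give two branches besides the one towards the root. -/
theorem exists_meet_of_unquilted {v : S.V} (hv : v ∉ S.quilted) : ∃ i j, i < j ∧
    S.Meet v 0 i j := by
  by_contra! hc
  obtain ⟨i, hi⟩ := beyond_nonempty v
  have h1 : range (S.branch v) ⊆ {S.branch v 0, S.branch v i} := by
    rintro _ ⟨j, rfl⟩
    by_contra h
    simp only [mem_insert_iff, mem_singleton_iff, not_or] at h
    rcases lt_trichotomy i j with hij | rfl | hij
    · exact hc i j hij ⟨Ne.symm hi, Ne.symm h.1, Ne.symm h.2⟩
    · exact h.2 rfl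
    · exact hc j i hij ⟨Ne.symm h.1, Ne.symm hi, h.2⟩
  have h2 := ncard_le_ncard h1 (toFinite _)
  rw [ncard_range_branch] at h2
  have := S.stable_unquilted v hv
  have := ncard_insert_le (S.branch v 0) {S.branch v i}
  rw [ncard_singleton] at this
  omega

end StableQuiltedDisk

end QuiltedDisk

end


/-! ### Cyclic order and the nesting of components -/

noncomputable section

namespace QuiltedDisk

theorem CCW.not_swap {a b c : Circle} (h : CCW a b c) : ¬ CCW a c b := by
  unfold CCW at *
  have : (conj ((c : ℂ) - a) * ((b : ℂ) - a)).im = -(conj ((b : ℂ) - a) * ((c : ℂ) - a)).im := by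
    simp only [Complex.mul_im, Complex.conj_re, Complex.conj_im, Complex.sub_re, Complex.sub_im]
    ring
  rw [this]
  linarith

theorem CCW.rotate {a b c : Circle} (h : CCW a b c) : CCW b c a := by
  unfold CCW at *
  have : (conj ((c : ℂ) - b) * ((a : ℂ) - b)).im = (conj ((b : ℂ) - a) * ((c : ℂ) - a)).im := by
    simp only [Complex.mul_im, Complex.conj_re, Complex.conj_im, Complex.sub_re, Complex.sub_im]
    ring
  rwa [this]

namespace StableQuiltedDisk

open NodalDisk

variable {n : ℕ} {S : StableQuiltedDisk n}

/-- `u ≠ v`, and `v` lies on the path from `u` to the root. -/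
def Farther (S : StableQuiltedDisk n) (u v : S.V) : Prop :=
  v ≠ u ∧ S.dir v u ≠ S.branch v 0

theorem Farther.branch_zero {u v : S.V} (h : S.Farther u v) : S.branch u 0 = S.dir u v :=
  (branch_eq_dir_or h.1 0).resolve_left (Ne.symm h.2)

theorem Farther.branch_eq_dir {u v : S.V} (h : S.Farther u v) {i : Fin (n + 1)}
    (hi : i ∈ S.beyond u) : S.branch v i = S.dir v u :=
  (branch_eq_dir_or h.1 i).resolve_right fun e => hi (e.trans h.branch_zero.symm)

theorem Farther.subset {u v : S.V} (h : S.Farther u v) : S.beyond u ⊆ S.beyond v :=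
  fun _ hi e => h.2 ((h.branch_eq_dir hi).symm.trans e)

theorem Farther.branch_eq {u v : S.V} (h : S.Farther u v) {i j : Fin (n + 1)}
    (hi : i ∈ S.beyond u) (hj : j ∈ S.beyond u) : S.branch v i = S.branch v j :=
  (h.branch_eq_dir hi).trans (h.branch_eq_dir hj).symm

/-- If each component saw the other in the direction of the root, the common marking, which one of
them sees in the direction of the other, would lie towards the root there. -/
theorem farther_or_farther {u v : S.V} (h : u ≠ v) {i : Fin (n + 1)} (hu : i ∈ S.beyond u)
    (hv : i ∈ S.beyond v) : S.Farther u v ∨ S.Farther v u := by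
  by_contra! hc
  obtain ⟨h1, h2⟩ := hc
  have h3 : S.dir v u = S.branch v 0 := by
    by_contra e; exact h1 ⟨h.symm, e⟩
  have h4 : S.dir u v = S.branch u 0 := by
    by_contra e; exact h2 ⟨h, e⟩
  rcases branch_eq_dir_or h i with e | e
  · exact hu (e.trans h4)
  · exact hv (e.trans h3)

theorem Farther.asymm {u v : S.V} (h : S.Farther u v) : ¬ S.Farther v u := fun h' =>
  h'.2 h.branch_zero.symm

theorem farther_iff_mem_support {u v : S.V} :
    S.Farther u v ↔ v ≠ u ∧ v ∈ (S.path u (S.comp 0)).support := by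
  unfold Farther
  refine and_congr_right fun h => ?_
  rw [ne_comm, Ne, branch_eq_dir_iff h]
  refine Iff.trans ?_ S.isTree.mem_support_iff.symm
  tauto

theorem Farther.length_lt {u v : S.V} (h : S.Farther u v) :
    (S.path v (S.comp 0)).length < (S.path u (S.comp 0)).length := by
  have h1 := (farther_iff_mem_support.1 h).2
  have h2 := S.isTree.thePath_append (S.isTree.mem_support_iff.1 h1)
  have h3 : (S.isTree.thePath u (S.comp 0)).length =
      (S.isTree.thePath u v).length + (S.isTree.thePath v (S.comp 0)).length := by
    rw [← SimpleGraph.Walk.length_append, h2]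
  have h4 := S.isTree.length_thePath h.1.symm
  change (S.isTree.thePath v (S.comp 0)).length < (S.isTree.thePath u (S.comp 0)).length
  omega

/-- A marking beyond `u` is beyond all three, so `u` and `w` are comparable, and the distance to the
root decides which is farther. -/
theorem Farther.trans {u v w : S.V} (h : S.Farther u v) (h' : S.Farther v w) :
    S.Farther u w := by
  have h1 := h.length_lt
  have h2 := h'.length_lt
  obtain ⟨k, hk⟩ := beyond_nonempty u
  rcases farther_or_farther (by rintro rfl; omega) hk (h'.subset (h.subset hk)) with h3 | h3
  · exact h3
  · have := h3.length_lt; omega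

/-- If two nested components have the same markings beyond them, the lower one is quilted. -/
theorem Farther.mem_quilted {u v : S.V} (h : S.Farther u v) (he : S.beyond v ⊆ S.beyond u) :
    v ∈ S.quilted := by
  by_contra hv
  obtain ⟨i, j, -, h1, h2, h3⟩ := exists_meet_of_unquilted hv
  exact h3 (h.branch_eq (he (Ne.symm h1)) (he (Ne.symm h2)))

theorem eq_of_mem_quilted {u v : S.V} (hu : u ∈ S.quilted) (hv : v ∈ S.quilted)
    {i : Fin (n + 1)} (hiu : i ∈ S.beyond u) (hiv : i ∈ S.beyond v) : u = v :=
  (existsUnique_quilted (ne_zero_of_mem_beyond hiu)).unique ⟨hu, hiu⟩ ⟨hv, hiv⟩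

theorem Farther.notMem_quilted {u v : S.V} (h : S.Farther u v) (hv : v ∈ S.quilted) :
    u ∉ S.quilted := fun hu => by
  obtain ⟨i, hi⟩ := beyond_nonempty u
  exact h.1 (eq_of_mem_quilted hv hu (h.subset hi) hi)

/-- The order of components is expressed by sets of markings and colours, which the cross-ratios can
detect. Of two nested components with equal sets the one nearer the root is quilted, because an
unquilted one has two branches away from the root. -/
theorem farther_iff {u v : S.V} : S.Farther u v ↔
    S.beyond u ⊂ S.beyond v ∨ S.beyond u = S.beyond v ∧ v ∈ S.quilted ∧ u ∉ S.quilted := by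
  constructor
  · intro h
    by_cases he : S.beyond v ⊆ S.beyond u
    · have hv := h.mem_quilted he
      exact Or.inr ⟨h.subset.antisymm he, hv, h.notMem_quilted hv⟩
    · exact Or.inl ⟨h.subset, he⟩
  · obtain ⟨i, hi⟩ := beyond_nonempty u
    rintro (h | ⟨h1, h2, h3⟩)
    · rcases farther_or_farther (by rintro rfl; exact h.ne rfl) hi (h.subset hi) with h' | h'
      · exact h'
      · exact absurd h'.subset h.not_subset
    · rcases farther_or_farther (by rintro rfl; exact h3 h2) hi (h1 ▸ hi) with h' | h'
      · exact h'
      · exact absurd (h'.mem_quilted h1.subset) h3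

theorem eq_of_beyond_eq {u v : S.V} (h : S.beyond u = S.beyond v)
    (hq : u ∈ S.quilted ↔ v ∈ S.quilted) : u = v := by
  by_contra hne
  obtain ⟨i, hi⟩ := beyond_nonempty u
  rcases farther_or_farther hne hi (h ▸ hi) with h' | h'
  · have := h'.mem_quilted h.symm.subset
    exact h'.notMem_quilted this (hq.2 this)
  · have := h'.mem_quilted h.subset
    exact h'.notMem_quilted this (hq.1 this)

/-- Otherwise each of the two neighbours would be the first step of the other towards the root, and
both distances would decrease. -/
theorem farther_or_farther_of_adj {u v : S.V} (h : S.graph.Adj u v) :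
    S.Farther u v ∨ S.Farther v u := by
  by_contra! hc
  obtain ⟨h1, h2⟩ := hc
  rw [Farther, not_and_not_right] at h1 h2
  have h3 := (branch_eq_dir_iff h.ne).1 (h2 h.ne).symm
  have h4 := (branch_eq_dir_iff h.ne').1 (h1 h.ne').symm
  have h5 := S.isTree.length_thePath h3.1
  have h6 := S.isTree.length_thePath h4.1
  rw [← h3.2, S.isTree.step_of_adj h] at h5
  rw [← h4.2, S.isTree.step_of_adj h.symm] at h6
  omega

theorem Farther.not_between {u v w : S.V} (h : S.Farther u v) (ha : S.graph.Adj u v)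
    (h1 : S.Farther u w) : ¬ S.Farther w v := by
  intro h2
  obtain ⟨k, hk⟩ := beyond_nonempty u
  have h3 : S.dir v u = S.dir v w := by
    rw [← h.branch_eq_dir hk, ← h2.branch_eq_dir (h1.subset hk)]
  have h4 : S.dir u v = S.dir u w := by
    rw [← h.branch_zero, ← h1.branch_zero]
  rw [dir_eq_dir_iff h.1 h2.1] at h3
  rw [dir_eq_dir_iff h.1.symm h1.1.symm] at h4
  rw [S.isTree.step_of_adj ha.symm] at h3
  rw [S.isTree.step_of_adj ha] at h4
  have h5 := S.isTree.length_thePath h2.1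
  have h6 := S.isTree.length_thePath h1.1.symm
  rw [← h3] at h5
  rw [← h4] at h6
  omega

/-- Adjacency is the covering relation of the order, so the tree can be recovered from the order. If
the first vertex on the path from `u` to `v` were not `v`, it would lie strictly between them. -/
theorem Farther.adj_iff {u v : S.V} (h : S.Farther u v) :
    S.graph.Adj u v ↔ ∀ w, S.Farther u w → ¬ S.Farther w v := by
  refine ⟨fun ha w h1 => h.not_between ha h1, fun hw => ?_⟩
  have hadj := S.isTree.adj_step h.1.symm
  obtain ⟨w, hwd⟩ : ∃ w, w = S.isTree.step u v := ⟨_, rfl⟩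
  rw [← hwd] at hadj
  by_cases hwv : w = v
  · rwa [← hwv]
  have h1 : S.branch u 0 = S.dir u w := by
    rw [h.branch_zero, dir_eq_dir_iff h.1.symm hadj.ne, S.isTree.step_of_adj hadj, hwd]
  have h2 : S.Farther u w := by
    rcases farther_or_farther_of_adj hadj with h' | h'
    · exact h'
    · exact absurd h1.symm h'.2
  obtain ⟨k, hk⟩ := beyond_nonempty u
  rcases farther_or_farther hwv (h2.subset hk) (h.subset hk) with h' | h'
  · exact absurd h' (hw w h2)
  · exact absurd h' (h2.not_between hadj h)

theorem mem_beyond_comp {i : Fin (n + 1)} (h : i ≠ 0) : i ∈ S.beyond (S.comp i) := by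
  rw [mem_beyond, Ne, branch_eq_branch_iff]
  simp [h]

theorem eq_or_farther_comp_zero (u : S.V) : u = S.comp 0 ∨ S.Farther u (S.comp 0) := by
  by_cases h : u = S.comp 0
  · exact Or.inl h
  · refine Or.inr (farther_iff_mem_support.2 ⟨Ne.symm h, SimpleGraph.Walk.end_mem_support _⟩)

/-- The component of a marking is thus characterized as the farthest one from the root with that
marking beyond it. -/
theorem comp_eq_or_farther {i : Fin (n + 1)} {v : S.V} (h : i ∈ S.beyond v) :
    v = S.comp i ∨ S.Farther (S.comp i) v := by
  by_cases hv : v = S.comp i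
  · exact Or.inl hv
  · refine Or.inr (farther_iff_mem_support.2 ⟨hv, ?_⟩)
    exact (mem_support_path_iff (ne_zero_of_mem_beyond h)).2 h

/-- The markings between two markings beyond `D_v` are beyond `D_v`. -/
theorem ordConnected_beyond {v : S.V} {i j k : Fin (n + 1)} (hi : i ∈ S.beyond v)
    (hk : k ∈ S.beyond v) (hij : i < j) (hjk : j < k) : j ∈ S.beyond v := by
  have h0i : 0 < i := Fin.pos_of_ne_zero (ne_zero_of_mem_beyond hi)
  -- Where `0, i, k` meet, placing `j` on the branch of `0` would give this branch two opposite
  -- positions relative to those of `i` and `k`.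
  have key : ∀ w : S.V, S.Meet w 0 i k → S.branch w j ≠ S.branch w 0 := by
    intro w ⟨h1, h2, h3⟩ h4
    have h5 := S.ordered w i j k hij hjk (by rw [h4]; exact h1.symm) (by rw [h4]; exact h2) h3
    rw [h4] at h5
    exact h5.rotate.not_swap (S.ordered w 0 i k h0i (hij.trans hjk) h1 h3 h2)
  intro hj
  by_cases hik : S.branch v i = S.branch v k
  · obtain ⟨w, hw⟩ := S.exists_meet h0i.ne (h0i.trans (hij.trans hjk)).ne (hij.trans hjk).ne
    have hwv : v ≠ w := by rintro rfl; exact hw.2.2 hik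
    have hb := branch_eq_dir_or hwv
    have := key w hw
    obtain ⟨h1, h2, h3⟩ := hw
    have e1 := hb 0
    have e2 := hb i
    have e3 := hb j
    have e4 := hb k
    rw [mem_beyond] at hi
    grind
  · exact key v ⟨Ne.symm hi, Ne.symm hk, hik⟩ hj

/-- At a component at which `zᵢ, zⱼ, zₖ` are separated, `i < j < k < l`, the branches towards
`zⱼ` and `zₗ` are different. -/
theorem branch_ne_of_meet {v : S.V} {i j k l : Fin (n + 1)} (hij : i < j) (hjk : j < k)
    (hkl : k < l) (h : S.Meet v i j k) : S.branch v j ≠ S.branch v l := by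
  intro e
  obtain ⟨h1, h2, h3⟩ := h
  have h4 := S.ordered v i j k hij hjk h1 h3 h2
  have h5 := S.ordered v i k l (hij.trans hjk) hkl h2 (by rw [← e]; exact h3.symm)
    (by rw [← e]; exact h1)
  rw [← e] at h5
  exact h4.not_swap h5

end StableQuiltedDisk

end QuiltedDisk

end


noncomputable section

namespace QuiltedDisk

open Complex Filter Topology

/-! ### The half plane model -/

/-- The closed disk minus a boundary point `p`, seen as the closed upper half plane: the map from
the half plane to the disk sending infinity to `p`. -/
def toDisk (p : Circle) (u : ℂ) : ℂ := p * (u - I) / (u + I)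

/-- The inverse of `toDisk`. -/
def toHalfPlane (p : Circle) (z : ℂ) : ℂ := I * (p + z) / (p - z)

theorem add_I_ne_zero {u : ℂ} (hu : 0 ≤ u.im) : u + I ≠ 0 := fun h => by
  have := congrArg Complex.im h
  simp at this
  linarith

theorem ofReal_add_I_ne_zero (t : ℝ) : (t : ℂ) + I ≠ 0 := add_I_ne_zero (by simp)

theorem toDisk_toHalfPlane {p : Circle} {z : ℂ} (h : z ≠ p) :
    toDisk p (toHalfPlane p z) = z := by
  have h1 : (p : ℂ) - z ≠ 0 := sub_ne_zero.2 h.symm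
  have hp : (p : ℂ) ≠ 0 := Circle.coe_ne_zero p
  have e1 : toHalfPlane p z - I = 2 * I * z / (p - z) := by
    rw [toHalfPlane]; field_simp; ring
  have e2 : toHalfPlane p z + I = 2 * I * p / (p - z) := by
    rw [toHalfPlane]; field_simp; ring
  rw [toDisk, e1, e2]
  have := I_ne_zero
  field_simp

theorem toDisk_sub_toDisk (p : Circle) {u w : ℂ} (hu : u + I ≠ 0) (hw : w + I ≠ 0) :
    toDisk p u - toDisk p w = p * (2 * I) * (u - w) / ((u + I) * (w + I)) := by
  rw [toDisk, toDisk]; field_simp; ring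

theorem sub_toDisk (p : Circle) {u : ℂ} (hu : u + I ≠ 0) :
    p - toDisk p u = p * (2 * I) / (u + I) := by
  rw [toDisk]; field_simp; ring

theorem toDisk_ne (p : Circle) {u : ℂ} (hu : u + I ≠ 0) : toDisk p u ≠ p := by
  intro h
  have := sub_toDisk p hu
  rw [h, sub_self] at this
  have h2 := div_ne_zero (mul_ne_zero (Circle.coe_ne_zero p) (mul_ne_zero two_ne_zero I_ne_zero)) hu
  exact h2 this.symm

theorem toHalfPlane_toDisk (p : Circle) {u : ℂ} (hu : u + I ≠ 0) :
    toHalfPlane p (toDisk p u) = u := by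
  have hp : (p : ℂ) ≠ 0 := Circle.coe_ne_zero p
  have := I_ne_zero
  rw [toHalfPlane, sub_toDisk p hu, toDisk]
  field_simp
  ring

/-- The imaginary part vanishes on the circle, so boundary points have real coordinates; on a circle
tangent at `p` it turns out to be constant. -/
theorem toHalfPlane_im (p : Circle) (z : ℂ) :
    (toHalfPlane p z).im = (1 - normSq z) / normSq (p - z) := by
  have hp : normSq (p : ℂ) = 1 := by simp
  rw [toHalfPlane, div_eq_mul_inv, Complex.inv_def, ← mul_assoc, Complex.im_mul_ofReal,
    div_eq_mul_inv, ← hp]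
  congr 1
  simp [normSq_apply]
  ring

theorem norm_toDisk_ofReal (p : Circle) (t : ℝ) : ‖toDisk p t‖ = 1 := by
  rw [toDisk, norm_div, norm_mul, Circle.norm_coe, one_mul,
    div_eq_one_iff_eq (norm_ne_zero_iff.2 (ofReal_add_I_ne_zero t)), ← norm_conj ((t : ℂ) + I)]
  simp [sub_eq_add_neg]

/-- The boundary point with a given real coordinate. -/
def bdry (p : Circle) (t : ℝ) : Circle := 
  ⟨toDisk p t, mem_sphere_zero_iff_norm.2 (norm_toDisk_ofReal p t)⟩

theorem coe_bdry (p : Circle) (t : ℝ) : (bdry p t : ℂ) = toDisk p t := rfl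

/-- The real coordinate of a boundary point, `p` being at infinity. -/
def coord (p q : Circle) : ℝ := (toHalfPlane p q).re

theorem coord_bdry (p : Circle) (t : ℝ) : coord p (bdry p t) = t := by
  rw [coord, coe_bdry, toHalfPlane_toDisk p (ofReal_add_I_ne_zero t), ofReal_re]

theorem bdry_injective (p : Circle) : Function.Injective (bdry p) := fun s t h => by
  rw [← coord_bdry p s, h, coord_bdry]

theorem bdry_ne (p : Circle) (t : ℝ) : bdry p t ≠ p := fun h =>
  toDisk_ne p (ofReal_add_I_ne_zero t) (congrArg Subtype.val h)

theorem bdry_coord {p q : Circle} (h : q ≠ p) : bdry p (coord p q) = q := by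
  have h1 : (q : ℂ) ≠ p := fun e => h (Circle.coe_injective e)
  have h2 : toHalfPlane p q = (coord p q : ℂ) := by
    apply Complex.ext
    · rfl
    · rw [toHalfPlane_im, normSq_eq_norm_sq, Circle.norm_coe]; simp
  apply Circle.coe_injective
  rw [coe_bdry, ← h2, toDisk_toHalfPlane h1]

/-- Up to a positive factor the quantity defining `CCW` is `(s + I) * conj (t + I)`, with imaginary
part `t - s`. -/
theorem ccw_bdry_iff (p : Circle) {s t : ℝ} : CCW p (bdry p s) (bdry p t) ↔ s < t := by
  have hs := ofReal_add_I_ne_zero s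
  have ht := ofReal_add_I_ne_zero t
  have hp : (p : ℂ) * conj (p : ℂ) = 1 := by rw [mul_conj]; simp
  have e : conj ((bdry p s : ℂ) - p) * ((bdry p t : ℂ) - p) =
      (((4 / (normSq (s + I) * normSq (t + I)) : ℝ) : ℂ)) * ((s + I) * conj ((t : ℂ) + I)) := by
    rw [← neg_sub, ← neg_sub (p : ℂ), coe_bdry, coe_bdry, sub_toDisk p hs, sub_toDisk p ht]
    push_cast
    rw [normSq_eq_conj_mul_self, normSq_eq_conj_mul_self]
    have hs' : conj ((s : ℂ) + I) ≠ 0 := (map_ne_zero _).2 hs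
    have ht' : conj ((t : ℂ) + I) ≠ 0 := (map_ne_zero _).2 ht
    simp only [map_neg, map_div₀, map_mul, conj_I, map_ofNat]
    field_simp
    linear_combination (-(4:ℂ) * I ^ 2) * hp - 4 * I_sq
  have hpos : 0 < 4 / (normSq (s + I) * normSq (t + I)) :=
    div_pos four_pos (mul_pos (normSq_pos.2 hs) (normSq_pos.2 ht))
  have e2 : (((s : ℂ) + I) * conj ((t : ℂ) + I)).im = t - s := by
    simp; ring
  rw [CCW, e, im_ofReal_mul, e2, mul_pos_iff_of_pos_left hpos, sub_pos]

theorem ccw_bdry_bdry {p : Circle} {r s t : ℝ} (h1 : r < s) (h2 : s < t) :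
    CCW (bdry p r) (bdry p s) (bdry p t) := by
  have hr := ofReal_add_I_ne_zero r
  have hs := ofReal_add_I_ne_zero s
  have ht := ofReal_add_I_ne_zero t
  have hp : (p : ℂ) * conj (p : ℂ) = 1 := by rw [mul_conj]; simp
  have e : conj ((bdry p s : ℂ) - bdry p r) * ((bdry p t : ℂ) - bdry p r) =
      (((4 * (s - r) * (t - r) / (normSq (s + I) * normSq (t + I) * normSq (r + I)) : ℝ) : ℂ)) *
        ((s + I) * conj ((t : ℂ) + I)) := by
    rw [coe_bdry, coe_bdry, coe_bdry, toDisk_sub_toDisk p hs hr, toDisk_sub_toDisk p ht hr]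
    push_cast
    rw [normSq_eq_conj_mul_self, normSq_eq_conj_mul_self, normSq_eq_conj_mul_self]
    have hr' : conj ((r : ℂ) + I) ≠ 0 := (map_ne_zero _).2 hr
    have hs' : conj ((s : ℂ) + I) ≠ 0 := (map_ne_zero _).2 hs
    have ht' : conj ((t : ℂ) + I) ≠ 0 := (map_ne_zero _).2 ht
    simp only [map_div₀, map_mul, conj_I, map_ofNat, map_sub, conj_ofReal]
    field_simp
    linear_combination (s - r) * (t - r) * ((-(4:ℂ) * I ^ 2) * hp - 4 * I_sq)
  have hpos : 0 < 4 * (s - r) * (t - r) / (normSq (s + I) * normSq (t + I) * normSq (r + I)) :=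
    div_pos (mul_pos (mul_pos four_pos (by linarith)) (by linarith))
      (mul_pos (mul_pos (normSq_pos.2 hs) (normSq_pos.2 ht)) (normSq_pos.2 hr))
  have e2 : (((s : ℂ) + I) * conj ((t : ℂ) + I)).im = t - s := by
    simp; ring
  rw [CCW, e, im_ofReal_mul, e2, mul_pos_iff_of_pos_left hpos, sub_pos]
  exact h2

theorem coord_lt_coord_iff {p a b : Circle} (ha : a ≠ p) (hb : b ≠ p) :
    coord p a < coord p b ↔ CCW p a b := by
  rw [← ccw_bdry_iff p, bdry_coord ha, bdry_coord hb]

/-- Every difference acquires a factor depending on its two end points, and each point occurs once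
in the numerator and once in the denominator. -/
theorem crossRatio_toDisk (p : Circle) {r s t u : ℂ} (hr : r + I ≠ 0) (hs : s + I ≠ 0)
    (ht : t + I ≠ 0) (hu : u + I ≠ 0) :
    crossRatio (toDisk p r) (toDisk p s) (toDisk p t) (toDisk p u) = crossRatio r s t u := by
  have hp : (p : ℂ) ≠ 0 := Circle.coe_ne_zero p
  have hI := I_ne_zero
  rw [crossRatio, toDisk_sub_toDisk p hs ht, toDisk_sub_toDisk p hu hr, toDisk_sub_toDisk p hr hs,
    toDisk_sub_toDisk p ht hu, crossRatio]
  -- Cancelling a common factor keeps the identity valid when some of the four points coincide.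
  rw [show ∀ A B : ℂ, (p : ℂ) * (2 * I) * A / ((s + I) * (t + I)) *
      (p * (2 * I) * B / ((u + I) * (r + I))) = ((p : ℂ) * (2 * I)) ^ 2 / ((r + I) * (s + I) *
        (t + I) * (u + I)) * (A * B) by intro A B; field_simp,
    show ∀ A B : ℂ, (p : ℂ) * (2 * I) * A / ((r + I) * (s + I)) *
      (p * (2 * I) * B / ((t + I) * (u + I))) = ((p : ℂ) * (2 * I)) ^ 2 / ((r + I) * (s + I) *
        (t + I) * (u + I)) * (A * B) by intro A B; field_simp]
  exact mul_div_mul_left _ _ (div_ne_zero (pow_ne_zero 2 (mul_ne_zero hp (mul_ne_zero two_ne_zero hI)))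
    (mul_ne_zero (mul_ne_zero (mul_ne_zero hr hs) ht) hu))

theorem crossRatio_infty_toDisk (p : Circle) {s t u : ℂ} (hs : s + I ≠ 0)
    (ht : t + I ≠ 0) (hu : u + I ≠ 0) :
    crossRatio p (toDisk p s) (toDisk p t) (toDisk p u) = -(t - s) / (u - t) := by
  have hp : (p : ℂ) ≠ 0 := Circle.coe_ne_zero p
  have hI := I_ne_zero
  have e0 : toDisk p u - p = -(p * (2 * I) / (u + I)) := by rw [← sub_toDisk p hu]; ring
  rw [crossRatio, toDisk_sub_toDisk p hs ht, sub_toDisk p hs, e0,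
    toDisk_sub_toDisk p ht hu, ← neg_sub u t, ← neg_sub t s]
  rw [show ∀ A : ℂ, (p : ℂ) * (2 * I) * A / ((s + I) * (t + I)) *
      -(p * (2 * I) / ((u + I))) = (-((p : ℂ) * (2 * I)) ^ 2 / ((s + I) *
        (t + I) * (u + I))) * A by intro A; field_simp,
    show ∀ A : ℂ, (p : ℂ) * (2 * I) / (s + I) *
      (p * (2 * I) * -A / ((t + I) * (u + I))) = (-((p : ℂ) * (2 * I)) ^ 2 / ((s + I) *
        (t + I) * (u + I))) * A by intro A; field_simp]
  exact mul_div_mul_left _ _ (div_ne_zero (neg_ne_zero.2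
    (pow_ne_zero 2 (mul_ne_zero hp (mul_ne_zero two_ne_zero hI)))) (mul_ne_zero (mul_ne_zero hs ht) hu))

theorem crossRatio_toDisk_infty (p : Circle) {s t u : ℂ} (hs : s + I ≠ 0)
    (ht : t + I ≠ 0) (hu : u + I ≠ 0) :
    crossRatio (toDisk p s) (toDisk p t) p (toDisk p u) = (u - s) / (t - s) := by
  have hp : (p : ℂ) ≠ 0 := Circle.coe_ne_zero p
  have hI := I_ne_zero
  have e0 : toDisk p t - p = -(p * (2 * I) / (t + I)) := by rw [← sub_toDisk p ht]; ring
  rw [crossRatio, e0, toDisk_sub_toDisk p hs ht, sub_toDisk p hu,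
    toDisk_sub_toDisk p hu hs, ← neg_sub t s]
  rw [show ∀ A : ℂ, -(p * (2 * I) / ((t + I))) * ((p : ℂ) * (2 * I) * A / ((u + I) * (s + I))) =
      (-((p : ℂ) * (2 * I)) ^ 2 / ((s + I) * (t + I) * (u + I))) * A by intro A; field_simp,
    show ∀ A : ℂ, (p * (2 * I) * -A / ((s + I) * (t + I))) * ((p : ℂ) * (2 * I) / (u + I)) =
      (-((p : ℂ) * (2 * I)) ^ 2 / ((s + I) * (t + I) * (u + I))) * A by intro A; field_simp]
  exact mul_div_mul_left _ _ (div_ne_zero (neg_ne_zero.2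
    (pow_ne_zero 2 (mul_ne_zero hp (mul_ne_zero two_ne_zero hI)))) (mul_ne_zero (mul_ne_zero hs ht) hu))

theorem tendsto_bdry {α : Type*} {F : Filter α} {y : α → ℝ} {t : ℝ} (p : Circle)
    (h : Tendsto y F (𝓝 t)) : Tendsto (fun a => (bdry p (y a) : ℂ)) F (𝓝 (bdry p t)) := by
  simp only [coe_bdry, toDisk]
  have h1 : Tendsto (fun a => (y a : ℂ)) F (𝓝 (t : ℂ)) := (continuous_ofReal.tendsto t).comp h
  exact (tendsto_const_nhds.mul (h1.sub_const I)).div (h1.add_const I) (ofReal_add_I_ne_zero t)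

/-- The distance from `p` is `2 / |y + I|`, at most `2 / |y|`. The same limit is reached from both
ends of the real line. -/
theorem tendsto_bdry_atTop {α : Type*} {F : Filter α} {y : α → ℝ} (p : Circle)
    (h : Tendsto (fun a => |y a|) F atTop) : Tendsto (fun a => (bdry p (y a) : ℂ)) F (𝓝 p) := by
  rw [tendsto_iff_norm_sub_tendsto_zero]
  have h1 : Tendsto (fun a => 2 / |y a|) F (𝓝 0) := h.const_div_atTop 2
  refine squeeze_zero' (Eventually.of_forall fun _ => norm_nonneg _) ?_ h1
  filter_upwards [h.eventually_gt_atTop 0] with a ha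
  rw [norm_sub_rev, coe_bdry, sub_toDisk p (ofReal_add_I_ne_zero _), norm_div, norm_mul,
    Circle.norm_coe, norm_mul, norm_I]
  simp only [RCLike.norm_ofNat, one_mul, mul_one]
  refine div_le_div_of_nonneg_left zero_le_two ha ?_
  simpa using abs_re_le_norm ((y a : ℂ) + I)

/-! ### Seams -/

/-- A circle in the disk tangent to the boundary is a line in the half plane. -/
theorem mem_seam_iff {p : Circle} {r : ℝ} (hr : 0 < r) {w : ℂ} (hw : w ≠ p) :
    w ∈ sphere ((1 - (r : ℂ)) * (p : ℂ)) r ↔ (toHalfPlane p w).im = 1 / r - 1 := by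
  have hp : normSq (p : ℂ) = 1 := by simp
  have h1 : (0 : ℝ) < normSq (p - w) := normSq_pos.2 (sub_ne_zero.2 hw.symm)
  have e1 : normSq (p - w) = 1 - 2 * ((p : ℂ).re * w.re + (p : ℂ).im * w.im) + normSq w := by
    rw [← hp]; simp [normSq_apply]; ring
  have e2 : normSq (w - (1 - (r : ℂ)) * (p : ℂ)) =
      normSq w - 2 * (1 - r) * ((p : ℂ).re * w.re + (p : ℂ).im * w.im) + (1 - r) ^ 2 := by
    have : (1 - r) ^ 2 = (1 - r) ^ 2 * normSq (p : ℂ) := by rw [hp, mul_one]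
    rw [this]; simp [normSq_apply]; ring
  rw [mem_sphere_iff_norm, toHalfPlane_im, ← pow_left_inj₀ (norm_nonneg _) hr.le two_ne_zero,
    ← normSq_eq_norm_sq, e2, div_eq_iff h1.ne', e1]
  constructor
  · intro h
    field_simp
    linear_combination -h
  · intro h
    field_simp at h
    linear_combination -h

theorem coe_mem_seam {p : Circle} {r : ℝ} (hr : 0 < r) :
    (p : ℂ) ∈ sphere ((1 - (r : ℂ)) * (p : ℂ)) r := by
  rw [mem_sphere_iff_norm, show (p : ℂ) - (1 - r) * p = r * p by ring, norm_mul, Circle.norm_coe,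
    mul_one, norm_real, Real.norm_of_nonneg hr.le]

/-! ### Affine maps of the half plane as isomorphisms of the disk -/

/-- The map of the disk corresponding to the affine map `u ↦ a * u + b` of the half plane. -/
def affineMap (p p' : Circle) (a b : ℝ) (z : ℂ) : ℂ :=
  p' * (a * I * (p + z) + (b - I) * (p - z)) / (a * I * (p + z) + (b + I) * (p - z))

/-- Compares denominator and numerator of `affineMap`: the map preserves the closed and the open
disk, and the denominator cannot vanish. -/
theorem normSq_affineMap_aux (p : Circle) (a b : ℝ) (z : ℂ) :
    normSq (a * I * (p + z) + (b + I) * (p - z)) - normSq (a * I * (p + z) + (b - I) * (p - z)) =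
      4 * a * (1 - normSq z) := by
  have hp : normSq (p : ℂ) = 1 := by simp
  rw [← hp]
  simp [normSq_apply]
  ring

theorem affineMap_denom_ne_zero (p : Circle) {a : ℝ} (ha : 0 < a) (b : ℝ) {z : ℂ} (hz : ‖z‖ ≤ 1) :
    (a * I * (p + z) + (b + I) * (p - z) : ℂ) ≠ 0 := by
  intro h
  have h1 := normSq_affineMap_aux p a b z
  rw [h, map_zero, normSq_eq_norm_sq z] at h1
  have h2 : 0 ≤ 4 * a * (1 - ‖z‖ ^ 2) := by
    apply mul_nonneg (by positivity); nlinarith [norm_nonneg z]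
  -- If the denominator vanishes, so does the numerator. Their difference then gives `z = p`, where
  -- the denominator is `2 * a * I * p`, which is not zero.
  have h3 : (a * I * (p + z) + (b - I) * (p - z) : ℂ) = 0 := by
    rw [← normSq_eq_zero]
    linarith [normSq_nonneg (a * I * (p + z) + (b - I) * (p - z) : ℂ)]
  have h4 : 2 * I * ((p : ℂ) - z) = 0 := by linear_combination h - h3
  have h5 : (p : ℂ) - z = 0 := by simpa using h4
  have h6 : z = p := by linear_combination -h5
  rw [h5, h6] at h
  have hp : (p : ℂ) ≠ 0 := Circle.coe_ne_zero p
  have : (2 * a * I * p : ℂ) = 0 := by linear_combination h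
  simp [ha.ne'] at this

theorem norm_affineMap_le (p p' : Circle) {a : ℝ} (ha : 0 < a) (b : ℝ) {z : ℂ} (hz : ‖z‖ ≤ 1) :
    ‖affineMap p p' a b z‖ ≤ 1 := by
  have h1 := normSq_affineMap_aux p a b z
  have h2 : 0 ≤ 4 * a * (1 - normSq z) := by
    rw [normSq_eq_norm_sq]
    apply mul_nonneg (by positivity); nlinarith [norm_nonneg z]
  rw [affineMap, norm_div, norm_mul, Circle.norm_coe, one_mul,
    div_le_one (norm_pos_iff.2 (affineMap_denom_ne_zero p ha b hz)),
    ← pow_le_pow_iff_left₀ (norm_nonneg _) (norm_nonneg _) two_ne_zero, ← normSq_eq_norm_sq,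
    ← normSq_eq_norm_sq]
  linarith

theorem norm_affineMap_lt (p p' : Circle) {a : ℝ} (ha : 0 < a) (b : ℝ) {z : ℂ} (hz : ‖z‖ < 1) :
    ‖affineMap p p' a b z‖ < 1 := by
  have h1 := normSq_affineMap_aux p a b z
  have h2 : 0 < 4 * a * (1 - normSq z) := by
    rw [normSq_eq_norm_sq]
    apply mul_pos (by positivity); nlinarith [norm_nonneg z]
  rw [affineMap, norm_div, norm_mul, Circle.norm_coe, one_mul,
    div_lt_one (norm_pos_iff.2 (affineMap_denom_ne_zero p ha b hz.le)),
    ← pow_lt_pow_iff_left₀ (norm_nonneg _) (norm_nonneg _) two_ne_zero, ← normSq_eq_norm_sq,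
    ← normSq_eq_norm_sq]
  linarith

theorem differentiableOn_affineMap (p p' : Circle) {a : ℝ} (ha : 0 < a) (b : ℝ) {z : ℂ}
    (hz : ‖z‖ ≤ 1) : DifferentiableAt ℂ (affineMap p p' a b) z := by
  have := affineMap_denom_ne_zero p ha b hz
  unfold affineMap
  fun_prop (disch := exact this)

theorem affineMap_affineMap (p p' : Circle) {a : ℝ} (ha : 0 < a) (b : ℝ) {z : ℂ}
    (hz : ‖z‖ ≤ 1) : affineMap p' p a⁻¹ (-b / a) (affineMap p p' a b z) = z := by
  have hD := affineMap_denom_ne_zero p ha b hz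
  have hp : (p : ℂ) ≠ 0 := Circle.coe_ne_zero p
  have hp' : (p' : ℂ) ≠ 0 := Circle.coe_ne_zero p'
  have ha' : (a : ℂ) ≠ 0 := by exact_mod_cast ha.ne'
  obtain ⟨D, hDd⟩ : ∃ D, D = (a * I * (p + z) + (b + I) * (p - z) : ℂ) := ⟨_, rfl⟩
  rw [← hDd] at hD
  obtain ⟨w, hw⟩ : ∃ w, w = affineMap p p' a b z := ⟨_, rfl⟩
  have hwD : w * D = p' * (a * I * (p + z) + (b - I) * (p - z)) := by
    rw [hw, affineMap, ← hDd, div_mul_cancel₀ _ hD]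
  -- The numerator and denominator of the outer map have the common factor `-4 * p' / D`; what
  -- remains is `z` over `p`.
  have e1 : ((a⁻¹ : ℝ) * I * (p' + w) + ((-b / a : ℝ) - I) * (p' - w) : ℂ) = -4 * p' * z / D := by
    rw [eq_div_iff hD]
    push_cast
    field_simp
    linear_combination (I + b + a * I) * hwD + (p' * (I - b - a * I)) * hDd + 4 * a * p' * z * I_sq
  have e2 : ((a⁻¹ : ℝ) * I * (p' + w) + ((-b / a : ℝ) + I) * (p' - w) : ℂ) = -4 * p' * p / D := by
    rw [eq_div_iff hD]
    push_cast
    field_simp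
    linear_combination (I + b - a * I) * hwD + (p' * (I - b + a * I)) * hDd + 4 * a * p' * p * I_sq
  rw [← hw, affineMap, e1, e2]
  field_simp

/-- The isomorphism of the disk corresponding to an affine map of the half plane. -/
def affineIso (p p' : Circle) (a b : ℝ) (ha : 0 < a) : DiskIso where
  toFun := affineMap p p' a b
  invFun := affineMap p' p a⁻¹ (-b / a)
  continuousOn_toFun z hz := (differentiableOn_affineMap p p' ha b
    (mem_closedBall_zero_iff.1 hz)).continuousAt.continuousWithinAt
  continuousOn_invFun z hz := (differentiableOn_affineMap p' p (inv_pos.2 ha) _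
    (mem_closedBall_zero_iff.1 hz)).continuousAt.continuousWithinAt
  mapsTo_closedBall z hz := mem_closedBall_zero_iff.2
    (norm_affineMap_le p p' ha b (mem_closedBall_zero_iff.1 hz))
  mapsTo_closedBall_inv z hz := mem_closedBall_zero_iff.2
    (norm_affineMap_le p' p (inv_pos.2 ha) _ (mem_closedBall_zero_iff.1 hz))
  left_inv z hz := affineMap_affineMap p p' ha b (mem_closedBall_zero_iff.1 hz)
  right_inv z hz := by
    have h := affineMap_affineMap p' p (inv_pos.2 ha) (-b / a) (mem_closedBall_zero_iff.1 hz)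
    rwa [inv_inv, show -(-b / a) / a⁻¹ = b by field_simp] at h
  mapsTo_ball z hz := mem_ball_zero_iff.2
    (norm_affineMap_lt p p' ha b (mem_ball_zero_iff.1 hz))
  mapsTo_ball_inv z hz := mem_ball_zero_iff.2
    (norm_affineMap_lt p' p (inv_pos.2 ha) _ (mem_ball_zero_iff.1 hz))
  differentiableOn_toFun z hz := (differentiableOn_affineMap p p' ha b
    (mem_ball_zero_iff.1 hz).le).differentiableWithinAt
  differentiableOn_invFun z hz := (differentiableOn_affineMap p' p (inv_pos.2 ha) _
    (mem_ball_zero_iff.1 hz).le).differentiableWithinAt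

theorem affineIso_infty (p p' : Circle) {a : ℝ} (b : ℝ) (ha : 0 < a) :
    affineIso p p' a b ha p = p' := by
  have hp : (p : ℂ) ≠ 0 := Circle.coe_ne_zero p
  have ha' : (a : ℂ) ≠ 0 := by exact_mod_cast ha.ne'
  have hI := I_ne_zero
  change affineMap p p' a b p = p'
  rw [affineMap, sub_self, mul_zero, mul_zero, add_zero]
  field_simp

theorem affineIso_toDisk (p p' : Circle) {a : ℝ} (b : ℝ) (ha : 0 < a) {u : ℂ} (hu : 0 ≤ u.im) :
    affineIso p p' a b ha (toDisk p u) = toDisk p' (a * u + b) := by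
  have hp : (p : ℂ) ≠ 0 := Circle.coe_ne_zero p
  have ha' : (a : ℂ) ≠ 0 := by exact_mod_cast ha.ne'
  have hI := I_ne_zero
  have h1 := add_I_ne_zero hu
  have h2 : (a * u + b : ℂ) + I ≠ 0 := add_I_ne_zero (by
    simp only [add_im, mul_im, ofReal_re, ofReal_im, zero_mul, add_zero]; positivity)
  have e0 : (p : ℂ) + toDisk p u = 2 * p * u / (u + I) := by
    rw [toDisk]; field_simp; ring
  have e1 : (a * I * (p + toDisk p u) + (b - I) * (p - toDisk p u) : ℂ) =
      (p * (2 * I) / (u + I)) * (a * u + b - I) := by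
    rw [sub_toDisk p h1, e0]; field_simp; ring
  have e2 : (a * I * (p + toDisk p u) + (b + I) * (p - toDisk p u) : ℂ) =
      (p * (2 * I) / (u + I)) * (a * u + b + I) := by
    rw [sub_toDisk p h1, e0]; field_simp; ring
  change affineMap p p' a b (toDisk p u) = _
  rw [affineMap, e1, e2, toDisk]
  field_simp

theorem affineIso_bdry (p p' : Circle) {a : ℝ} (b : ℝ) (ha : 0 < a) (t : ℝ) :
    affineIso p p' a b ha (bdry p t) = bdry p' (a * t + b) := by
  rw [coe_bdry, affineIso_toDisk p p' b ha (by simp), coe_bdry]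
  push_cast; rfl

/-- In the half plane the seam is the horizontal line at height `1 / r - 1`, and the affine map
multiplies heights by `a`. -/
theorem affineIso_seam_subset (p p' : Circle) {a : ℝ} (b : ℝ) (ha : 0 < a) {r r' : ℝ}
    (hr : 0 < r) (hr1 : r < 1) (hr' : 0 < r') (h : 1 / r' - 1 = a * (1 / r - 1)) {w : ℂ}
    (hw : w ∈ sphere ((1 - (r : ℂ)) * (p : ℂ)) r) :
    affineMap p p' a b w ∈ sphere ((1 - (r' : ℂ)) * (p' : ℂ)) r' := by
  by_cases hwp : w = p
  · have := affineIso_infty p p' b ha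
    subst hwp
    change affineMap p p' a b p = p' at this
    rw [this]
    exact coe_mem_seam hr'
  · have h1 := (mem_seam_iff hr hwp).1 hw
    have h0 : 0 ≤ (toHalfPlane p w).im := by
      rw [h1, sub_nonneg, le_div_iff₀ hr]; linarith
    have h2 := affineIso_toDisk p p' b ha h0
    rw [toDisk_toHalfPlane hwp] at h2
    change affineMap p p' a b w = _ at h2
    have h3 : (a * toHalfPlane p w + b : ℂ) + I ≠ 0 := add_I_ne_zero (by
      simp only [add_im, mul_im, ofReal_re, ofReal_im, zero_mul, add_zero]; positivity)
    rw [h2, mem_seam_iff hr' (toDisk_ne _ h3), toHalfPlane_toDisk _ h3, h, ← h1]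
    simp

theorem affineIso_image_seam (p p' : Circle) {a : ℝ} (b : ℝ) (ha : 0 < a) {r r' : ℝ}
    (hr : 0 < r) (hr1 : r < 1) (hr' : 0 < r') (hr1' : r' < 1)
    (h : 1 / r' - 1 = a * (1 / r - 1))
    (hs : sphere ((1 - (r' : ℂ)) * (p' : ℂ)) r' ⊆ closedBall 0 1) :
    affineIso p p' a b ha '' sphere ((1 - (r : ℂ)) * (p : ℂ)) r =
      sphere ((1 - (r' : ℂ)) * (p' : ℂ)) r' := by
  apply Subset.antisymm
  · rintro _ ⟨w, hw, rfl⟩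
    exact affineIso_seam_subset p p' b ha hr hr1 hr' h hw
  · intro w hw
    refine ⟨affineMap p' p a⁻¹ (-b / a) w, ?_, (affineIso p p' a b ha).right_inv (hs hw)⟩
    refine affineIso_seam_subset p' p _ (inv_pos.2 ha) hr' hr1' hr ?_ hw
    rw [h]; field_simp

end QuiltedDisk

end


noncomputable section

namespace QuiltedDisk

open Complex Filter Topology NodalDisk

/-! ### The cross-ratios of real configurations -/

/-- The cross-ratio of the points of a real configuration, with the marking `0` at infinity. -/
def realRho {n : ℕ} (x : Fin (n + 1) → ℝ) (i j k l : Fin (n + 1)) : ℝ :=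
  if i = 0 then -(x k - x j) / (x l - x k)
  else ((x j - x k) * (x l - x i)) / ((x i - x j) * (x k - x l))

/-- The values of all cross-ratios and quilted cross-ratios for a single disk with a real
configuration of markings and a seam at height one. -/
def realRhoMap (n : ℕ) (x : Fin (n + 1) → ℝ) : (Quad n → EReal) × (Pair n → EReal) :=
  (fun q => (realRho x q.1.1 q.1.2.1 q.1.2.2.1 q.1.2.2.2 : ℝ),
    fun p => ((1 / (x p.1.2 - x p.1.1) : ℝ) : EReal))

/-- The configurations of points in increasing order. -/
def Increasing {n : ℕ} (x : Fin (n + 1) → ℝ) : Prop :=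
  ∀ i j, 0 < i → i < j → x i < x j

variable {n : ℕ}

/-- The sign matters in the limit: it makes a cross-ratio with vanishing inverse tend to `-∞` and
not to `+∞`. -/
theorem realRho_neg {x : Fin (n + 1) → ℝ} (hx : Increasing x) {i j k l : Fin (n + 1)}
    (hij : i < j) (hjk : j < k) (hkl : k < l) : realRho x i j k l < 0 := by
  have hj : 0 < j := (Fin.zero_le i).trans_lt hij
  have h1 := hx j k hj hjk
  have h2 := hx k l (hj.trans hjk) hkl
  rw [realRho]
  split_ifs with h
  · exact div_neg_of_neg_of_pos (by linarith) (by linarith)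
  · have hi : 0 < i := Fin.pos_of_ne_zero h
    have h3 := hx i j hi hij
    exact div_neg_of_neg_of_pos (mul_neg_of_neg_of_pos (by linarith) (by linarith))
      (mul_pos_of_neg_of_neg (by linarith) (by linarith))

/-- Hence the limit of a cross-ratio may be computed after the rescaling that belongs to any chosen
component. -/
theorem realRho_affine (x : Fin (n + 1) → ℝ) {a : ℝ} (ha : a ≠ 0) (b : ℝ)
    (i j k l : Fin (n + 1)) : realRho (fun m => a * x m + b) i j k l = realRho x i j k l := by
  simp only [realRho]
  split_ifs
  · rw [show -(a * x k + b - (a * x j + b)) = a * -(x k - x j) by ring,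
      show a * x l + b - (a * x k + b) = a * (x l - x k) by ring, mul_div_mul_left _ _ ha]
  · rw [show (a * x j + b - (a * x k + b)) * (a * x l + b - (a * x i + b)) =
        a ^ 2 * ((x j - x k) * (x l - x i)) by ring,
      show (a * x i + b - (a * x j + b)) * (a * x k + b - (a * x l + b)) =
        a ^ 2 * ((x i - x j) * (x k - x l)) by ring, mul_div_mul_left _ _ (pow_ne_zero 2 ha)]

/-- The markings on the boundary of the disk given by a real configuration. -/
def diskPoint (p : Circle) (x : Fin (n + 1) → ℝ) (m : Fin (n + 1)) : Circle :=
  if m = 0 then p else bdry p (x m)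

theorem crossRatio_diskPoint (p : Circle) (x : Fin (n + 1) → ℝ) {i j k l : Fin (n + 1)}
    (hij : i < j) (hjk : j < k) (hkl : k < l) :
    crossRatio (diskPoint p x i) (diskPoint p x j) (diskPoint p x k) (diskPoint p x l) =
      (realRho x i j k l : ℂ) := by
  have hj : 0 < j := (Fin.zero_le i).trans_lt hij
  have hk := hj.trans hjk
  have hl := hk.trans hkl
  simp only [diskPoint, realRho, hj.ne', hk.ne', hl.ne', if_false]
  split_ifs
  · rw [coe_bdry, coe_bdry, coe_bdry, crossRatio_infty_toDisk _ (ofReal_add_I_ne_zero _)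
      (ofReal_add_I_ne_zero _) (ofReal_add_I_ne_zero _)]
    push_cast; rfl
  · rw [coe_bdry, coe_bdry, coe_bdry, coe_bdry, crossRatio_toDisk _ (ofReal_add_I_ne_zero _)
      (ofReal_add_I_ne_zero _) (ofReal_add_I_ne_zero _) (ofReal_add_I_ne_zero _), crossRatio]
    push_cast; rfl

namespace StableQuiltedDisk

variable {S : StableQuiltedDisk n}

/-! ### Evaluation of the cross-ratios -/

/-- The coordinate of the branch towards a marking in the half plane model of a component. -/
def pos (S : StableQuiltedDisk n) (v : S.V) (k : Fin (n + 1)) : ℝ :=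
  coord (S.branch v 0) (S.branch v k)

/-- The height of the seam in the half plane model. -/
def height (S : StableQuiltedDisk n) (v : S.V) : ℝ := 1 / S.radius v - 1

theorem height_pos {v : S.V} (hv : v ∈ S.quilted) : 0 < S.height v := by
  obtain ⟨h0, h1⟩ := S.radius_mem v hv
  rw [height, sub_pos, lt_div_iff₀ h0]; linarith

theorem bdry_pos {v : S.V} {k : Fin (n + 1)} (hk : k ∈ S.beyond v) :
    bdry (S.branch v 0) (S.pos v k) = S.branch v k := bdry_coord hk

theorem pos_eq_pos_iff {v : S.V} {i j : Fin (n + 1)} (hi : i ∈ S.beyond v) (hj : j ∈ S.beyond v) :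
    S.pos v i = S.pos v j ↔ S.branch v i = S.branch v j :=
  ⟨fun h => by rw [← bdry_pos hi, ← bdry_pos hj, h], fun h => by rw [pos, pos, h]⟩

theorem pos_lt_pos {v : S.V} {i j : Fin (n + 1)} (hi : i ∈ S.beyond v) (hj : j ∈ S.beyond v)
    (hij : i < j) (h : S.branch v i ≠ S.branch v j) : S.pos v i < S.pos v j :=
  (coord_lt_coord_iff hi hj).2 (S.ordered v 0 i j
    (Fin.pos_of_ne_zero (ne_zero_of_mem_beyond hi)) hij (Ne.symm hi) h (Ne.symm hj))

theorem pos_le_pos {v : S.V} {i j : Fin (n + 1)} (hi : i ∈ S.beyond v) (hj : j ∈ S.beyond v)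
    (hij : i ≤ j) : S.pos v i ≤ S.pos v j := by
  by_cases h : S.branch v i = S.branch v j
  · exact ((pos_eq_pos_iff hi hj).2 h).le
  · exact (pos_lt_pos hi hj (lt_of_le_of_ne hij (by rintro rfl; exact h rfl)) h).le

/-- Three markings meet at only one component, so the existential in the definition can be evaluated
at `v`. -/
theorem isCrossRatio_iff {v : S.V} {i j k l : Fin (n + 1)} (h : S.Meet v i j k) {x : ℝ} :
    S.IsCrossRatio i j k l x ↔ (S.branch v i ≠ S.branch v l ∧ S.branch v j ≠ S.branch v l ∧
      S.branch v k ≠ S.branch v l) ∧ (x : ℂ) =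
        QuiltedDisk.crossRatio (S.branch v i) (S.branch v j) (S.branch v k) (S.branch v l) := by
  constructor
  · rintro ⟨w, hw, hx⟩
    simp only [List.nodup_cons, List.mem_cons, not_or, List.not_mem_nil, not_false_eq_true,
      and_true, List.nodup_nil] at hw
    obtain ⟨⟨h1, h2, h3⟩, ⟨h4, h5⟩, h6⟩ := hw
    obtain rfl : w = v := Meet.unique ⟨h1, h2, h4⟩ h
    exact ⟨⟨h3, h5, h6⟩, hx⟩
  · rintro ⟨⟨h1, h2, h3⟩, hx⟩
    refine ⟨v, ?_, hx⟩
    obtain ⟨h4, h5, h6⟩ := h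
    simp [*]

theorem separated_iff {v : S.V} {i j k l : Fin (n + 1)} (h : S.Meet v i j k) :
    S.Separated i j k l ↔ S.branch v k = S.branch v l := by
  constructor
  · rintro ⟨w, hw, hx⟩
    simp only [List.nodup_cons, List.mem_cons, not_or, List.not_mem_nil, not_false_eq_true,
      and_true, List.nodup_nil] at hw
    obtain ⟨⟨h1, h2⟩, h4⟩ := hw
    obtain rfl : w = v := Meet.unique ⟨h1, h2, h4⟩ h
    exact hx
  · intro hx
    refine ⟨v, ?_, hx⟩
    obtain ⟨h4, h5, h6⟩ := h
    simp [h4, h5, h6]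

theorem rho_eq_coe {i j k l : Fin (n + 1)} {x : ℝ} (h : S.IsCrossRatio i j k l x)
    (hu : ∀ y, S.IsCrossRatio i j k l y → y = x) : S.rho i j k l = x := by
  have h' : ∃ x : ℝ, S.IsCrossRatio i j k l x := ⟨x, h⟩
  rw [rho, dif_pos h', hu _ h'.choose_spec]

theorem rho_of_meet {v : S.V} {i j k l : Fin (n + 1)} (h : S.Meet v i j k)
    (hi : S.branch v i ≠ S.branch v l) (hj : S.branch v j ≠ S.branch v l)
    (hk : S.branch v k ≠ S.branch v l) {x : ℝ} (hx : (x : ℂ) =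
      QuiltedDisk.crossRatio (S.branch v i) (S.branch v j) (S.branch v k) (S.branch v l)) :
    S.rho i j k l = x := by
  refine rho_eq_coe ((isCrossRatio_iff h).2 ⟨⟨hi, hj, hk⟩, hx⟩) fun y hy => ?_
  have := ((isCrossRatio_iff h).1 hy).2
  rw [← hx] at this
  exact_mod_cast this

theorem rho_of_meet_bot {v : S.V} {i j k l : Fin (n + 1)} (h : S.Meet v i j k)
    (hk : S.branch v k = S.branch v l) : S.rho i j k l = ⊥ := by
  rw [rho, dif_neg, if_pos ((separated_iff h).2 hk)]
  rintro ⟨x, hx⟩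
  exact ((isCrossRatio_iff h).1 hx).1.2.2 hk

theorem rho_of_meet_zero {v : S.V} {i j k l : Fin (n + 1)} (h : S.Meet v i j k)
    (hl : S.branch v i = S.branch v l ∨ S.branch v j = S.branch v l) : S.rho i j k l = 0 := by
  obtain ⟨h1, h2, h3⟩ := h
  rw [rho, dif_neg, if_neg]
  · rw [separated_iff ⟨h1, h2, h3⟩]
    intro e
    rcases hl with hl | hl
    · exact h2 (hl.trans e.symm)
    · exact h3 (hl.trans e.symm)
  · rintro ⟨x, hx⟩
    have := ((isCrossRatio_iff ⟨h1, h2, h3⟩).1 hx).1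
    tauto

/-- With the root direction at infinity the cross-ratio is `(w - s) / (t - s)` for the real
coordinates `s`, `t` of the branches towards `i`, `j`; its imaginary part involves only the height
of `w`. -/
theorem quiltedCrossRatio_seam {v : S.V} (hv : v ∈ S.quilted) {i j : Fin (n + 1)}
    (hi : i ∈ S.beyond v) (hj : j ∈ S.beyond v) {w : ℂ} (hw : w ∈ S.seam v)
    (hw0 : w ≠ (S.branch v 0 : ℂ)) :
    (QuiltedDisk.crossRatio (S.branch v i) (S.branch v j) (S.branch v 0) w).im =
      S.height v / (S.pos v j - S.pos v i) := by
  have h0 := (mem_seam_iff (S.radius_mem v hv).1 hw0).1 hw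
  change _ = S.height v at h0
  have h1 : toHalfPlane (S.branch v 0) w + I ≠ 0 :=
    add_I_ne_zero (by rw [h0]; exact (height_pos hv).le)
  rw [← bdry_pos hi, ← bdry_pos hj, ← toDisk_toHalfPlane hw0, coe_bdry, coe_bdry,
    crossRatio_toDisk_infty _ (ofReal_add_I_ne_zero _) (ofReal_add_I_ne_zero _) h1,
    ← ofReal_sub, div_ofReal_im, sub_im, ofReal_im, sub_zero, h0]

theorem exists_mem_seam {v : S.V} (hv : v ∈ S.quilted) :
    ∃ w ∈ S.seam v, w ≠ (S.branch v 0 : ℂ) := by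
  have h0 := height_pos hv
  have h1 : (S.height v : ℂ) * I + I ≠ 0 := add_I_ne_zero (by simpa using h0.le)
  refine ⟨toDisk (S.branch v 0) (S.height v * I), ?_, toDisk_ne _ h1⟩
  refine (mem_seam_iff (S.radius_mem v hv).1 (toDisk_ne _ h1)).2 ?_
  rw [toHalfPlane_toDisk _ h1]
  simp [height]

theorem quiltedRho_of_quilted {v : S.V} (hv : v ∈ S.quilted) {i j : Fin (n + 1)}
    (h : S.Meet v 0 i j) :
    S.quiltedRho i j = ((S.height v / (S.pos v j - S.pos v i) : ℝ) : EReal) := by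
  have h' : ∃ x : ℝ, S.IsQuiltedCrossRatio i j x := by
    obtain ⟨w, hw, hw0⟩ := exists_mem_seam hv
    obtain ⟨h1, h2, h3⟩ := h
    exact ⟨_, v, hv, by simp [*], w, hw, hw0, rfl⟩
  rw [quiltedRho, dif_pos h']
  obtain ⟨v', hv', hd, w, hw, hw0, hx⟩ := h'.choose_spec
  simp only [List.nodup_cons, List.mem_cons, not_or, List.not_mem_nil, not_false_eq_true,
      and_true, List.nodup_nil] at hd
  obtain ⟨⟨h1, h2⟩, h4⟩ := hd
  obtain rfl : v' = v := Meet.unique ⟨h1, h2, h4⟩ h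
  rw [hx, quiltedCrossRatio_seam hv (Ne.symm h1) (Ne.symm h2) hw hw0]

theorem not_isQuiltedCrossRatio {v : S.V} (hv : v ∉ S.quilted) {i j : Fin (n + 1)}
    (h : S.Meet v 0 i j) : ¬ ∃ x : ℝ, S.IsQuiltedCrossRatio i j x := by
  rintro ⟨x, v', hv', hd, -⟩
  simp only [List.nodup_cons, List.mem_cons, not_or, List.not_mem_nil, not_false_eq_true,
      and_true, List.nodup_nil] at hd
  obtain ⟨⟨h1, h2⟩, h4⟩ := hd
  obtain rfl : v' = v := Meet.unique ⟨h1, h2, h4⟩ h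
  exact hv hv'

theorem quiltedRho_of_farther {v w : S.V} (hw : w ∈ S.quilted) (hvw : S.Farther v w)
    {i j : Fin (n + 1)} (h : S.Meet v 0 i j) : S.quiltedRho i j = ⊤ := by
  have hi : i ∈ S.beyond v := Ne.symm h.1
  have hj : j ∈ S.beyond v := Ne.symm h.2.1
  rw [quiltedRho, dif_neg (not_isQuiltedCrossRatio (hvw.notMem_quilted hw) h), if_pos]
  exact ⟨w, hw, hvw.branch_eq hi hj, hvw.subset hi⟩

/-- A quilted component witnessing `QuiltedBelow` would lie nearer the root than `v`, so the
markings beyond `w` would see two quilted components. It cannot lie farther away, since `i` and `j`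
separate at `v`. -/
theorem quiltedRho_of_farther' {v w : S.V} (hw : w ∈ S.quilted) (hvw : S.Farther w v)
    {i j : Fin (n + 1)} (h : S.Meet v 0 i j) : S.quiltedRho i j = 0 := by
  have hv : v ∉ S.quilted := fun hv => hvw.notMem_quilted hv hw
  rw [quiltedRho, dif_neg (not_isQuiltedCrossRatio hv h), if_neg]
  rintro ⟨u, hu, h1, h2⟩
  have hi : i ∈ S.beyond v := Ne.symm h.1
  rcases farther_or_farther (by rintro rfl; exact hv hu) hi h2 with h3 | h3
  · obtain ⟨k, hk⟩ := beyond_nonempty w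
    exact (hvw.trans h3).1 (eq_of_mem_quilted hu hw (h3.subset (hvw.subset hk)) hk)
  · exact h.2.2 (h3.branch_eq h2 (by rw [mem_beyond, ← h1]; exact h2))

/-- Follow any marking beyond `v` to the root and compare `v` with the quilted component met on the
way. -/
theorem quilted_trichotomy (v : S.V) : v ∈ S.quilted ∨ (∃ w ∈ S.quilted, S.Farther v w) ∨
    ∃ w ∈ S.quilted, S.Farther w v := by
  obtain ⟨i, hi⟩ := beyond_nonempty v
  obtain ⟨w, ⟨hw, hiw⟩, -⟩ := existsUnique_quilted (ne_zero_of_mem_beyond hi)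
  by_cases hvw : v = w
  · exact Or.inl (hvw ▸ hw)
  · rcases farther_or_farther hvw hi hiw with h | h
    · exact Or.inr (Or.inl ⟨w, hw, h⟩)
    · exact Or.inr (Or.inr ⟨w, hw, h⟩)

/-! ### Limits of real configurations -/

/-- A family of real configurations converges to a stable quilted disk: suitably rescaled at each
component, the markings converge to the branches, and so does the seam at height one. -/
def IsLimit (S : StableQuiltedDisk n) {α : Type*} (x : α → Fin (n + 1) → ℝ) (F : Filter α) :
    Prop :=
  ∀ v : S.V, ∃ a b : α → ℝ, (∀ᶠ t in F, 0 < a t) ∧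
    (∀ k ∈ S.beyond v, Tendsto (fun t => a t * x t k + b t) F (𝓝 (S.pos v k))) ∧
    (∀ k, k ≠ 0 → k ∉ S.beyond v → Tendsto (fun t => |a t * x t k + b t|) F atTop) ∧
    (v ∈ S.quilted → Tendsto a F (𝓝 (S.height v))) ∧
    (∀ w ∈ S.quilted, S.Farther v w → Tendsto a F atTop) ∧
    (∀ w ∈ S.quilted, S.Farther w v → Tendsto a F (𝓝 0))

variable {α : Type*} {x : α → Fin (n + 1) → ℝ} {F : Filter α}

theorem IsLimit.tendsto_diskPoint (h : S.IsLimit x F) (v : S.V) : ∃ a b : α → ℝ,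
    (∀ᶠ t in F, 0 < a t) ∧ ∀ m, Tendsto (fun t =>
      (diskPoint (S.branch v 0) (fun k => a t * x t k + b t) m : ℂ)) F (𝓝 (S.branch v m)) := by
  obtain ⟨a, b, ha, h1, h2, -⟩ := h v
  refine ⟨a, b, ha, fun m => ?_⟩
  by_cases hm : m = 0
  · subst hm
    simpa only [diskPoint, if_true] using tendsto_const_nhds
  · simp only [diskPoint, hm, if_false]
    by_cases hmv : m ∈ S.beyond v
    · rw [← bdry_pos hmv]
      exact tendsto_bdry _ (h1 m hmv)
    · have e : S.branch v m = S.branch v 0 := by simpa [mem_beyond] using hmv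
      rw [e]
      exact tendsto_bdry_atTop _ (h2 m hm hmv)

/-- Rescale at the component where `i, j, k` meet, so that these three have distinct limits. If `k`
and `l` get the same limit, the inverse cross-ratio tends to zero through negative values. Otherwise
the denominator has a nonzero limit and the cross-ratio converges, to a real number because it is
real throughout. -/
theorem IsLimit.tendsto_rho [F.NeBot] (h : S.IsLimit x F) (hx : ∀ᶠ t in F, Increasing (x t))
    {i j k l : Fin (n + 1)} (hij : i < j) (hjk : j < k) (hkl : k < l) :
    Tendsto (fun t => (realRho (x t) i j k l : EReal)) F (𝓝 (S.rho i j k l)) := by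
  obtain ⟨v, hv⟩ := S.exists_meet hij.ne (hij.trans hjk).ne hjk.ne
  obtain ⟨a, b, ha, hb⟩ := h.tendsto_diskPoint v
  have hij' : (S.branch v i : ℂ) - S.branch v j ≠ 0 :=
    sub_ne_zero.2 fun e => hv.1 (Circle.coe_injective e)
  have hik' : (S.branch v k : ℂ) - S.branch v i ≠ 0 :=
    sub_ne_zero.2 fun e => hv.2.1 (Circle.coe_injective e).symm
  have hjk' : (S.branch v j : ℂ) - S.branch v k ≠ 0 :=
    sub_ne_zero.2 fun e => hv.2.2 (Circle.coe_injective e)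
  have hr : ∀ᶠ t in F, QuiltedDisk.crossRatio
      (diskPoint (S.branch v 0) (fun k => a t * x t k + b t) i)
      (diskPoint (S.branch v 0) (fun k => a t * x t k + b t) j)
      (diskPoint (S.branch v 0) (fun k => a t * x t k + b t) k)
      (diskPoint (S.branch v 0) (fun k => a t * x t k + b t) l) =
        (realRho (x t) i j k l : ℂ) := by
    filter_upwards [ha] with t ht
    rw [crossRatio_diskPoint _ _ hij hjk hkl, realRho_affine _ ht.ne']
  by_cases hkl' : S.branch v k = S.branch v l
  · rw [rho_of_meet_bot hv hkl']
    have h1 : Tendsto (fun t => ((realRho (x t) i j k l)⁻¹ : ℂ)) F (𝓝 0) := by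
      have h2 := (((hb i).sub (hb j)).mul ((hb k).sub (hb l))).div
        (((hb j).sub (hb k)).mul ((hb l).sub (hb i)))
        (mul_ne_zero hjk' (by rw [← hkl']; exact hik'))
      rw [← hkl', sub_self, mul_zero, zero_div] at h2
      refine h2.congr' ?_
      filter_upwards [hr] with t ht
      rw [← ht, QuiltedDisk.crossRatio, inv_div]
      rfl
    have h3 : Tendsto (fun t => (realRho (x t) i j k l)⁻¹) F (𝓝 0) := by
      have := (continuous_re.tendsto 0).comp h1
      simpa only [Function.comp_def, ← ofReal_inv, ofReal_re, zero_re] using this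
    have h4 : Tendsto (fun t => (realRho (x t) i j k l)⁻¹) F (𝓝[<] 0) := by
      refine tendsto_nhdsWithin_iff.2 ⟨h3, ?_⟩
      filter_upwards [hx] with t ht
      exact inv_lt_zero.2 (realRho_neg ht hij hjk hkl)
    have h5 := tendsto_inv_nhdsLT_zero.comp h4
    simp only [Function.comp_def, inv_inv] at h5
    exact EReal.tendsto_coe_nhds_bot_iff.2 h5
  · have hkl'' : (S.branch v k : ℂ) - S.branch v l ≠ 0 :=
      sub_ne_zero.2 fun e => hkl' (Circle.coe_injective e)
    have h1 : Tendsto (fun t => (realRho (x t) i j k l : ℂ)) F (𝓝 (QuiltedDisk.crossRatio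
        (S.branch v i) (S.branch v j) (S.branch v k) (S.branch v l))) := by
      have h2 := (((hb j).sub (hb k)).mul ((hb l).sub (hb i))).div
        (((hb i).sub (hb j)).mul ((hb k).sub (hb l))) (mul_ne_zero hij' hkl'')
      exact h2.congr' hr
    have h2 := (continuous_re.tendsto _).comp h1
    have h3 := (continuous_im.tendsto _).comp h1
    simp only [Function.comp_def, ofReal_re, ofReal_im] at h2 h3
    have h4 := tendsto_nhds_unique h3 tendsto_const_nhds
    have h5 := (continuous_coe_real_ereal.tendsto _).comp h2
    by_cases hil : S.branch v i = S.branch v l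
    · rw [rho_of_meet_zero hv (Or.inl hil)]
      simpa [hil, QuiltedDisk.crossRatio, Function.comp_def] using h5
    · rw [rho_of_meet hv hil (branch_ne_of_meet hij hjk hkl hv) hkl'
        (x := (QuiltedDisk.crossRatio (S.branch v i) (S.branch v j) (S.branch v k)
          (S.branch v l)).re)]
      · exact h5
      · apply Complex.ext
        · simp
        · rw [h4, ofReal_im]

theorem IsLimit.tendsto_quiltedRho (h : S.IsLimit x F) {i j : Fin (n + 1)} (hi : 0 < i)
    (hij : i < j) :
    Tendsto (fun t => ((1 / (x t j - x t i) : ℝ) : EReal)) F (𝓝 (S.quiltedRho i j)) := by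
  obtain ⟨v, hv⟩ := S.exists_meet hi.ne (hi.trans hij).ne hij.ne
  obtain ⟨a, b, ha, h1, -, h2, h3, h4⟩ := h v
  have hiv : i ∈ S.beyond v := Ne.symm hv.1
  have hjv : j ∈ S.beyond v := Ne.symm hv.2.1
  have hlt := sub_pos.2 (pos_lt_pos hiv hjv hij hv.2.2)
  have h5 := ((h1 j hjv).sub (h1 i hiv))
  -- Multiplying by the rescaling factor makes the denominator converge to a positive number; only
  -- the behaviour of `a` remains.
  have h6 : (fun t => a t / (a t * x t j + b t - (a t * x t i + b t))) =ᶠ[F]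
      fun t => 1 / (x t j - x t i) := by
    filter_upwards [ha] with t ht
    rw [show a t * x t j + b t - (a t * x t i + b t) = a t * (x t j - x t i) by ring]
    nth_rewrite 1 [← mul_one (a t)]
    exact mul_div_mul_left _ _ ht.ne'
  rcases quilted_trichotomy v with hq | ⟨w, hw, hq⟩ | ⟨w, hw, hq⟩
  · rw [quiltedRho_of_quilted hq hv]
    exact (continuous_coe_real_ereal.tendsto _).comp
      (((h2 hq).div h5 hlt.ne').congr' h6)
  · rw [quiltedRho_of_farther hw hq hv, EReal.tendsto_coe_nhds_top_iff]
    refine Tendsto.congr' h6 ?_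
    simp only [div_eq_mul_inv]
    exact (h3 w hw hq).atTop_mul_pos (inv_pos.2 hlt) (h5.inv₀ hlt.ne')
  · rw [quiltedRho_of_farther' hw hq hv]
    have h7 := ((h4 w hw hq).div h5 hlt.ne').congr' h6
    rw [zero_div] at h7
    exact (continuous_coe_real_ereal.tendsto _).comp h7

/-- Used in both directions: it shows that values on the moduli space are limits of real ones, and
it identifies ultrafilter limits of real values as values on the moduli space. -/
theorem IsLimit.tendsto_rhoMap [F.NeBot] (h : S.IsLimit x F)
    (hx : ∀ᶠ t in F, Increasing (x t)) :
    Tendsto (fun t => realRhoMap n (x t)) F (𝓝 (rhoMap n (Quotient.mk _ S))) := by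
  refine Tendsto.prodMk_nhds ?_ ?_
  · exact tendsto_pi_nhds.2 fun q => h.tendsto_rho hx q.2.1 q.2.2.1 q.2.2.2
  · exact tendsto_pi_nhds.2 fun p => h.tendsto_quiltedRho p.2.1 p.2.2

end StableQuiltedDisk

end QuiltedDisk

end


noncomputable section

namespace QuiltedDisk

namespace StableQuiltedDisk

open Filter Topology NodalDisk

variable {n : ℕ} (S : StableQuiltedDisk n)

/-! ### Every stable quilted disk is a limit of real configurations -/

open Classical in
/-- An integer for each component which increases towards the root and vanishes at the quilted
components. -/
def level (v : S.V) : ℤ :=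
  if v ∈ S.quilted then 0
  else if ∃ w ∈ S.quilted, S.Farther v w then -(1 + {u | S.Farther v u}.ncard)
  else 1 + {u | S.Farther u v}.ncard

variable {S}

theorem level_of_quilted {v : S.V} (h : v ∈ S.quilted) : S.level v = 0 := if_pos h

/-- On either side of the quilted layer the level counts the components in a set that is strictly
monotone along `Farther`; the sign separates the two sides. -/
theorem Farther.level_lt {u v : S.V} (h : S.Farther u v) : S.level u < S.level v := by
  have := S.finite
  by_cases hv : v ∈ S.quilted
  · rw [level_of_quilted hv, level, if_neg (h.notMem_quilted hv), if_pos ⟨v, hv, h⟩]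
    omega
  by_cases hv' : ∃ w ∈ S.quilted, S.Farther v w
  · obtain ⟨w, hw, hvw⟩ := hv'
    have huw := h.trans hvw
    rw [level, if_neg (huw.notMem_quilted hw), if_pos ⟨w, hw, huw⟩, level, if_neg hv,
      if_pos ⟨w, hw, hvw⟩]
    have : {x | S.Farther v x}.ncard < {x | S.Farther u x}.ncard :=
      ncard_lt_ncard ⟨fun x hx => h.trans hx, fun hs => (hs h).1 rfl⟩
    omega
  · rw [level.eq_def S v, if_neg hv, if_neg hv', level]
    split_ifs with h1 h2
    · omega
    · omega
    · have : {x | S.Farther x u}.ncard < {x | S.Farther x v}.ncard :=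
        ncard_lt_ncard ⟨fun x hx => Farther.trans hx h, fun hs => (hs h).1 rfl⟩
      omega

variable (S)

open Classical in
/-- The scaling factor of a component. -/
def scale (v : S.V) (t : ℝ) : ℝ :=
  -- The level of a quilted component is zero, so its scale is constantly its seam height.
  -- Components farther from the root get larger powers of `t`.
  (if v ∈ S.quilted then S.height v else 1) * t ^ (-S.level v)

open Classical in
/-- The component at which the branches towards the markings `0`, `m` and `m + 1` meet. -/
def meetVertex (m : ℕ) : S.V :=
  -- For `m = 0` no such component exists. The default only shifts all nonzero markings by a common
  -- amount, which is harmless.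
  if h : ∃ (v : S.V) (i j : Fin (n + 1)), i.val = m ∧ j.val = m + 1 ∧ S.Meet v 0 i j
  then h.choose else S.comp 0

/-- The distance of the markings `m` and `m + 1` in the smoothing with parameter `t`. -/
def gap (t : ℝ) (m : ℕ) : ℝ :=
  if h : m + 1 < n + 1 then
    (S.pos (S.meetVertex m) ⟨m + 1, h⟩ - S.pos (S.meetVertex m) ⟨m, by omega⟩) /
      S.scale (S.meetVertex m) t
  else 0

/-- The smoothing of a stable quilted disk with parameter `t`. -/
def smoothing (t : ℝ) (k : Fin (n + 1)) : ℝ := ∑ m ∈ Finset.range k, S.gap t m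

variable {S}

theorem scale_pos (v : S.V) {t : ℝ} (ht : 0 < t) : 0 < S.scale v t := by
  rw [scale]
  apply mul_pos _ (zpow_pos ht _)
  split_ifs with h
  · exact height_pos h
  · exact one_pos

theorem tendsto_scale_atTop {v : S.V} (h : S.level v < 0) :
    Tendsto (S.scale v) atTop atTop := by
  have h1 := scale_pos v one_pos
  rw [scale, one_zpow, mul_one] at h1
  exact (tendsto_zpow_atTop_atTop (by omega)).const_mul_atTop h1

theorem tendsto_scale_div {u v : S.V} (h : S.level u < S.level v) :
    Tendsto (fun t => S.scale v t / S.scale u t) atTop (𝓝 0) := by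
  have h1 : Tendsto (fun t : ℝ => t ^ (S.level u - S.level v)) atTop (𝓝 0) :=
    tendsto_zpow_atTop_zero (by omega)
  have h2 := h1.const_mul (S.scale v 1 / S.scale u 1)
  rw [mul_zero] at h2
  refine h2.congr' ?_
  filter_upwards [eventually_gt_atTop 0] with t ht
  simp only [scale, one_zpow, mul_one]
  rw [show S.level u - S.level v = -S.level v - -S.level u by ring, zpow_sub₀ ht.ne',
    mul_div_mul_comm]

theorem tendsto_div_scale {u v : S.V} (h : S.level u < S.level v) :
    Tendsto (fun t => S.scale u t / S.scale v t) atTop atTop := by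
  have h1 : Tendsto (fun t => S.scale v t / S.scale u t) atTop (𝓝[>] 0) := by
    refine tendsto_nhdsWithin_iff.2 ⟨tendsto_scale_div h, ?_⟩
    filter_upwards [eventually_gt_atTop 0] with t ht
    exact div_pos (scale_pos v ht) (scale_pos u ht)
  simpa only [Function.comp_def, inv_div] using tendsto_inv_nhdsGT_zero.comp h1

theorem meet_meetVertex {i j : Fin (n + 1)} (hi : 0 < i) (hj : j.val = i.val + 1) :
    S.Meet (S.meetVertex i) 0 i j := by
  have hij : i < j := by rw [Fin.lt_def]; omega
  have h : ∃ (v : S.V) (i' j' : Fin (n + 1)), i'.val = i.val ∧ j'.val = i.val + 1 ∧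
      S.Meet v 0 i' j' := by
    obtain ⟨v, hv⟩ := S.exists_meet hi.ne (hi.trans hij).ne hij.ne
    exact ⟨v, i, j, rfl, hj, hv⟩
  rw [meetVertex, dif_pos h]
  obtain ⟨i', j', h1, h2, h3⟩ := h.choose_spec
  obtain rfl : i' = i := Fin.ext h1
  obtain rfl : j' = j := Fin.ext (h2.trans hj.symm)
  exact h3

theorem smoothing_succ {i j : Fin (n + 1)} (hj : j.val = i.val + 1) (t : ℝ) :
    S.smoothing t j = S.smoothing t i +
      (S.pos (S.meetVertex i) j - S.pos (S.meetVertex i) i) / S.scale (S.meetVertex i) t := by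
  have h : i.val + 1 < n + 1 := by omega
  rw [smoothing, hj, Finset.sum_range_succ, smoothing, gap, dif_pos h,
    show (⟨i.val + 1, h⟩ : Fin (n + 1)) = j from Fin.ext hj.symm]

theorem succ_induction {P : Fin (n + 1) → Prop} {i : Fin (n + 1)} (h0 : P i)
    (hs : ∀ k l : Fin (n + 1), i ≤ k → l.val = k.val + 1 → P k → P l) {j : Fin (n + 1)}
    (hij : i ≤ j) : P j := by
  have : ∀ m (hm : i.val ≤ m) (h : m < n + 1), P ⟨m, h⟩ := by
    intro m hm
    induction m, hm using Nat.le_induction with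
    | base => exact fun _ => h0
    | succ m hm ih => exact fun h => hs ⟨m, by omega⟩ ⟨m + 1, h⟩ hm rfl (ih (by omega))
  exact this j.val hij j.2

theorem increasing_smoothing {t : ℝ} (ht : 0 < t) : Increasing (S.smoothing t) := by
  intro i j hi hij
  have key : ∀ k l : Fin (n + 1), i ≤ k → l.val = k.val + 1 →
      S.smoothing t k < S.smoothing t l := by
    intro k l hik hl
    have hm := S.meet_meetVertex (hi.trans_le hik) hl
    rw [smoothing_succ hl, lt_add_iff_pos_right]
    exact div_pos (sub_pos.2 (pos_lt_pos (Ne.symm hm.1) (Ne.symm hm.2.1)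
      (by rw [Fin.lt_def]; omega) hm.2.2)) (scale_pos _ ht)
  refine succ_induction (P := fun j => i = j ∨ S.smoothing t i < S.smoothing t j) (Or.inl rfl) ?_
    hij.le |>.resolve_left hij.ne
  rintro k l hik hl (rfl | h)
  · exact Or.inr (key _ _ hik hl)
  · exact Or.inr (h.trans (key _ _ hik hl))

/-- The difference telescopes into gaps between consecutive markings, all beyond `v` by convexity. A
gap whose markings meet at `v` contributes exactly its coordinate difference. One whose markings
meet farther out has coordinate difference zero at `v` and tends to zero at the scale of `v`. -/
theorem tendsto_scale_mul_smoothing_sub {v : S.V} {i j : Fin (n + 1)} (hi : i ∈ S.beyond v)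
    (hj : j ∈ S.beyond v) (hij : i ≤ j) :
    Tendsto (fun t => S.scale v t * (S.smoothing t j - S.smoothing t i)) atTop
      (𝓝 (S.pos v j - S.pos v i)) := by
  revert hj
  refine succ_induction (P := fun j => j ∈ S.beyond v → Tendsto
    (fun t => S.scale v t * (S.smoothing t j - S.smoothing t i)) atTop
      (𝓝 (S.pos v j - S.pos v i))) ?_ ?_ hij
  · intro _
    simp
  · intro k l hik hl ih hlv
    have hkl : k < l := by rw [Fin.lt_def]; omega
    have hk : k ∈ S.beyond v := by
      rcases hik.eq_or_lt with rfl | hik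
      · exact hi
      · exact ordConnected_beyond hi hlv hik hkl
    have hk0 : 0 < k := Fin.pos_of_ne_zero (ne_zero_of_mem_beyond hk)
    have hm := S.meet_meetVertex hk0 hl
    obtain ⟨u, hu⟩ : ∃ u, u = S.meetVertex k := ⟨_, rfl⟩
    rw [← hu] at hm
    have hku : k ∈ S.beyond u := Ne.symm hm.1
    have hlu : l ∈ S.beyond u := Ne.symm hm.2.1
    have key : Tendsto (fun t => S.scale v t * ((S.pos u l - S.pos u k) / S.scale u t)) atTop
        (𝓝 (S.pos v l - S.pos v k)) := by
      by_cases huv : u = v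
      · subst huv
        refine tendsto_const_nhds.congr' ?_
        filter_upwards [eventually_gt_atTop 0] with t ht
        rw [mul_div_cancel₀ _ (scale_pos u ht).ne']
      · have hf : S.Farther u v := by
          refine (farther_or_farther huv hku hk).resolve_right fun h => ?_
          exact hm.2.2 (h.branch_eq hk hlv)
        rw [(pos_eq_pos_iff hlv hk).2 (hf.branch_eq hlu hku), sub_self]
        have := (tendsto_scale_div hf.level_lt).mul_const (S.pos u l - S.pos u k)
        rw [zero_mul] at this
        refine this.congr fun t => ?_
        ring
    have := (ih hk).add key
    rw [show S.pos v k - S.pos v i + (S.pos v l - S.pos v k) = S.pos v l - S.pos v i by ring]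
      at this
    refine this.congr fun t => ?_
    rw [smoothing_succ hl, ← hu]
    ring

theorem tendsto_scale_mul_smoothing_sub' {v : S.V} {i j : Fin (n + 1)} (hi : i ∈ S.beyond v)
    (hj : j ∈ S.beyond v) :
    Tendsto (fun t => S.scale v t * (S.smoothing t j - S.smoothing t i)) atTop
      (𝓝 (S.pos v j - S.pos v i)) := by
  rcases le_total i j with h | h
  · exact tendsto_scale_mul_smoothing_sub hi hj h
  · have := (tendsto_scale_mul_smoothing_sub hj hi h).neg
    rw [neg_sub] at this
    refine this.congr fun t => ?_
    ring

theorem isLimit_smoothing (S : StableQuiltedDisk n) : S.IsLimit S.smoothing atTop := by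
  intro v
  obtain ⟨i, hi⟩ := beyond_nonempty v
  refine ⟨S.scale v, fun t => S.pos v i - S.scale v t * S.smoothing t i, ?_, ?_, ?_, ?_, ?_, ?_⟩
  · filter_upwards [eventually_gt_atTop 0] with t ht
    exact scale_pos v ht
  · intro k hk
    have := (tendsto_scale_mul_smoothing_sub' hi hk).add_const (S.pos v i)
    rw [sub_add_cancel] at this
    refine this.congr fun t => ?_
    ring
  · intro k hk0 hk
    have hik : i ≠ k := by rintro rfl; exact hk hi
    -- A marking `k` not beyond `v` separates from `i` at a component `u` nearer the root. Their
    -- distance has the order of `1 / scale u`, which becomes infinite at the larger scale of `v`.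
    obtain ⟨u, hu⟩ := S.exists_meet (ne_zero_of_mem_beyond hi).symm hk0.symm hik
    have hiu : i ∈ S.beyond u := Ne.symm hu.1
    have hku : k ∈ S.beyond u := Ne.symm hu.2.1
    have hf : S.Farther v u := by
      refine (farther_or_farther (by rintro rfl; exact hk hku) hi hiu).resolve_right fun h => ?_
      exact hk (h.subset hku)
    have h1 := (tendsto_div_scale hf.level_lt).atTop_mul_pos (abs_pos.2 (sub_ne_zero.2
      fun e => hu.2.2 ((pos_eq_pos_iff hku hiu).1 e).symm))
      (tendsto_scale_mul_smoothing_sub' hiu hku).abs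
    have h2 := tendsto_atTop_add_const_right _ (-|S.pos v i|) h1
    refine tendsto_atTop_mono' _ ?_ h2
    filter_upwards [eventually_gt_atTop 0] with t ht
    have e : S.scale v t / S.scale u t * |S.scale u t * (S.smoothing t k - S.smoothing t i)| =
        |S.scale v t * (S.smoothing t k - S.smoothing t i)| := by
      rw [abs_mul, abs_mul, abs_of_pos (scale_pos u ht), abs_of_pos (scale_pos v ht)]
      have := (scale_pos u ht).ne'
      field_simp
    have e2 : S.scale v t * S.smoothing t k + (S.pos v i - S.scale v t * S.smoothing t i) =
        S.scale v t * (S.smoothing t k - S.smoothing t i) - (-S.pos v i) := by ring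
    rw [e, e2]
    have := abs_sub_abs_le_abs_sub (S.scale v t * (S.smoothing t k - S.smoothing t i))
      (-S.pos v i)
    rw [abs_neg] at this
    linarith
  · intro hv
    refine tendsto_const_nhds.congr fun t => ?_
    rw [scale, if_pos hv, level_of_quilted hv, neg_zero, zpow_zero, mul_one]
  · intro w hw hf
    refine tendsto_scale_atTop ?_
    have := hf.level_lt
    rwa [level_of_quilted hw] at this
  · intro w hw hf
    -- The scale of the quilted `w` is constant, so the limit of the quotient gives the limit of
    -- `scale v`.
    have h1 := (tendsto_scale_div hf.level_lt).mul_const (S.height w)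
    rw [zero_mul] at h1
    refine h1.congr fun t => ?_
    rw [scale.eq_def S w, if_pos hw, level_of_quilted hw, neg_zero, zpow_zero, mul_one,
      div_mul_cancel₀ _ (height_pos hw).ne']

end StableQuiltedDisk

/-- The values of the cross-ratios on real configurations are dense in their values on the moduli
space. -/
theorem range_rhoMap_subset (n : ℕ) :
    range (rhoMap n) ⊆ closure (realRhoMap n '' {x | Increasing x}) := by
  rintro _ ⟨x, rfl⟩
  induction x using Quotient.inductionOn with
  | _ S =>
  have h : ∀ᶠ t : ℝ in Filter.atTop, Increasing (S.smoothing t) := by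
    filter_upwards [Filter.eventually_gt_atTop 0] with t ht
    exact StableQuiltedDisk.increasing_smoothing ht
  refine mem_closure_of_tendsto (S.isLimit_smoothing.tendsto_rhoMap h) ?_
  filter_upwards [h] with t ht
  exact mem_image_of_mem _ ht

end QuiltedDisk

end


noncomputable section

namespace QuiltedDisk

namespace StableQuiltedDisk

open NodalDisk

variable {n : ℕ} {S : StableQuiltedDisk n}

/-! ### Reconstruction from the cross-ratios -/

theorem rho_zero_of_meet {v : S.V} {i j k : Fin (n + 1)} (h : S.Meet v 0 i j)
    (h0 : S.branch v 0 ≠ S.branch v k) (hi : S.branch v i ≠ S.branch v k)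
    (hj : S.branch v j ≠ S.branch v k) :
    S.rho 0 i j k = ((-(S.pos v j - S.pos v i) / (S.pos v k - S.pos v j) : ℝ) : EReal) := by
  refine rho_of_meet h h0 hi hj ?_
  rw [← bdry_pos (Ne.symm h.1), ← bdry_pos (Ne.symm h.2.1), ← bdry_pos (Ne.symm h0), coe_bdry,
    coe_bdry, coe_bdry, crossRatio_infty_toDisk _ (ofReal_add_I_ne_zero _)
      (ofReal_add_I_ne_zero _) (ofReal_add_I_ne_zero _)]
  push_cast
  rfl

theorem rho_zero_eq_bot_iff {v : S.V} {i j k : Fin (n + 1)} (hi : 0 < i) (hij : i < j)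
    (hjk : j < k) (h : S.Meet v 0 i j) : S.rho 0 i j k = ⊥ ↔ S.branch v j = S.branch v k := by
  refine ⟨fun e => ?_, rho_of_meet_bot h⟩
  by_contra hjk'
  by_cases h0 : S.branch v 0 = S.branch v k
  · rw [rho_of_meet_zero h (Or.inl h0)] at e
    exact EReal.zero_ne_bot e
  · rw [rho_zero_of_meet h h0 (branch_ne_of_meet hi hij hjk h) hjk'] at e
    exact EReal.coe_ne_bot _ e

theorem rho_zero_eq_zero_iff {v : S.V} {i j k : Fin (n + 1)} (hi : 0 < i) (hij : i < j)
    (hjk : j < k) (h : S.Meet v 0 i j) : S.rho 0 i j k = 0 ↔ S.branch v k = S.branch v 0 := by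
  refine ⟨fun e => ?_, fun e => rho_of_meet_zero h (Or.inl e.symm)⟩
  by_contra h0
  have hiv : i ∈ S.beyond v := Ne.symm h.1
  have hjv : j ∈ S.beyond v := Ne.symm h.2.1
  by_cases hjk' : S.branch v j = S.branch v k
  · rw [rho_of_meet_bot h hjk'] at e
    exact EReal.zero_ne_bot e.symm
  · rw [rho_zero_of_meet h (Ne.symm h0) (branch_ne_of_meet hi hij hjk h) hjk',
      EReal.coe_eq_zero] at e
    have h1 := pos_lt_pos hiv hjv hij h.2.2
    have h2 := pos_lt_pos hjv h0 hjk hjk'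
    have := div_neg_of_neg_of_pos (neg_neg_of_pos (sub_pos.2 h1)) (sub_pos.2 h2)
    linarith

theorem mem_beyond_iff_of_gt {v : S.V} {i j k : Fin (n + 1)} (hi : 0 < i) (hij : i < j)
    (hjk : j < k) (h : S.Meet v 0 i j) : k ∈ S.beyond v ↔ S.rho 0 i j k ≠ 0 := by
  rw [Ne, rho_zero_eq_zero_iff hi hij hjk h]; rfl

/-- The cross-ratio is read off where `0, k, i` meet: there `i` and `j` share a branch exactly when
`v` sees `k` in the direction of the root. -/
theorem mem_beyond_iff_of_lt {v : S.V} {i j k : Fin (n + 1)} (hk : 0 < k) (hki : k < i)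
    (hij : i < j) (h : S.Meet v 0 i j) : k ∈ S.beyond v ↔ S.rho 0 k i j ≠ ⊥ := by
  obtain ⟨u, hu⟩ := S.exists_meet hk.ne (hk.trans hki).ne hki.ne
  rw [Ne, rho_zero_eq_bot_iff hk hki hij hu, mem_beyond, not_iff_not]
  by_cases huv : u = v
  · subst huv
    exact ⟨fun e => absurd e.symm hu.1, fun e => absurd e h.2.2⟩
  · have hb := branch_eq_dir_or huv
    have e1 := hb 0
    have e2 := hb i
    have e3 := hb j
    have e4 := hb k
    obtain ⟨h1, h2, h3⟩ := h
    obtain ⟨h4, h5, h6⟩ := hu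
    constructor <;> intro e <;> grind

/-- The relative position of the middle one of three points with given cross-ratio. -/
def middlePos (e : EReal) : ℝ := open Classical in
  -- Solving `ρ = -(y - x) / (z - y)` for `(y - x) / (z - x)` gives `-ρ / (1 - ρ)`. The value `⊥`
  -- means `y = z`; it is treated apart because `toReal ⊥` is zero.
  if e = ⊥ then 1 else -e.toReal / (1 - e.toReal)

/-- The cross-ratios with `z₀` determine all intermediate coordinates once the outer two are fixed;
the remaining freedom is an affine map. -/
theorem pos_sub_pos_eq {v : S.V} {i j k : Fin (n + 1)} (hi : 0 < i) (hik : i < k)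
    (hkj : k < j) (h : S.Meet v 0 i j) :
    S.pos v k - S.pos v i = (S.pos v j - S.pos v i) * middlePos (S.rho 0 i k j) := by
  have hiv : i ∈ S.beyond v := Ne.symm h.1
  have hjv : j ∈ S.beyond v := Ne.symm h.2.1
  have hkv : k ∈ S.beyond v := ordConnected_beyond hiv hjv hik hkj
  by_cases hik' : S.branch v i = S.branch v k
  · obtain ⟨u, hu⟩ := S.exists_meet hi.ne (hi.trans hik).ne hik.ne
    have huv : u ≠ v := by rintro rfl; exact hu.2.2 hik'
    have hr : S.rho 0 i k j = 0 := by
      rw [rho_zero_eq_zero_iff hi hik hkj hu]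
      have hb := branch_eq_dir_or huv
      have e1 := hb 0
      have e2 := hb i
      have e3 := hb j
      have e4 := hb k
      obtain ⟨h1, h2, h3⟩ := h
      obtain ⟨h4, h5, h6⟩ := hu
      grind
    rw [hr, (pos_eq_pos_iff hkv hiv).2 hik'.symm, middlePos, if_neg EReal.zero_ne_bot]
    simp
  · have hm : S.Meet v 0 i k := ⟨h.1, Ne.symm hkv, hik'⟩
    by_cases hkj' : S.branch v k = S.branch v j
    · rw [rho_of_meet_bot hm hkj', middlePos, if_pos rfl, (pos_eq_pos_iff hkv hjv).2 hkj', mul_one]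
    · rw [rho_zero_of_meet hm h.2.1 h.2.2 hkj', middlePos, if_neg (EReal.coe_ne_bot _),
        EReal.toReal_coe]
      have h1 := sub_pos.2 (pos_lt_pos hkv hjv hkj hkj')
      have h2 := sub_pos.2 (pos_lt_pos hiv hjv (hik.trans hkj) h.2.2)
      have h3 : 1 - -(S.pos v k - S.pos v i) / (S.pos v j - S.pos v k) =
          (S.pos v j - S.pos v i) / (S.pos v j - S.pos v k) := by
        field_simp; ring
      rw [h3]
      field_simp

/-- The component where `0, i, j` meet is comparable with `v`. The value is zero exactly when it
lies nearer the root, that is, when `v` fails to have both markings beyond it. -/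
theorem quiltedRho_ne_zero_iff {v : S.V} (hv : v ∈ S.quilted) {i j : Fin (n + 1)} (hi : 0 < i)
    (hij : i < j) (h : i ∈ S.beyond v ∨ j ∈ S.beyond v) :
    S.quiltedRho i j ≠ 0 ↔ i ∈ S.beyond v ∧ j ∈ S.beyond v := by
  obtain ⟨u, hu⟩ := S.exists_meet hi.ne (hi.trans hij).ne hij.ne
  have hiu : i ∈ S.beyond u := Ne.symm hu.1
  have hju : j ∈ S.beyond u := Ne.symm hu.2.1
  by_cases huv : u = v
  · subst huv
    rw [quiltedRho_of_quilted hv hu]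
    refine iff_of_true ?_ ⟨hiu, hju⟩
    rw [Ne, EReal.coe_eq_zero]
    exact (div_pos (height_pos hv) (sub_pos.2 (pos_lt_pos hiu hju hij hu.2.2))).ne'
  · have h' : S.Farther u v ∨ S.Farther v u := by
      rcases h with h | h
      · exact farther_or_farther huv hiu h
      · exact farther_or_farther huv hju h
    rcases h' with h' | h'
    · rw [quiltedRho_of_farther hv h' hu]
      exact iff_of_true EReal.top_ne_zero ⟨h'.subset hiu, h'.subset hju⟩
    · rw [quiltedRho_of_farther' hv h' hu]
      exact iff_of_false (fun e => e rfl) fun e => hu.2.2 (h'.branch_eq e.1 e.2)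

theorem pos_sub_pos_of_quilted {v : S.V} (hv : v ∈ S.quilted) {i j : Fin (n + 1)}
    (hi : i ∈ S.beyond v) (hj : j ∈ S.beyond v) (hij : i < j) :
    S.pos v j - S.pos v i = S.height v / (S.quiltedRho i j).toReal := by
  have hi0 := Fin.pos_of_ne_zero (ne_zero_of_mem_beyond hi)
  by_cases hb : S.branch v i = S.branch v j
  · obtain ⟨u, hu⟩ := S.exists_meet hi0.ne (hi0.trans hij).ne hij.ne
    have hf : S.Farther u v := by
      refine (farther_or_farther (by rintro rfl; exact hu.2.2 hb) (Ne.symm hu.1) hi).resolve_right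
        fun h => ?_
      exact hu.2.2 (h.branch_eq hi hj)
    -- The conventions `toReal ⊤ = 0` and division by zero give the correct difference zero.
    rw [quiltedRho_of_farther hv hf hu, (pos_eq_pos_iff hi hj).2 hb]
    simp
  · rw [quiltedRho_of_quilted hv ⟨Ne.symm hi, Ne.symm hj, hb⟩, EReal.toReal_coe]
    have h1 := sub_pos.2 (pos_lt_pos hi hj hij hb)
    have h2 := height_pos hv
    field_simp

theorem mem_quilted_iff {v : S.V} {i j : Fin (n + 1)} (hij : i < j)
    (h : S.Meet v 0 i j) : v ∈ S.quilted ↔ S.quiltedRho i j ≠ 0 ∧ S.quiltedRho i j ≠ ⊤ := by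
  have hi : i ∈ S.beyond v := Ne.symm h.1
  have hj : j ∈ S.beyond v := Ne.symm h.2.1
  rcases quilted_trichotomy v with hv | ⟨w, hw, hv⟩ | ⟨w, hw, hv⟩
  · refine iff_of_true hv ?_
    rw [quiltedRho_of_quilted hv h]
    refine ⟨?_, EReal.coe_ne_top _⟩
    rw [Ne, EReal.coe_eq_zero]
    exact (div_pos (height_pos hv) (sub_pos.2 (pos_lt_pos hi hj hij h.2.2))).ne'
  · refine iff_of_false (hv.notMem_quilted hw) ?_
    rw [quiltedRho_of_farther hw hv h]
    exact fun e => e.2 rfl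
  · refine iff_of_false (fun hq => hv.notMem_quilted hq hw) ?_
    rw [quiltedRho_of_farther' hw hv h]
    exact fun e => e.1 rfl

/-- An unquilted component is determined by the first and the last marking beyond it. -/
theorem exists_isLeast_isGreatest {v : S.V} (hv : v ∉ S.quilted) : ∃ i j, i < j ∧
    S.Meet v 0 i j ∧ (∀ k ∈ S.beyond v, i ≤ k ∧ k ≤ j) := by
  obtain ⟨i, hi, hi'⟩ := exists_min_image (S.beyond v) id (toFinite _) (beyond_nonempty v)
  obtain ⟨j, hj, hj'⟩ := exists_max_image (S.beyond v) id (toFinite _) (beyond_nonempty v)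
  obtain ⟨k, l, hkl, h1, h2, h3⟩ := exists_meet_of_unquilted hv
  have hk : k ∈ S.beyond v := Ne.symm h1
  have hl : l ∈ S.beyond v := Ne.symm h2
  have e1 := pos_le_pos hi hk (hi' k hk)
  have e2 := pos_le_pos hl hj (hj' l hl)
  have e3 := pos_lt_pos hk hl hkl h3
  have hb : S.branch v i ≠ S.branch v j := fun e => by
    rw [← pos_eq_pos_iff hi hj] at e
    linarith
  refine ⟨i, j, ((hi' k hk).trans_lt hkl).trans_le (hj' l hl), ⟨Ne.symm hi, Ne.symm hj, hb⟩,
    fun m hm => ⟨hi' m hm, hj' m hm⟩⟩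

section Uniqueness

/-- Two stable quilted disks have the same cross-ratios and quilted cross-ratios. -/
def SameRho (S S' : StableQuiltedDisk n) : Prop :=
  (∀ i j k l, i < j → j < k → k < l → S.rho i j k l = S'.rho i j k l) ∧
    ∀ i j, 0 < i → i < j → S.quiltedRho i j = S'.quiltedRho i j

/-- Components of two stable quilted disks correspond to each other: they have the same markings
beyond them, and are both quilted or both unquilted. -/
def Matches {S S' : StableQuiltedDisk n} (v : S.V) (v' : S'.V) : Prop :=
  S.beyond v = S'.beyond v' ∧ (v ∈ S.quilted ↔ v' ∈ S'.quilted)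

variable {S' : StableQuiltedDisk n}

theorem SameRho.symm (h : SameRho S S') : SameRho S' S :=
  ⟨fun i j k l h1 h2 h3 => (h.1 i j k l h1 h2 h3).symm, fun i j h1 h2 => (h.2 i j h1 h2).symm⟩

/-- A quilted component is found from any marking beyond it, and its set of markings from the
nonvanishing quilted cross-ratios. An unquilted one is found where its first and last markings meet
`0`: convexity handles the markings between them, cross-ratios those outside. -/
theorem SameRho.exists_matches (h : SameRho S S') (v : S.V) : ∃ v' : S'.V, Matches v v' := by
  by_cases hv : v ∈ S.quilted
  · obtain ⟨i, hi⟩ := beyond_nonempty v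
    have hi0 := ne_zero_of_mem_beyond hi
    obtain ⟨v', ⟨hv', hi'⟩, -⟩ := S'.existsUnique_quilted hi0
    refine ⟨v', ?_, iff_of_true hv hv'⟩
    ext k
    by_cases hk0 : k = 0
    · subst hk0
      exact iff_of_false (zero_notMem_beyond v) (zero_notMem_beyond v')
    rcases lt_trichotomy i k with hik | rfl | hik
    · have hi0 := Fin.pos_of_ne_zero hi0
      have h1 := quiltedRho_ne_zero_iff hv hi0 hik (Or.inl hi)
      have h2 := quiltedRho_ne_zero_iff hv' hi0 hik (Or.inl hi')
      rw [h.2 i k hi0 hik] at h1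
      tauto
    · exact iff_of_true hi hi'
    · have hk0 := Fin.pos_of_ne_zero hk0
      have h1 := quiltedRho_ne_zero_iff hv hk0 hik (Or.inr hi)
      have h2 := quiltedRho_ne_zero_iff hv' hk0 hik (Or.inr hi')
      rw [h.2 k i hk0 hik] at h1
      tauto
  · obtain ⟨i, j, hij, hm, hij'⟩ := exists_isLeast_isGreatest hv
    have hiv : i ∈ S.beyond v := Ne.symm hm.1
    have hjv : j ∈ S.beyond v := Ne.symm hm.2.1
    have hi0 := Fin.pos_of_ne_zero (ne_zero_of_mem_beyond hiv)
    obtain ⟨v', hm'⟩ := S'.exists_meet hi0.ne (hi0.trans hij).ne hij.ne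
    have hiv' : i ∈ S'.beyond v' := Ne.symm hm'.1
    have hjv' : j ∈ S'.beyond v' := Ne.symm hm'.2.1
    refine ⟨v', ?_, ?_⟩
    · ext k
      by_cases hk0 : k = 0
      · subst hk0
        exact iff_of_false (zero_notMem_beyond v) (zero_notMem_beyond v')
      have hk0 := Fin.pos_of_ne_zero hk0
      rcases lt_trichotomy k i with hki | rfl | hki
      · rw [mem_beyond_iff_of_lt hk0 hki hij hm, mem_beyond_iff_of_lt hk0 hki hij hm',
          h.1 _ _ _ _ hk0 hki hij]
      · exact iff_of_true hiv hiv'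
      · rcases lt_trichotomy k j with hkj | rfl | hkj
        · exact iff_of_true (ordConnected_beyond hiv hjv hki hkj)
            (ordConnected_beyond hiv' hjv' hki hkj)
        · exact iff_of_true hjv hjv'
        · rw [mem_beyond_iff_of_gt hi0 hij hkj hm, mem_beyond_iff_of_gt hi0 hij hkj hm',
            h.1 _ _ _ _ hi0 hij hkj]
    · rw [mem_quilted_iff hij hm, mem_quilted_iff hij hm', h.2 _ _ hi0 hij]

/-- At a quilted component the quilted cross-ratios give all coordinate differences in units of the
seam height, so the ratio of heights is the factor. At an unquilted one, match the first and last
markings; the others follow by `pos_sub_pos_eq`. -/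
theorem SameRho.exists_affine (h : SameRho S S') {v : S.V} {v' : S'.V} (hm : Matches v v') :
    ∃ a b : ℝ, 0 < a ∧ (∀ k ∈ S.beyond v, S'.pos v' k = a * S.pos v k + b) ∧
      (v ∈ S.quilted → S'.height v' = a * S.height v) := by
  by_cases hv : v ∈ S.quilted
  · have hv' := hm.2.1 hv
    obtain ⟨i, hi⟩ := beyond_nonempty v
    have hp := height_pos hv
    have hp' := height_pos hv'
    have key : ∀ k l, k ∈ S.beyond v → l ∈ S.beyond v → k < l → S'.pos v' l - S'.pos v' k =
        S'.height v' / S.height v * (S.pos v l - S.pos v k) := by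
      intro k l hk hl hkl
      rw [pos_sub_pos_of_quilted hv hk hl hkl,
        pos_sub_pos_of_quilted hv' (hm.1 ▸ hk) (hm.1 ▸ hl) hkl,
        h.2 _ _ (Fin.pos_of_ne_zero (ne_zero_of_mem_beyond hk)) hkl]
      field_simp
    refine ⟨S'.height v' / S.height v, S'.pos v' i - S'.height v' / S.height v * S.pos v i,
      div_pos hp' hp, fun k hk => ?_, fun _ => by field_simp⟩
    rcases lt_trichotomy i k with hik | rfl | hik
    · linear_combination key i k hi hk hik
    · ring
    · linear_combination -key k i hk hi hik
  · obtain ⟨i, j, hij, hmv, hij'⟩ := exists_isLeast_isGreatest hv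
    obtain ⟨i', j', hij2, hmv', hij2'⟩ := exists_isLeast_isGreatest (mt hm.2.2 hv)
    have hi : i ∈ S.beyond v := Ne.symm hmv.1
    have hj : j ∈ S.beyond v := Ne.symm hmv.2.1
    have hi' : i' ∈ S'.beyond v' := Ne.symm hmv'.1
    have hj' : j' ∈ S'.beyond v' := Ne.symm hmv'.2.1
    obtain rfl : i = i' := le_antisymm (hij' _ (hm.1 ▸ hi')).1 (hij2' _ (hm.1 ▸ hi)).1
    obtain rfl : j = j' := le_antisymm (hij2' _ (hm.1 ▸ hj)).2 (hij' _ (hm.1 ▸ hj')).2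
    have hi0 := Fin.pos_of_ne_zero (ne_zero_of_mem_beyond hi)
    have hlt := sub_pos.2 (pos_lt_pos hi hj hij hmv.2.2)
    have hlt' := sub_pos.2 (pos_lt_pos hi' hj' hij hmv'.2.2)
    obtain ⟨a, ha⟩ : ∃ a, a = (S'.pos v' j - S'.pos v' i) / (S.pos v j - S.pos v i) := ⟨_, rfl⟩
    have ha' : a * (S.pos v j - S.pos v i) = S'.pos v' j - S'.pos v' i := by
      rw [ha, div_mul_cancel₀ _ hlt.ne']
    refine ⟨a, S'.pos v' i - a * S.pos v i, ha ▸ div_pos hlt' hlt, fun k hk => ?_,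
      fun h => absurd h hv⟩
    obtain ⟨h1, h2⟩ := hij' k hk
    rcases h1.eq_or_lt with rfl | h1
    · ring
    rcases h2.eq_or_lt with rfl | h2
    · linear_combination -ha'
    have e1 := pos_sub_pos_eq hi0 h1 h2 hmv
    have e2 := pos_sub_pos_eq hi0 h1 h2 hmv'
    rw [← h.1 _ _ _ _ hi0 h1 h2, ← ha'] at e2
    linear_combination e2 - a * e1

theorem SameRho.exists_diskIso (h : SameRho S S') {v : S.V} {v' : S'.V} (hm : Matches v v') :
    ∃ f : DiskIso, (∀ k, f (S.branch v k) = S'.branch v' k) ∧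
      (v ∈ S.quilted → f '' S.seam v = S'.seam v') := by
  obtain ⟨a, b, ha, h1, h2⟩ := h.exists_affine hm
  refine ⟨affineIso (S.branch v 0) (S'.branch v' 0) a b ha, fun k => ?_, fun hv => ?_⟩
  · by_cases hk : k ∈ S.beyond v
    · rw [← bdry_pos hk, affineIso_bdry, ← h1 k hk, bdry_pos (hm.1 ▸ hk)]
    · have hk' : k ∉ S'.beyond v' := hm.1 ▸ hk
      rw [mem_beyond, not_not] at hk hk'
      rw [hk, hk', affineIso_infty]
  · have hv' := hm.2.1 hv
    obtain ⟨r0, r1⟩ := S.radius_mem v hv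
    obtain ⟨r0', r1'⟩ := S'.radius_mem v' hv'
    exact affineIso_image_seam _ _ b ha r0 r1 r0' r1' (h2 hv) (S'.seam_subset hv')

theorem Matches.symm {v : S.V} {v' : S'.V} (h : Matches v v') : Matches v' v :=
  ⟨h.1.symm, h.2.symm⟩

theorem Matches.unique {v w : S.V} {v' : S'.V} (h : Matches v v') (h' : Matches w v') : v = w :=
  eq_of_beyond_eq (h.1.trans h'.1.symm) (h.2.trans h'.2.symm)

theorem Matches.farther_iff {u v : S.V} {u' v' : S'.V} (hu : Matches u u') (hv : Matches v v') :
    S.Farther u v ↔ S'.Farther u' v' := by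
  rw [StableQuiltedDisk.farther_iff, StableQuiltedDisk.farther_iff, hu.1, hv.1, hu.2, hv.2]

theorem adj_iff_farther {u v : S.V} : S.graph.Adj u v ↔
    (S.Farther u v ∧ ∀ w, S.Farther u w → ¬ S.Farther w v) ∨
      (S.Farther v u ∧ ∀ w, S.Farther v w → ¬ S.Farther w u) := by
  constructor
  · intro h
    rcases farther_or_farther_of_adj h with h' | h'
    · exact Or.inl ⟨h', h'.adj_iff.1 h⟩
    · exact Or.inr ⟨h', h'.adj_iff.1 h.symm⟩
  · rintro (⟨h, h'⟩ | ⟨h, h'⟩)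
    · exact h.adj_iff.2 h'
    · exact (h.adj_iff.2 h').symm

/-- Matching in both directions is a bijection that preserves the order, hence adjacency. Components
of markings correspond because they are extremal in the order. -/
theorem SameRho.nonempty_iso (h : SameRho S S') : Nonempty (Iso S S') := by
  choose τ hτ using h.exists_matches
  choose τ' hτ' using h.symm.exists_matches
  let e : S.V ≃ S'.V := ⟨τ, τ', fun v => (hτ' (τ v)).symm.unique (hτ v),
    fun v => (hτ (τ' v)).symm.unique (hτ' v)⟩
  have he : ∀ v, Matches v (e v) := hτ
  have hf : ∀ u v, S'.Farther (e u) (e v) ↔ S.Farther u v := fun u v =>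
    ((he u).farther_iff (he v)).symm
  choose d hd hd' using fun v => h.exists_diskIso (he v)
  have hadj : ∀ {u v}, S'.graph.Adj (e u) (e v) ↔ S.graph.Adj u v := by
    intro u v
    rw [adj_iff_farther, adj_iff_farther, ← e.forall_congr_right, ← e.forall_congr_right]
    simp only [hf]
  have hcomp : ∀ i, e (S.comp i) = S'.comp i := by
    intro i
    obtain ⟨w, hw⟩ := e.surjective (S'.comp i)
    rw [← hw]
    by_cases hi : i = 0
    · subst hi
      rcases eq_or_farther_comp_zero (e (S.comp 0)) with h1 | h1
      · rw [h1, hw]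
      · rw [← hw, hf] at h1
        rcases eq_or_farther_comp_zero w with h2 | h2
        · rw [h2]
        · exact absurd h2 h1.asymm
    · have h1 : i ∈ S'.beyond (e (S.comp i)) := (he _).1 ▸ mem_beyond_comp hi
      have h2 : i ∈ S.beyond w := by
        rw [(he w).1, hw]; exact mem_beyond_comp hi
      rcases comp_eq_or_farther h1 with h3 | h3
      · rw [h3, hw]
      · rw [← hw, hf] at h3
        rcases comp_eq_or_farther h2 with h4 | h4
        · rw [h4]
        · exact absurd h4 h3.asymm
  refine ⟨⟨⟨e, hadj⟩, d, ?_, hcomp, ?_, fun v => (he v).2, hd'⟩⟩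
  · intro u v huv
    have huv' : S'.graph.Adj (e u) (e v) := hadj.2 huv
    have e1 : S.node u v = S.dir u v := by rw [dir, S.isTree.step_of_adj huv]
    have e2 : S'.node (e u) (e v) = S'.dir (e u) (e v) := by
      rw [dir, S'.isTree.step_of_adj huv']
    change d u (S.node u v) = S'.node (e u) (e v)
    rw [e1, e2]
    -- Every node is a branch: towards the root the branch of `0`, and away from it the branch of
    -- any marking beyond the neighbour. Disk isomorphisms preserving branches therefore preserve
    -- nodes.
    rcases farther_or_farther_of_adj huv with h1 | h1
    · rw [← h1.branch_zero, ← ((hf _ _).2 h1).branch_zero, hd]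
    · obtain ⟨k, hk⟩ := beyond_nonempty v
      rw [← h1.branch_eq_dir hk, ← ((hf _ _).2 h1).branch_eq_dir ((he v).1 ▸ hk), hd]
  · intro i
    rw [← branch_of_comp_eq (S := S.toNodalDisk) (i := i) rfl, hd]
    rw [branch_of_comp_eq (hcomp i).symm]

end Uniqueness

end StableQuiltedDisk

theorem rhoMap_injective (n : ℕ) : Function.Injective (rhoMap n) := by
  intro x y h
  induction x using Quotient.inductionOn with
  | _ S =>
  induction y using Quotient.inductionOn with
  | _ S' =>
  refine Quotient.sound (StableQuiltedDisk.SameRho.nonempty_iso ⟨?_, ?_⟩)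
  · intro i j k l hij hjk hkl
    exact congrFun (congrArg Prod.fst h) ⟨(i, j, k, l), hij, hjk, hkl⟩
  · intro i j hi hij
    exact congrFun (congrArg Prod.snd h) ⟨(i, j), hi, hij⟩

end QuiltedDisk

end


noncomputable section

namespace QuiltedDisk

open ArchimedeanClass NodalDisk

/-! ### The stable quilted disk of a configuration in an ordered field

The markings `1, …, n` are points of an ordered extension field of the reals. The components are
the closed balls around these points, whose radius is a distance of two points in the ball, or
one; the balls of radius one are quilted. -/

section Construction

variable {n : ℕ} {K : Type} [Field K] [LinearOrder K] [IsStrictOrderedRing K]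

/-- The markings in the closed ball around a marking. -/
def ball (X : Fin (n + 1) → K) (i : Fin (n + 1)) (s : ArchimedeanClass K) : Set (Fin (n + 1)) :=
  {k | k ≠ 0 ∧ s ≤ mk (X k - X i)}

variable {X : Fin (n + 1) → K}

theorem mem_ball_self {i : Fin (n + 1)} (hi : i ≠ 0) (s : ArchimedeanClass K) : i ∈ ball X i s :=
  ⟨hi, by rw [sub_self, mk_zero]; exact le_top⟩

/-- Larger Archimedean classes belong to smaller elements, and `mk` satisfies the ultrametric
inequality; hence every point of a ball is a centre. -/
theorem le_mk_sub_of_mem {i j k : Fin (n + 1)} {s : ArchimedeanClass K} (hj : j ∈ ball X i s)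
    (hk : k ∈ ball X i s) : s ≤ mk (X j - X k) := by
  rw [← sub_sub_sub_cancel_right (X j) (X k) (X i)]
  exact (le_min hj.2 hk.2).trans (min_le_mk_sub _ _)

theorem ball_eq_of_mem {i j : Fin (n + 1)} {s : ArchimedeanClass K} (hj : j ∈ ball X i s) :
    ball X j s = ball X i s := by
  ext k
  refine ⟨fun hk => ⟨hk.1, ?_⟩, fun hk => ⟨hk.1, le_mk_sub_of_mem hk hj⟩⟩
  rw [← sub_add_sub_cancel (X k) (X j) (X i)]
  exact (le_min hk.2 hj.2).trans (min_le_mk_add _ _)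

variable (X) in
/-- A component of the stable quilted disk of a configuration: a ball and its radius. -/
@[ext]
structure Vertex where
  ofBall ::
  set : Set (Fin (n + 1))
  scale : ArchimedeanClass K
  exists_eq_ball : ∃ i ≠ 0, set = ball X i scale
  scale_eq : scale = 0 ∨ ∃ i ∈ set, ∃ j ∈ set, i ≠ j ∧ scale = mk (X i - X j)

namespace Vertex

/-- The scale has to be compared as well: a ball of radius one may contain the same markings as a
smaller ball inside it, and both are components. -/
instance : PartialOrder (Vertex X) where
  le u v := u.set ⊆ v.set ∧ v.scale ≤ u.scale
  le_refl u := ⟨Subset.rfl, le_rfl⟩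
  le_trans u v w h h' := ⟨h.1.trans h'.1, h'.2.trans h.2⟩
  le_antisymm u v h h' := Vertex.ext (h.1.antisymm h'.1) (h'.2.antisymm h.2)

theorem ne_zero_of_mem {v : Vertex X} {i : Fin (n + 1)} (hi : i ∈ v.set) : i ≠ 0 := by
  obtain ⟨j, -, hv⟩ := v.exists_eq_ball
  rw [hv] at hi
  exact hi.1

theorem nonempty (v : Vertex X) : v.set.Nonempty := by
  obtain ⟨j, hj, hv⟩ := v.exists_eq_ball
  exact ⟨j, hv ▸ mem_ball_self hj _⟩

theorem set_eq {v : Vertex X} {i : Fin (n + 1)} (hi : i ∈ v.set) : v.set = ball X i v.scale := by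
  obtain ⟨j, -, hv⟩ := v.exists_eq_ball
  rw [hv] at hi ⊢
  exact (ball_eq_of_mem hi).symm

theorem mem_iff {v : Vertex X} {i k : Fin (n + 1)} (hi : i ∈ v.set) :
    k ∈ v.set ↔ k ≠ 0 ∧ v.scale ≤ mk (X k - X i) := by
  rw [set_eq hi]; rfl

theorem le_mk_sub {v : Vertex X} {i k : Fin (n + 1)} (hi : i ∈ v.set) (hk : k ∈ v.set) :
    v.scale ≤ mk (X k - X i) := ((mem_iff hi).1 hk).2

theorem le_of_scale_le {u v : Vertex X} {i : Fin (n + 1)} (hu : i ∈ u.set) (hv : i ∈ v.set)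
    (h : v.scale ≤ u.scale) : u ≤ v := by
  refine ⟨fun k hk => ?_, h⟩
  rw [mem_iff hv]
  exact ⟨ne_zero_of_mem hk, h.trans (le_mk_sub hu hk)⟩

theorem le_or_le {u v : Vertex X} {i : Fin (n + 1)} (hu : i ∈ u.set) (hv : i ∈ v.set) :
    u ≤ v ∨ v ≤ u :=
  (le_total v.scale u.scale).imp (le_of_scale_le hu hv) (le_of_scale_le hv hu)

theorem scale_lt {u v : Vertex X} (h : u < v) : v.scale < u.scale := by
  refine h.le.2.lt_of_ne fun e => h.not_ge ?_
  obtain ⟨i, hi⟩ := u.nonempty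
  exact le_of_scale_le (h.le.1 hi) hi e.ge

instance : Finite (Vertex X) := by
  have hs : (insert 0 (range fun p : Fin (n + 1) × Fin (n + 1) => mk (X p.1 - X p.2))).Finite :=
    (finite_range _).insert _
  have := hs.to_subtype
  refine Finite.of_injective (β := Set (Fin (n + 1)) × _)
    (fun v : Vertex X => (v.set, (⟨v.scale, ?_⟩ : (insert 0 (range fun p : Fin (n + 1) ×
      Fin (n + 1) => mk (X p.1 - X p.2)) : Set (ArchimedeanClass K))))) fun u v h => ?_
  · rcases v.scale_eq with h | ⟨i, -, j, -, -, h⟩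
    · exact Or.inl h
    · exact Or.inr ⟨(i, j), h.symm⟩
  · simp only [Prod.mk.injEq, Subtype.mk.injEq] at h
    exact Vertex.ext h.1 h.2

/-- The ball of radius one. -/
def unitBall {i : Fin (n + 1)} (hi : i ≠ 0) : Vertex X :=
  ⟨ball X i 0, 0, ⟨i, hi, rfl⟩, Or.inl rfl⟩

/-- The smallest ball containing two different markings. -/
def hull {i j : Fin (n + 1)} (hi : i ≠ 0) (hj : j ≠ 0) (hij : i ≠ j) : Vertex X :=
  ⟨ball X i (mk (X i - X j)), mk (X i - X j), ⟨i, hi, rfl⟩, Or.inr ⟨i, mem_ball_self hi _, j,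
    ⟨hj, (mk_sub_comm _ _).le⟩, hij, rfl⟩⟩

theorem left_mem_hull {i j : Fin (n + 1)} (hi : i ≠ 0) (hj : j ≠ 0) (hij : i ≠ j) :
    i ∈ (hull hi hj hij : Vertex X).set := mem_ball_self hi _

theorem right_mem_hull {i j : Fin (n + 1)} (hi : i ≠ 0) (hj : j ≠ 0) (hij : i ≠ j) :
    j ∈ (hull hi hj hij : Vertex X).set := ⟨hj, (mk_sub_comm _ _).le⟩

theorem hull_lt {v : Vertex X} {i j : Fin (n + 1)} (hi : i ∈ v.set) (hj : j ∈ v.set) (hij : i ≠ j)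
    (h : v.scale < mk (X i - X j)) :
    hull (ne_zero_of_mem hi) (ne_zero_of_mem hj) hij < v := by
  refine lt_of_le_of_ne (le_of_scale_le (left_mem_hull _ _ _) hi h.le) fun e => ?_
  exact h.ne' (congrArg Vertex.scale e)

/-- A ball of greatest radius contains every marking, since the hull of two markings is itself a
component and cannot be larger. -/
theorem exists_top [Nonempty (Vertex X)] : ∃ t : Vertex X, ∀ v, v ≤ t := by
  obtain ⟨t, ht⟩ := Finite.exists_min (fun v : Vertex X => v.scale)
  refine ⟨t, fun v => ?_⟩
  obtain ⟨i, hi⟩ := v.nonempty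
  refine le_of_scale_le hi ?_ (ht v)
  obtain ⟨j, hj⟩ := t.nonempty
  rw [mem_iff hj]
  refine ⟨ne_zero_of_mem hi, ?_⟩
  by_cases hij : i = j
  · rw [hij, sub_self, mk_zero]; exact le_top
  · exact ht (hull (ne_zero_of_mem hi) (ne_zero_of_mem hj) hij)

theorem exists_least {i : Fin (n + 1)} (hi : i ≠ 0) :
    ∃ v : Vertex X, i ∈ v.set ∧ ∀ u : Vertex X, i ∈ u.set → v ≤ u := by
  obtain ⟨v, hv, hmin⟩ := (toFinite {v : Vertex X | i ∈ v.set}).exists_minimal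
    ⟨unitBall hi, mem_ball_self hi _⟩
  exact ⟨v, hv, fun u hu => (le_or_le hv hu).elim id fun h => hmin hu h⟩

theorem isTree [Nonempty (Vertex X)] : (SimpleGraph.hasse (Vertex X)).IsTree := by
  obtain ⟨t, ht⟩ := exists_top (X := X)
  refine hasse_isTree ht fun u v w hv hw => ?_
  obtain ⟨i, hi⟩ := u.nonempty
  exact le_or_le (hv.1 hi) (hw.1 hi)

/-! #### The coordinates on a component -/

/-- Balls of radius one get the unit `1` exactly, not just up to finite factors, so that rescaling
there leaves the seam at height one. -/
theorem exists_unit (hX : ∀ i j, i ≠ 0 → i < j → X i < X j) (v : Vertex X) :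
    ∃ σ : K, 0 < σ ∧ mk σ = v.scale ∧ (v.scale = 0 → σ = 1) := by
  by_cases h : v.scale = 0
  · exact ⟨1, one_pos, h.symm, fun _ => rfl⟩
  · obtain ⟨i, hi, j, hj, hij, hs⟩ := v.scale_eq.resolve_left h
    refine ⟨|X i - X j|, abs_pos.2 (sub_ne_zero.2 ?_), by rw [mk_abs, hs], fun e => absurd e h⟩
    rcases lt_or_gt_of_ne hij with h' | h'
    · exact (hX i j (ne_zero_of_mem hi) h').ne
    · exact (hX j i (ne_zero_of_mem hj) h').ne'

/-- A marking in a ball. -/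
def base (v : Vertex X) : Fin (n + 1) := v.nonempty.some

theorem base_mem (v : Vertex X) : v.base ∈ v.set := v.nonempty.some_mem

variable (hX : ∀ i j, i ≠ 0 → i < j → X i < X j)

/-- An element which has the size of the radius of a ball. -/
def unit (v : Vertex X) : K := (exists_unit hX v).choose

theorem unit_pos (v : Vertex X) : 0 < v.unit hX := (exists_unit hX v).choose_spec.1

theorem mk_unit (v : Vertex X) : mk (v.unit hX) = v.scale := (exists_unit hX v).choose_spec.2.1

theorem unit_eq_one {v : Vertex X} (h : v.scale = 0) : v.unit hX = 1 :=
  (exists_unit hX v).choose_spec.2.2 h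

/-- The rescaled position of a marking. -/
def rescaled (v : Vertex X) (k : Fin (n + 1)) : K := (X k - X v.base) / v.unit hX

theorem mk_div_unit (v : Vertex X) (x : K) : 0 ≤ mk (x / v.unit hX) ↔ v.scale ≤ mk x := by
  have h := v.unit_pos hX
  rw [← mk_unit hX, ← mk_one, mk_le_mk, mk_le_mk]
  simp only [abs_div, abs_one, abs_of_pos h, nsmul_eq_mul, mul_one, div_le_iff₀ h]

theorem mk_div_unit_pos (v : Vertex X) (x : K) : 0 < mk (x / v.unit hX) ↔ v.scale < mk x := by
  have h := v.unit_pos hX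
  rw [← mk_unit hX, ← mk_one, mk_lt_mk, mk_lt_mk]
  simp only [abs_div, abs_one, abs_of_pos h, nsmul_eq_mul, mul_div_assoc', div_lt_one h]

theorem rescaled_nonneg_iff {v : Vertex X} {k : Fin (n + 1)} (hk : k ≠ 0) :
    0 ≤ mk (v.rescaled hX k) ↔ k ∈ v.set := by
  rw [rescaled, mk_div_unit, mem_iff v.base_mem]
  simp [hk]

/-- The coordinate of a marking. -/
def coordinate (v : Vertex X) (k : Fin (n + 1)) : ℝ := stdPart (v.rescaled hX k)

theorem coordinate_sub {v : Vertex X} {k l : Fin (n + 1)} (hk : k ∈ v.set) (hl : l ∈ v.set) :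
    v.coordinate hX k - v.coordinate hX l = stdPart ((X k - X l) / v.unit hX) := by
  rw [coordinate, coordinate, ← stdPart_sub ((rescaled_nonneg_iff hX (ne_zero_of_mem hk)).2 hk)
    ((rescaled_nonneg_iff hX (ne_zero_of_mem hl)).2 hl), rescaled, rescaled, ← sub_div,
    sub_sub_sub_cancel_right]

/-- The standard part identifies two markings exactly when their distance is infinitesimal compared
with the radius. -/
theorem coordinate_eq_iff {v : Vertex X} {k l : Fin (n + 1)} (hk : k ∈ v.set) (hl : l ∈ v.set) :
    v.coordinate hX k = v.coordinate hX l ↔ v.scale < mk (X k - X l) := by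
  rw [← sub_eq_zero, coordinate_sub hX hk hl, stdPart_eq_zero, ← mk_div_unit_pos hX]
  exact ⟨fun h => lt_of_le_of_ne ((mk_div_unit hX _ _).2 (le_mk_sub hl hk)) h.symm, fun h => h.ne'⟩

theorem coordinate_le {v : Vertex X} {k l : Fin (n + 1)} (hk : k ∈ v.set) (hl : l ∈ v.set)
    (h : k < l) : v.coordinate hX k ≤ v.coordinate hX l := by
  rw [← sub_nonneg, coordinate_sub hX hl hk]
  exact stdPart_nonneg (div_nonneg (sub_nonneg.2 (hX k l (ne_zero_of_mem hk) h).le)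
    (v.unit_pos hX).le)

include hX in
theorem mem_of_between {v : Vertex X} {i j k : Fin (n + 1)} (hi : i ∈ v.set) (hk : k ∈ v.set)
    (hij : i < j) (hjk : j < k) : j ∈ v.set := by
  have hj0 : j ≠ 0 := ((Fin.zero_le i).trans_lt hij).ne'
  rw [mem_iff hi]
  refine ⟨hj0, (le_mk_sub hi hk).trans (mk_le_mk_of_abs ?_)⟩
  have h1 := hX i j (ne_zero_of_mem hi) hij
  have h2 := hX j k hj0 hjk
  rw [abs_of_pos (by linarith), abs_of_pos (by linarith)]
  linarith

open Classical in
/-- The boundary point in the direction of a marking. -/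
def point (v : Vertex X) (k : Fin (n + 1)) : Circle :=
  if k ∈ v.set then bdry 1 (v.coordinate hX k) else 1

theorem point_of_mem {v : Vertex X} {k : Fin (n + 1)} (hk : k ∈ v.set) :
    v.point hX k = bdry 1 (v.coordinate hX k) := if_pos hk

theorem point_of_notMem {v : Vertex X} {k : Fin (n + 1)} (hk : k ∉ v.set) :
    v.point hX k = 1 := if_neg hk

theorem point_zero (v : Vertex X) : v.point hX 0 = 1 :=
  point_of_notMem hX fun h => ne_zero_of_mem h rfl

theorem point_eq_one_iff {v : Vertex X} {k : Fin (n + 1)} : v.point hX k = 1 ↔ k ∉ v.set := by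
  refine ⟨fun h hk => ?_, point_of_notMem hX⟩
  rw [point_of_mem hX hk] at h
  exact bdry_ne _ _ h

theorem point_eq_iff {v : Vertex X} {k l : Fin (n + 1)} (hk : k ∈ v.set) (hl : l ∈ v.set) :
    v.point hX k = v.point hX l ↔ v.scale < mk (X k - X l) := by
  rw [point_of_mem hX hk, point_of_mem hX hl, (bdry_injective 1).eq_iff, coordinate_eq_iff hX hk hl]

theorem point_eq_of_lt {u v : Vertex X} (h : u < v) {k l : Fin (n + 1)} (hk : k ∈ u.set)
    (hl : l ∈ u.set) : v.point hX k = v.point hX l := by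
  rw [point_eq_iff hX (h.le.1 hk) (h.le.1 hl)]
  exact (scale_lt h).trans_le (le_mk_sub hl hk)

/-- Markings of a ball with the same boundary point, one of them different, lie in a smaller
ball. -/
theorem exists_lt {v : Vertex X} {k l : Fin (n + 1)} (hk : k ∈ v.set) (hl : l ∈ v.set)
    (hkl : k ≠ l) (h : v.point hX k = v.point hX l) : ∃ w < v, k ∈ w.set ∧ l ∈ w.set :=
  ⟨_, hull_lt hk hl hkl ((point_eq_iff hX hk hl).1 h), left_mem_hull _ _ _, right_mem_hull _ _ _⟩

-- Markings with a common boundary point lie in a proper subball of `u`, and the maximal subball `v`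
-- contains it by nesting. So `v` and `v'` share a marking, are nested, and agree by maximality.
include hX in
theorem eq_of_covBy {v v' u : Vertex X} (h : v ⋖ u) (h' : v' ⋖ u) {k k' : Fin (n + 1)}
    (hk : k ∈ v.set) (hk' : k' ∈ v'.set) (he : u.point hX k = u.point hX k') : v = v' := by
  have key : ∀ j, j ∈ v.set → j ∈ v'.set → v = v' := by
    intro j hj hj'
    rcases le_or_le hj hj' with h1 | h1
    · exact (h.eq_or_eq h1 h'.le).elim Eq.symm fun e => absurd e h'.ne
    · exact (h'.eq_or_eq h1 h.le).elim id fun e => absurd e h.ne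
  by_cases hkk : k = k'
  · exact key k hk (hkk ▸ hk')
  · obtain ⟨w, hw, h1, h2⟩ := exists_lt hX (h.le.1 hk) (h'.le.1 hk') hkk he
    refine key k' ?_ hk'
    rcases le_or_le hk h1 with h3 | h3
    · rcases h.eq_or_eq h3 hw.le with e | e
      · exact e ▸ h2
      · exact absurd e hw.ne
    · exact h3.1 h2

end Vertex

end Construction

end QuiltedDisk

end


/-! ### The tree of balls as a stable quilted disk -/

noncomputable section

namespace QuiltedDisk

open ArchimedeanClass NodalDisk

section Construction

variable {n : ℕ} {K : Type} [Field K] [LinearOrder K] [IsStrictOrderedRing K]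
  {X : Fin (n + 1) → K}

namespace Vertex

section Component

variable [Nonempty (Vertex X)]

open Classical in
variable (X) in
/-- The component of a marking: the largest ball for the marking `0`, and the smallest ball around
any other marking. -/
def component (i : Fin (n + 1)) : Vertex X :=
  if hi : i = 0 then (exists_top (X := X)).choose else (exists_least (X := X) hi).choose

theorem le_component_zero (v : Vertex X) : v ≤ component X 0 := by
  rw [component, dif_pos rfl]
  exact exists_top.choose_spec v

theorem component_le_iff {i : Fin (n + 1)} (hi : i ≠ 0) {v : Vertex X} :
    component X i ≤ v ↔ i ∈ v.set := by
  rw [component, dif_neg hi]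
  exact ⟨fun h => h.1 (exists_least hi).choose_spec.1, (exists_least hi).choose_spec.2 v⟩

theorem mem_component {i : Fin (n + 1)} (hi : i ≠ 0) : i ∈ (component X i).set :=
  (component_le_iff hi).1 le_rfl

end Component

variable (hX : ∀ i j, i ≠ 0 → i < j → X i < X j)

open Classical in
/-- The node of a component in the direction of an adjacent component. -/
def nodeTowards (u v : Vertex X) : Circle := if v < u then u.point hX v.base else 1

theorem nodeTowards_of_lt {u v : Vertex X} (h : v < u) :
    nodeTowards hX u v = u.point hX v.base := if_pos h

theorem nodeTowards_of_gt {u v : Vertex X} (h : u < v) : nodeTowards hX u v = 1 :=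
  if_neg h.not_gt

theorem nodeTowards_ne_one {u v : Vertex X} (h : v < u) : nodeTowards hX u v ≠ 1 := by
  rw [nodeTowards_of_lt hX h, Ne, point_eq_one_iff, not_not]
  exact h.le.1 v.base_mem

/-- Covers of `u` are unique because balls around a common marking are nested; the smaller
neighbours are told apart by `eq_of_covBy`, and only the larger one is placed at infinity. -/
theorem nodeTowards_inj {u v v' : Vertex X} (h : (SimpleGraph.hasse (Vertex X)).Adj u v)
    (h' : (SimpleGraph.hasse (Vertex X)).Adj u v') (he : nodeTowards hX u v = nodeTowards hX u v') :
    v = v' := by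
  rcases h with h | h <;> rcases h' with h' | h'
  · obtain ⟨i, hi⟩ := u.nonempty
    rcases le_or_le (h.le.1 hi) (h'.le.1 hi) with hv | hv
    · exact (h'.eq_or_eq h.le hv).resolve_left h.ne'
    · exact ((h.eq_or_eq h'.le hv).resolve_left h'.ne').symm
  · rw [nodeTowards_of_gt hX h.lt] at he
    exact absurd he.symm (nodeTowards_ne_one hX h'.lt)
  · rw [nodeTowards_of_gt hX h'.lt] at he
    exact absurd he (nodeTowards_ne_one hX h.lt)
  · rw [nodeTowards_of_lt hX h.lt, nodeTowards_of_lt hX h'.lt] at he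
    exact eq_of_covBy hX h h' v.base_mem v'.base_mem he

variable [Nonempty (Vertex X)]

/-- Another marking at the same boundary point would produce a ball around `i` smaller than the
smallest one. -/
theorem point_component_ne {i j : Fin (n + 1)} (hi : i ≠ 0) (hij : i ≠ j) :
    (component X i).point hX i ≠ (component X i).point hX j := fun h => by
  have hm : i ∈ (component X i).set := mem_component hi
  by_cases hj : j ∈ (component X i).set
  · obtain ⟨w, hw, h1, -⟩ := exists_lt hX hm hj hij h
    exact hw.not_ge ((component_le_iff hi).2 h1)
  · rw [point_of_notMem hX hj, point_eq_one_iff] at h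
    exact h hm

theorem nodeTowards_ne_point {v : Vertex X} {i : Fin (n + 1)}
    (h : (SimpleGraph.hasse (Vertex X)).Adj (component X i) v) :
    nodeTowards hX (component X i) v ≠ (component X i).point hX i := by
  by_cases hi : i = 0
  · subst hi
    rw [point_zero]
    rcases h with h | h
    · exact absurd (le_component_zero v) h.lt.not_ge
    · exact nodeTowards_ne_one hX h.lt
  · rcases h with h | h
    · rw [nodeTowards_of_gt hX h.lt]
      intro e
      exact (point_eq_one_iff hX).1 e.symm (mem_component hi)
    · rw [nodeTowards_of_lt hX h.lt]
      refine (point_component_ne hX hi ?_).symm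
      intro e
      exact h.lt.not_ge ((component_le_iff hi).2 (by rw [e]; exact v.base_mem))

variable (X) in
/-- The nodal disk of a configuration. -/
def nodalDisk : NodalDisk n where
  V := Vertex X
  finite := inferInstance
  graph := SimpleGraph.hasse (Vertex X)
  isTree := isTree
  node := nodeTowards hX
  comp := component X
  mark i := (component X i).point hX i
  node_inj := nodeTowards_inj hX
  mark_inj {i j} h h' := by
    by_contra hij
    by_cases hi : i = 0
    · have hj : j ≠ 0 := fun e => hij (hi.trans e.symm)
      refine point_component_ne hX hj (Ne.symm hij) ?_
      rw [← h', h]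
    · refine point_component_ne hX hi hij ?_
      rw [h', h]
  node_ne_mark {u v i} h h' := by
    subst h'
    exact nodeTowards_ne_point hX h

/-- Paths in the tree of balls descend towards the markings of a ball and ascend towards all others.
Thus branches, defined by paths, are given by the explicit boundary points. -/
theorem branch_nodalDisk (v : Vertex X) (i : Fin (n + 1)) :
    (nodalDisk X hX).branch v i = v.point hX i := by
  by_cases hc : component X i = v
  · refine (branch_of_comp_eq (S := nodalDisk X hX) hc).trans ?_
    rw [← hc]; rfl
  · refine (branch_of_comp_ne (S := nodalDisk X hX) hc).trans ?_
    by_cases hi : i ∈ v.set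
    · have hi0 := ne_zero_of_mem hi
      obtain ⟨u, hu, huv⟩ := exists_le_covBy_of_lt
        (lt_of_le_of_ne ((component_le_iff hi0).2 hi) hc)
      have hs : (nodalDisk X hX).isTree.step v (component X i) = u :=
        step_hasse_of_covBy isTree huv hu
      change nodeTowards hX v ((nodalDisk X hX).isTree.step v (component X i)) = _
      rw [hs, nodeTowards_of_lt hX huv.lt]
      exact point_eq_of_lt hX huv.lt u.base_mem (hu.1 (mem_component hi0))
    · have hle : ¬ component X i ≤ v := by
        by_cases hi0 : i = 0
        · subst hi0
          exact fun h => hc (h.antisymm (le_component_zero v))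
        · rwa [component_le_iff hi0]
      have hv : v ≠ component X 0 := fun e => hle (e ▸ le_component_zero _)
      obtain ⟨u, hu, -⟩ := exists_covBy_le_of_lt (lt_of_le_of_ne (le_component_zero v) hv)
      have hs : (nodalDisk X hX).isTree.step v (component X i) = u :=
        step_hasse_of_not_le le_component_zero isTree hu hle
      change nodeTowards hX v ((nodalDisk X hX).isTree.step v (component X i)) = _
      rw [hs, nodeTowards_of_gt hX hu.lt, point_of_notMem hX hi]

theorem branch_ne_nodalDisk (v : Vertex X) (i : Fin (n + 1)) :
    (nodalDisk X hX).branch v i ≠ (nodalDisk X hX).branch v 0 ↔ i ∈ v.set := by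
  refine (not_congr (Eq.congr (branch_nodalDisk hX v i) (branch_nodalDisk hX v 0))).trans ?_
  rw [point_zero, point_eq_one_iff, not_not]

/-- Markings outside the ball all share the point at infinity, so at most one of the three is
outside, and by convexity it is not the middle one. Standard parts preserve the weak order;
distinctness makes it strict. -/
theorem ordered_nodalDisk : (nodalDisk X hX).Ordered := by
  intro v i j k hij hjk h1 h2 h3
  have hb : ∀ m, (nodalDisk X hX).branch v m = v.point hX m := branch_nodalDisk hX v
  rw [hb, hb] at h1 h2 h3
  rw [hb, hb, hb]
  have hlt : ∀ {a b}, a ∈ Vertex.set v → b ∈ Vertex.set v → a < b → v.point hX a ≠ v.point hX b →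
      v.coordinate hX a < v.coordinate hX b := by
    intro a b ha hb' hab hne
    refine lt_of_le_of_ne (coordinate_le hX ha hb' hab) fun e => hne ?_
    rw [point_of_mem hX ha, point_of_mem hX hb', e]
  by_cases hi : i ∈ Vertex.set v
  · by_cases hk : k ∈ Vertex.set v
    · have hj := mem_of_between hX hi hk hij hjk
      have a1 := hlt hi hj hij h1
      have a2 := hlt hj hk hjk h2
      rw [point_of_mem hX hi, point_of_mem hX hj, point_of_mem hX hk]
      exact ccw_bdry_bdry a1 a2
    · have hj : j ∈ Vertex.set v := by
        by_contra hj
        rw [point_of_notMem hX hj, point_of_notMem hX hk] at h2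
        exact h2 rfl
      rw [point_of_mem hX hi, point_of_mem hX hj, point_of_notMem hX hk]
      exact ((ccw_bdry_iff 1).2 (hlt hi hj hij h1)).rotate
  · have hj : j ∈ Vertex.set v := by
      by_contra hj
      rw [point_of_notMem hX hi, point_of_notMem hX hj] at h1
      exact h1 rfl
    have hk : k ∈ Vertex.set v := by
      by_contra hk
      rw [point_of_notMem hX hi, point_of_notMem hX hk] at h3
      exact h3 rfl
    rw [point_of_notMem hX hi, point_of_mem hX hj, point_of_mem hX hk]
    exact (ccw_bdry_iff 1).2 (hlt hj hk hjk h2)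

theorem two_le_numSpecial_nodalDisk (v : Vertex X) : 2 ≤ (nodalDisk X hX).numSpecial v := by
  refine le_trans ?_ (ncard_range_branch_le (S := nodalDisk X hX) v)
  have hne : v.point hX v.base ≠ 1 := by
    rw [Ne, point_eq_one_iff, not_not]; exact v.base_mem
  rw [← ncard_pair hne]
  refine ncard_le_ncard ?_ (finite_range _)
  rintro _ (rfl | rfl)
  · exact ⟨v.base, branch_nodalDisk hX v _⟩
  · exact ⟨0, (branch_nodalDisk hX v 0).trans (point_zero hX v)⟩

/-- The radius is attained by two markings, whose coordinates therefore differ; infinity is the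
third special point. -/
theorem three_le_numSpecial_nodalDisk {v : Vertex X} (hv : v.scale ≠ 0) :
    3 ≤ (nodalDisk X hX).numSpecial v := by
  refine le_trans ?_ (ncard_range_branch_le (S := nodalDisk X hX) v)
  obtain ⟨i, hi, j, hj, -, hs⟩ := v.scale_eq.resolve_left hv
  have hne : ∀ {k}, k ∈ v.set → v.point hX k ≠ 1 := fun hk => by
    rwa [Ne, point_eq_one_iff, not_not]
  have hij : v.point hX i ≠ v.point hX j := by
    rw [Ne, point_eq_iff hX hi hj, hs]; exact lt_irrefl _
  have h3 : ({v.point hX i, v.point hX j, 1} : Set Circle).ncard = 3 :=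
    ncard_eq_three.2 ⟨_, _, _, hij, hne hi, hne hj, rfl⟩
  rw [← h3]
  refine ncard_le_ncard ?_ (finite_range _)
  rintro _ (rfl | rfl | rfl)
  · exact ⟨i, branch_nodalDisk hX v _⟩
  · exact ⟨j, branch_nodalDisk hX v _⟩
  · exact ⟨0, (branch_nodalDisk hX v 0).trans (point_zero hX v)⟩

variable (X) in
/-- The stable nodal quilted disk of a configuration. -/
def quiltedDisk : StableQuiltedDisk n where
  toNodalDisk := nodalDisk X hX
  ordered := ordered_nodalDisk hX
  quilted := {v : Vertex X | v.scale = 0}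
  -- This is the seam at height one in the half plane.
  radius _ := 1 / 2
  radius_mem _ _ := by norm_num
  colored i hi := by
    have key : ∀ v : (nodalDisk X hX).V, v ∈ ((nodalDisk X hX).path ((nodalDisk X hX).comp i)
        ((nodalDisk X hX).comp 0)).support ↔ i ∈ Vertex.set v := fun v =>
      (mem_support_path_iff hi).trans (branch_ne_nodalDisk hX v i)
    refine ⟨(unitBall hi : Vertex X), ⟨rfl, (key _).2 (mem_ball_self hi _)⟩, ?_⟩
    rintro v ⟨h1, h2⟩
    have h3 := (key v).1 h2
    exact (le_of_scale_le (u := v) (v := unitBall hi) h3 (mem_ball_self hi _)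
      (le_of_eq h1.symm)).antisymm (le_of_scale_le (mem_ball_self hi _) h3 (le_of_eq h1))
  stable_quilted v _ := two_le_numSpecial_nodalDisk hX v
  stable_unquilted v hv := three_le_numSpecial_nodalDisk hX hv

theorem mem_beyond_quiltedDisk {v : Vertex X} {i : Fin (n + 1)} :
    i ∈ (quiltedDisk X hX).beyond v ↔ i ∈ v.set := branch_ne_nodalDisk hX v i

theorem pos_quiltedDisk {v : Vertex X} {i : Fin (n + 1)} (hi : i ∈ v.set) :
    (quiltedDisk X hX).pos v i = v.coordinate hX i := by
  refine (congrArg₂ coord (branch_nodalDisk hX v 0) (branch_nodalDisk hX v i)).trans ?_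
  rw [point_zero, point_of_mem hX hi, coord_bdry]

/-- If `u` is not inside `v`, the path from `v` to `u` begins upwards, at the node towards the root.
-/
theorem lt_of_farther_quiltedDisk {u v : Vertex X} (h : (quiltedDisk X hX).Farther u v) :
    u < v := by
  refine lt_of_le_of_ne ?_ h.1.symm
  by_contra hle
  have hv : v ≠ component X 0 := fun e => hle (e ▸ le_component_zero _)
  obtain ⟨w, hw, -⟩ := exists_covBy_le_of_lt (lt_of_le_of_ne (le_component_zero v) hv)
  have hs : (nodalDisk X hX).isTree.step v u = w :=
    step_hasse_of_not_le le_component_zero isTree hw hle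
  refine h.2 (Eq.trans ?_ ((branch_nodalDisk hX v 0).trans (point_zero hX v)).symm)
  change nodeTowards hX v ((nodalDisk X hX).isTree.step v u) = _
  rw [hs, nodeTowards_of_gt hX hw.lt]

end Vertex

end Construction

end QuiltedDisk

end


noncomputable section

namespace QuiltedDisk

open ArchimedeanClass Filter Topology

/-! ### Limits along ultrafilters -/

section Germ

variable {α : Type} {U : Ultrafilter α}

theorem germ_abs_coe (g : α → ℝ) :
    |(g : Germ (U : Filter α) ℝ)| = ((fun t => |g t| : α → ℝ) : Germ (U : Filter α) ℝ) := by
  rw [Germ.abs_def]; rfl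

variable (U) in
/-- The embedding of the real numbers into the hyperreal numbers of an ultrafilter. -/
def constGerm : ℝ →+*o Germ (U : Filter α) ℝ where
  toFun r := (r : Germ (U : Filter α) ℝ)
  map_one' := rfl
  map_mul' _ _ := rfl
  map_zero' := rfl
  map_add' _ _ := rfl
  monotone' r s h := by
    rcases h.eq_or_lt with rfl | h
    · exact le_rfl
    · exact (Germ.const_lt h).le

theorem constGerm_apply (r : ℝ) :
    constGerm U r = ((fun _ => r : α → ℝ) : Germ (U : Filter α) ℝ) := rfl

/-- Comparing a finite germ with a real constant means comparing the functions eventually along the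
ultrafilter; the standard part is the cut this defines. -/
theorem tendsto_of_mk_nonneg {g : α → ℝ} (h : 0 ≤ mk (g : Germ (U : Filter α) ℝ)) :
    Tendsto g U (𝓝 (stdPart (g : Germ (U : Filter α) ℝ))) := by
  refine tendsto_order.2 ⟨fun r hr => ?_, fun r hr => ?_⟩
  · have := lt_of_lt_stdPart (constGerm U) h hr
    rw [constGerm_apply, Germ.coe_lt] at this
    exact this
  · have := lt_of_stdPart_lt (constGerm U) h hr
    rw [constGerm_apply, Germ.coe_lt] at this
    exact this

theorem tendsto_abs_of_mk_neg {g : α → ℝ} (h : mk (g : Germ (U : Filter α) ℝ) < 0) :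
    Tendsto (fun t => |g t|) U atTop := by
  rw [← mk_one, mk_lt_mk] at h
  refine tendsto_atTop.2 fun r => ?_
  obtain ⟨m, hm⟩ := exists_nat_ge r
  have h1 := h m
  rw [abs_one, nsmul_eq_mul, mul_one, germ_abs_coe, ← map_natCast (constGerm U),
    constGerm_apply, Germ.coe_lt] at h1
  filter_upwards [h1] with t ht
  exact hm.trans ht.le

end Germ

namespace Vertex

variable {n : ℕ} {α : Type} {U : Ultrafilter α}

/-- The configuration of germs of a family of real configurations. -/
def germs (U : Ultrafilter α) (x : α → Fin (n + 1) → ℝ) (k : Fin (n + 1)) :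
    Germ (U : Filter α) ℝ := ((fun t => x t k : α → ℝ) : Germ (U : Filter α) ℝ)

theorem germs_lt {x : α → Fin (n + 1) → ℝ} (hx : ∀ᶠ t in (U : Filter α), Increasing (x t))
    (i j : Fin (n + 1)) (hi : i ≠ 0) (hij : i < j) : germs U x i < germs U x j :=
  Germ.coe_lt.2 (hx.mono fun _ h => h i j (Fin.pos_of_ne_zero hi) hij)

/-- The required rescalings are representatives of the germ that normalizes a ball. Rescaled
markings are finite germs inside the ball, converging to their standard parts, and infinite germs
outside. -/
theorem isLimit_quiltedDisk {x : α → Fin (n + 1) → ℝ} [Nonempty (Vertex (germs U x))]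
    (hX : ∀ i j, i ≠ 0 → i < j → germs U x i < germs U x j) :
    (quiltedDisk (germs U x) hX).IsLimit x (U : Filter α) := by
  suffices h : ∀ v : Vertex (germs U x), ∃ a b : α → ℝ, (∀ᶠ t in (U : Filter α), 0 < a t) ∧
      (∀ k ∈ v.set, Tendsto (fun t => a t * x t k + b t) U (𝓝 (v.coordinate hX k))) ∧
      (∀ k, k ≠ 0 → k ∉ v.set → Tendsto (fun t => |a t * x t k + b t|) U atTop) ∧
      (v.scale = 0 → Tendsto a U (𝓝 1)) ∧ (0 < v.scale → Tendsto a U atTop) ∧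
      (v.scale < 0 → Tendsto a U (𝓝 0)) by
    intro v
    obtain ⟨a, b, h0, h1, h2, h3, h4, h5⟩ := h v
    have hv : ∀ k, k ∈ (quiltedDisk (germs U x) hX).beyond v ↔ k ∈ Vertex.set v :=
      fun k => mem_beyond_quiltedDisk hX
    refine ⟨a, b, h0, fun k hk => ?_, fun k hk hk' => h2 k hk ((hv k).not.1 hk'), fun hq => ?_,
      fun w hw hvw => h4 ?_, fun w hw hwv => h5 ?_⟩
    · exact (pos_quiltedDisk hX ((hv k).1 hk)).symm ▸ h1 k ((hv k).1 hk)
    · have : (quiltedDisk (germs U x) hX).height v = 1 := by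
        change 1 / (1 / 2 : ℝ) - 1 = 1
        norm_num
      rw [this]
      exact h3 hq
    · exact (show Vertex.scale w = 0 from hw) ▸ scale_lt (lt_of_farther_quiltedDisk hX hvw)
    · exact (show Vertex.scale w = 0 from hw) ▸ scale_lt (lt_of_farther_quiltedDisk hX hwv)
  intro v
  have hu := v.unit_pos hX
  -- The germ of `a` is the inverse of the unit: it is infinite, one or infinitesimal according to
  -- whether the radius is infinitesimal, one or infinite.
  obtain ⟨a, ha⟩ : ∃ a : α → ℝ, (a : Germ (U : Filter α) ℝ) = 1 / v.unit hX := Quot.exists_rep _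
  obtain ⟨b, hb⟩ : ∃ b : α → ℝ, (b : Germ (U : Filter α) ℝ) =
    -(germs U x v.base / v.unit hX) := Quot.exists_rep _
  have hpos : ∀ᶠ t in (U : Filter α), 0 < a t := by
    rw [← Germ.coe_pos, ha]
    exact one_div_pos.2 hu
  have key : ∀ k, ((fun t => a t * x t k + b t : α → ℝ) : Germ (U : Filter α) ℝ) =
      v.rescaled hX k := fun k => by
    change (a : Germ (U : Filter α) ℝ) * germs U x k + b = _
    rw [ha, hb, rescaled]
    ring
  refine ⟨a, b, hpos, fun k hk => ?_, fun k hk hk' => ?_, fun h => ?_, fun h => ?_, fun h => ?_⟩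
  · rw [coordinate, ← key]
    refine tendsto_of_mk_nonneg ?_
    rw [key, rescaled_nonneg_iff hX (ne_zero_of_mem hk)]
    exact hk
  · refine tendsto_abs_of_mk_neg ?_
    rw [key, ← not_le, rescaled_nonneg_iff hX hk]
    exact hk'
  · have h1 : (a : Germ (U : Filter α) ℝ) = 1 := by rw [ha, unit_eq_one hX h, div_one]
    have h2 := tendsto_of_mk_nonneg (U := U) (g := a) (by rw [h1, mk_one])
    rwa [h1, stdPart_one] at h2
  · have h1 : mk (a : Germ (U : Filter α) ℝ) < 0 := by
      rw [ha, ← not_le, mk_div_unit, mk_one]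
      exact h.not_ge
    refine (tendsto_abs_of_mk_neg h1).congr' ?_
    filter_upwards [hpos] with t ht using abs_of_pos ht
  · have h1 : 0 < mk (a : Germ (U : Filter α) ℝ) := by
      rwa [ha, mk_div_unit_pos, mk_one]
    have h2 := tendsto_of_mk_nonneg h1.le
    rwa [stdPart_eq_zero.2 h1.ne'] at h2

end Vertex

/-! ### The image of the moduli space -/

/-- An ultrafilter on configurations plays the role of a convergent sequence. Its germs define a
stable quilted disk, whose value agrees with the given limit because limits in the product are
unique. -/
theorem closure_subset_range_rhoMap {n : ℕ} (hn : n ≠ 0) :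
    closure (realRhoMap n '' {x | Increasing x}) ⊆ range (rhoMap n) := by
  intro y hy
  obtain ⟨W, hW, hWy⟩ := mem_closure_iff_ultrafilter.1 hy
  have hU := Ultrafilter.ofComapInfPrincipal_eq_of_map hW
  have hx := Ultrafilter.ofComapInfPrincipal_mem hW
  generalize Ultrafilter.ofComapInfPrincipal hW = U at hU hx
  have hx' : ∀ᶠ x in (U : Filter (Fin (n + 1) → ℝ)), Increasing x := hx
  have hX := Vertex.germs_lt (U := U) (x := fun x => x) hx'
  have : NeZero n := ⟨hn⟩
  have h1 : (Fin.last n) ≠ 0 := Fin.last_pos'.ne'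
  -- A nonzero marking is needed here; the ball of radius one around it is a component.
  have : Nonempty (Vertex (Vertex.germs U fun x : Fin (n + 1) → ℝ => x)) :=
    ⟨Vertex.unitBall h1⟩
  have hl := (Vertex.isLimit_quiltedDisk hX).tendsto_rhoMap hx'
  refine ⟨_, tendsto_nhds_unique hl ?_⟩
  rw [← hU] at hWy
  exact hWy

theorem range_rhoMap {n : ℕ} (hn : n ≠ 0) :
    range (rhoMap n) = closure (realRhoMap n '' {x | Increasing x}) :=
  (range_rhoMap_subset n).antisymm (closure_subset_range_rhoMap hn)

/-- The bounds hold on real configurations and are closed conditions, so they pass to the closure,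
which contains the image. -/
theorem rhoMap_mem_Icc (n : ℕ) (x : Moduli n) :
    (∀ q, (rhoMap n x).1 q ∈ Icc (⊥ : EReal) 0) ∧ ∀ p, (rhoMap n x).2 p ∈ Icc (0 : EReal) ⊤ := by
  have hc : IsClosed {y : (Quad n → EReal) × (Pair n → EReal) |
      (∀ q, y.1 q ∈ Icc (⊥ : EReal) 0) ∧ ∀ p, y.2 p ∈ Icc (0 : EReal) ⊤} := by
    simp only [ofPred_and, ofPred_forall]
    refine (isClosed_iInter fun q => isClosed_Icc.preimage (by fun_prop)).inter
      (isClosed_iInter fun p => isClosed_Icc.preimage (by fun_prop))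
  refine closure_minimal ?_ hc (range_rhoMap_subset n (mem_range_self x))
  rintro _ ⟨x, hx, rfl⟩
  refine ⟨fun q => ⟨bot_le, ?_⟩, fun p => ⟨?_, le_top⟩⟩
  · exact EReal.coe_nonpos.2 (realRho_neg hx q.2.1 q.2.2.1 q.2.2.2).le
  · exact EReal.coe_nonneg.2 (one_div_nonneg.2 (sub_nonneg.2 (hx _ _ p.2.1 p.2.2).le))

end QuiltedDisk

end

theorem mainTheorem6 (n : ℕ) (hn : 2 ≤ n) :
    (∀ x : QuiltedDisk.Moduli n,
      (∀ q, (QuiltedDisk.rhoMap n x).1 q ∈ Set.Icc (⊥ : EReal) 0) ∧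
      (∀ p, (QuiltedDisk.rhoMap n x).2 p ∈ Set.Icc (0 : EReal) ⊤)) ∧
    Function.Injective (QuiltedDisk.rhoMap n) ∧
    IsClosed (Set.range (QuiltedDisk.rhoMap n)) ∧
    CompactSpace (QuiltedDisk.Moduli n) ∧
    T2Space (QuiltedDisk.Moduli n) := by
  have hcl : IsClosed (Set.range (QuiltedDisk.rhoMap n)) := by
    rw [QuiltedDisk.range_rhoMap (by omega)]
    exact isClosed_closure
  have hinj := QuiltedDisk.rhoMap_injective n
  -- The topology is induced by definition, so injectivity and closed range suffice; compactness and
  -- separation are inherited from the product of copies of `EReal`.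
  have hemb : Topology.IsClosedEmbedding (QuiltedDisk.rhoMap n) := ⟨⟨⟨rfl⟩, hinj⟩, hcl⟩
  exact ⟨QuiltedDisk.rhoMap_mem_Icc n, hinj, hcl, hemb.compactSpace, hemb.isEmbedding.t2Space⟩
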